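/- **Setting.** For $\Omega'\subseteq\mathbb R^n$ put $T_{\Omega'}=\mathbb R^n+i\Omega'\subseteq\mathbb C^n$, and write $\langle z,\lambda\rangle=\sum_k z_k\lambda_k$ for $z\in\mathbb C^n$, $\lambda\in\mathbb R^n$. Let $HAP(\mathbb C^n,\mathbb C^m)$ be the space of holomorphic almost periodic mappings, i.e. the entire mappings $F=(f_1,\dots,f_m):\mathbb C^n\to\mathbb C^m$ such that for every $\varepsilon>0$ and every bounded $\Omega'\subseteq\mathbb R^n$ there are $t_1,\dots,t_n>0$ such that for each $\xi\in\mathbb R^n$ the box $\{x\in\mathbb R^n:|x_k-\xi_k|<t_k,\ 1\le k\le n\}$ contains a point $\tau$ with $\sup_{z\in T_{\Omega'}}\max_\ell|f_\ell(z+\tau)-f_\ell(z)|<\varepsilon$. It carries the topology of uniform convergence on the tubes $T_{\Omega'}$ with $\Omega'$ bounded. Each component $f=f_\ell$ has a Bohr transform $$a(\lambda,f)=\lim_{s\to+\infty}\frac1{(2s)^n}\int_{|x_k|<s}e^{-i\langle x,\lambda\rangle}f(x)\,dx\qquad(\lambda\in\mathbb R^n)$$ and a spectrum $\mathrm{Sp}\,f=\{\lambda\in\mathbb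 R^n: a(\lambda,f)\ne0\}$. Let $\Xi_F$ be the additive subgroup of $\mathbb R^n$ generated by $\bigcup_\ell \mathrm{Sp}\,f_\ell$, and let $\mathrm{lin}_{\mathbb Q}\Xi_F$, $\mathrm{lin}_{\mathbb R}\Xi_F$ be the $\mathbb Q$-linear and $\mathbb R$-linear subspaces of $\mathbb R^n$ that it generates. Fix a (finite or infinite) sequence $\omega_1,\omega_2,\dots$ that is a basis of $\mathrm{lin}_{\mathbb Q}\Xi_F$, and let $Q_j(F)=(Q_j(f_1),\dots,Q_j(f_m))$ be the Bochner–Fejér approximations $$Q_j(f)(z)=\sum_{\nu}\ \prod_{r\le j}\Bigl(1-\frac{|\nu_r|}{(j!)^2}\Bigr)\,a\Bigl(\sum_{r\le j}\nu_r\frac{\omega_r}{j!},f\Bigr)\exp\Bigl(i\Bigl\langle z,\sum_{r\le j}\nu_r\frac{\omega_r}{j!}\Bigr\rangle\Bigr),$$ where $\nu$ runs over the tuples of integers $\nu_r$ with $|\nu_r|\le(j!)^2$ (and $r$ over the indices $\le j$ of the sequence). Fix also an additive subgroup $\mathbb G\subseteq\mathbb R^n$ containing $\bigcup_\ell\mathrm{Sp}\,f_\ell$.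 For a character $\chi\in\mathrm{Ch}\,\mathbb G=\mathrm{Hom}(\mathbb G,\mathbb S^1)$ (no continuity required), the perturbation of an exponential sum $f$ with $\mathrm{Sp}\,f\subseteq\mathbb G$ is $f_\chi(z)=\sum_{\lambda\in\mathrm{Sp}\,f}a(\lambda,f)\chi(\lambda)e^{i\langle z,\lambda\rangle}$, and that of $F$ is $F_\chi=\lim_{j\to\infty}Q_j(F)_\chi$, the limit (perturbing componentwise) being taken in $HAP(\mathbb C^n,\mathbb C^m)$. With $V(\cdot)$ the zero set and $\mathrm{Im}:\mathbb C^n\to\mathbb R^n$ the componentwise imaginary part, put $$\mathcal F_F=\overline{\mathrm{Im}\,V(F)},\qquad \mathcal Y_F=\bigcup_{\chi\in\mathrm{Ch}\,\mathbb G}\mathrm{Im}\,V(F_\chi).$$ **Lemma 4.3.** Let $F\in HAP(\mathbb C^n,\mathbb C^m)$. If $\Xi_F$ is a free $\mathbb Z$-module of finite rank and its rank equals $\dim_{\mathbb R}\mathrm{lin}_{\mathbb R}\Xi_F$, then, whatever the choice of the basis $(\omega_r)$ and of the group $\mathbb G$, $$\mathcal Y_F=\mathrm{Im}\,V(F)=\mathcal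 F_F;$$ thus $\mathrm{Im}\,V(F)$ is closed. In particular, this holds whenever $\Xi_F$ is a finitely generated subgroup of $\mathbb Q^n$. -/

import Mathlib

open Filter Topology MeasureTheory
open scoped Nat

noncomputable section

/-- The map `Im : ℂⁿ → ℝⁿ` taking imaginary parts componentwise. -/
def imPart {n : ℕ} (z : Fin n → ℂ) : Fin n → ℝ := fun k => (z k).im

/-- The translate `z + t` of a point `z ∈ ℂⁿ` by a real vector `t ∈ ℝⁿ`. -/
def realShift {n : ℕ} (z : Fin n → ℂ) (t : Fin n → ℝ) : Fin n → ℂ := fun k => z k + (t k : ℂ)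

/-- The pairing `⟨z, l⟩ = ∑ₖ zₖ lₖ` of `z ∈ ℂⁿ` with a real vector `l ∈ ℝⁿ`. -/
def pairing {n : ℕ} (z : Fin n → ℂ) (l : Fin n → ℝ) : ℂ := ∑ k, z k * (l k : ℂ)

/-- The tube `ℝⁿ + i Ω` over the base `Ω ⊆ ℝⁿ`. -/
def tube {n : ℕ} (Ω : Set (Fin n → ℝ)) : Set (Fin n → ℂ) := {z | imPart z ∈ Ω}

/-- `F : ℂⁿ → ℂᵐ` belongs to `HAP(ℂⁿ, ℂᵐ)`: it is entire and, for every `ε > 0` and every bounded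
(i.e. relatively compact) base `Ω ⊆ ℝⁿ`, there are side lengths `t` such that every open box
`{x : |xₖ - ξₖ| < tₖ}` contains an `ε`-almost period of `F` on the tube over `Ω`. -/
structure IsHAP {n m : ℕ} (F : (Fin n → ℂ) → (Fin m → ℂ)) : Prop where
  holomorphic : Differentiable ℂ F
  almostPeriodic : ∀ ε : ℝ, 0 < ε → ∀ Ω : Set (Fin n → ℝ), Bornology.IsBounded Ω →
    ∃ t : Fin n → ℝ, (∀ k, 0 < t k) ∧ ∀ ξ : Fin n → ℝ, ∃ τ : Fin n → ℝ,
      (∀ k, |τ k - ξ k| < t k) ∧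
      ∃ δ : ℝ, δ < ε ∧ ∀ z ∈ tube Ω, ∀ l, ‖F (realShift z τ) l - F z l‖ ≤ δ

/-- Convergence in the topology of `HAP(ℂⁿ, ℂᵐ)`: uniform convergence on every tube with bounded
base. -/
def TendstoHAP {n m : ℕ} (G : ℕ → (Fin n → ℂ) → (Fin m → ℂ))
    (H : (Fin n → ℂ) → (Fin m → ℂ)) : Prop :=
  ∀ Ω : Set (Fin n → ℝ), Bornology.IsBounded Ω → TendstoUniformlyOn G H atTop (tube Ω)

/-- The Bohr transform `a(l, f)`, the limit as `s → ∞` of the averages of `e^{-i⟨x, l⟩} f(x)` over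
the cubes `|xₖ| < s`.  For almost periodic `f` the limit exists, and computing it along `x + i y`
for another fixed `y ∈ ℝⁿ` gives the same value. -/
def bohrTransform {n : ℕ} (f : (Fin n → ℂ) → ℂ) (l : Fin n → ℝ) : ℂ :=
  limUnder atTop (fun s : ℝ => (1 / (2 * (s : ℂ)) ^ n) *
    ∫ x in {x : Fin n → ℝ | ∀ k, |x k| < s},
      Complex.exp (-Complex.I * pairing (fun k => (x k : ℂ)) l) * f (fun k => (x k : ℂ)))

/-- The spectrum `Sp f`. -/
def bohrSpectrum {n : ℕ} (f : (Fin n → ℂ) → ℂ) : Set (Fin n → ℝ) :=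
  {l | bohrTransform f l ≠ 0}

/-- The union of the spectra of the components of `F`. -/
def allSpectra {n m : ℕ} (F : (Fin n → ℂ) → (Fin m → ℂ)) : Set (Fin n → ℝ) :=
  ⋃ l : Fin m, bohrSpectrum (fun z => F z l)

/-- The `ℤ`-module `Ξ_F` of `F`: the additive subgroup of `ℝⁿ` generated by the spectra of the
components of `F`. -/
def freqModule {n m : ℕ} (F : (Fin n → ℂ) → (Fin m → ℂ)) : AddSubgroup (Fin n → ℝ) :=
  AddSubgroup.closure (allSpectra F)

/-- The (finite or infinite) sequence `ω₀, ω₁, …` of length `d` is a `ℚ`-basis of the `ℚ`-linear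
subspace of `ℝⁿ` generated by `Ξ_F`.  The values `ω r` with `r ≥ d` play no role. -/
structure IsFreqBasis {n m : ℕ} (F : (Fin n → ℂ) → (Fin m → ℂ)) (d : ℕ∞)
    (ω : ℕ → Fin n → ℝ) : Prop where
  linearIndependent : LinearIndependent ℚ (fun r : {r : ℕ // (r : ℕ∞) < d} => ω r)
  span_eq : Submodule.span ℚ (ω '' {r : ℕ | (r : ℕ∞) < d}) =
    Submodule.span ℚ (freqModule F : Set (Fin n → ℝ))

/-- The `j`-th Bochner-Fejer sum `Q_j(f)` with respect to the sequence `ω` of length `d`: the sum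
runs over the tuples of integers `ν_r`, `|ν_r| ≤ (j!)²`, where `r` ranges over the first `j` indices
of the sequence (over all `d` indices when `d < j`). -/
def bochnerFejer {n : ℕ} (d : ℕ∞) (ω : ℕ → Fin n → ℝ) (j : ℕ) (f : (Fin n → ℂ) → ℂ)
    (z : Fin n → ℂ) : ℂ :=
  ∑ ν ∈ Fintype.piFinset
      (fun _ : Fin (min (j : ℕ∞) d).toNat => Finset.Icc (-((j ! : ℤ) ^ 2)) ((j ! : ℤ) ^ 2)),
    (∏ r, (1 - |(ν r : ℝ)| / (j ! : ℝ) ^ 2) : ℝ) *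
      bohrTransform f (∑ r, ((ν r : ℝ) / (j ! : ℝ)) • ω r) *
      Complex.exp (Complex.I * pairing z (∑ r, ((ν r : ℝ) / (j ! : ℝ)) • ω r))

/-- The perturbation `f_χ(z) = ∑_{l ∈ Sp f} a(l, f) χ(l) e^{i⟨z, l⟩}` of an exponential sum `f` whose
spectrum lies in the group `G`, by a character `χ` of `G` (only the finitely many `l ∈ Sp f`
contribute to the sum). -/
def perturbExpSum {n : ℕ} {G : AddSubgroup (Fin n → ℝ)} (χ : AddChar G Circle)
    (f : (Fin n → ℂ) → ℂ) (z : Fin n → ℂ) : ℂ :=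
  ∑ᶠ l : G, bohrTransform f l * (χ l : ℂ) * Complex.exp (Complex.I * pairing z l)

/-- `H` is the perturbed mapping `F_χ`: the limit in `HAP(ℂⁿ, ℂᵐ)` of the perturbations `Q_j(F)_χ`
of the Bochner-Fejer approximations of `F` with respect to the sequence `ω` of length `d`. -/
structure IsPerturbed {n m : ℕ} (d : ℕ∞) (ω : ℕ → Fin n → ℝ) {G : AddSubgroup (Fin n → ℝ)}
    (F : (Fin n → ℂ) → (Fin m → ℂ)) (χ : AddChar G Circle)
    (H : (Fin n → ℂ) → (Fin m → ℂ)) : Prop where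
  isHAP : IsHAP H
  tendsto : TendstoHAP
    (fun j z l => perturbExpSum χ (bochnerFejer d ω j (fun w => F w l)) z) H

/-- The zero set `V(F)`. -/
def zeroLocus {n m : ℕ} (F : (Fin n → ℂ) → (Fin m → ℂ)) : Set (Fin n → ℂ) := {z | F z = 0}

/-- The amoeba `𝓕_F`, the closure of `Im V(F)`. -/
def amoeba {n m : ℕ} (F : (Fin n → ℂ) → (Fin m → ℂ)) : Set (Fin n → ℝ) :=
  closure (imPart '' zeroLocus F)

/-- The `𝒴`-amoeba of `F`, the union of the sets `Im V(F_χ)` over all characters `χ : G → 𝕊¹`. -/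
def yAmoeba {n m : ℕ} (d : ℕ∞) (ω : ℕ → Fin n → ℝ) (G : AddSubgroup (Fin n → ℝ))
    (F : (Fin n → ℂ) → (Fin m → ℂ)) : Set (Fin n → ℝ) :=
  ⋃ χ : AddChar G Circle, {y | ∃ H, IsPerturbed d ω F χ H ∧ y ∈ imPart '' zeroLocus H}

end

/-! Choose a ℤ-basis b₁, …, b_r of Ξ_F. Under either hypothesis it is linearly independent over ℝ
(`exists_lattice_basis`), so there are vectors β_j with ⟨β_j, b_i⟩ = δ_ij (`exists_dual_vectors`),
and real translations can realize any prescribed phases on the b_i. Both assertions follow from this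
freedom.

Closedness: a real vector τ with e^{i⟨τ, b_i⟩} = 1 for all i is a period of F, because every Bohr
coefficient of F(· + τ) - F carries a factor e^{i⟨τ, λ⟩} - 1 = 0 (`IsHAP.periodic`). Modulo such
periods the real part of a zero lies in the compact set of all Σ θ_j β_j with |θ_j| ≤ π, so Im V(F)
is the projection of a closed set along a compact factor.

Equality with the 𝒴-amoeba: a character χ is determined on Ξ_F by its values at the b_i, hence
agrees there with λ ↦ e^{i⟨τ, λ⟩} for τ = Σ arg χ(b_j) β_j (`exists_realExp_eq_char`). Perturbing
Q_j(F) by χ is therefore translation by τ, and as Q_j(F) → F uniformly on tubes, F_χ = F(· + τ)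
(`exists_isPerturbed_iff`). Real translations do not move Im V(F).

Two classical theorems are established on the way. Uniqueness (`exists_bohrMean_ne_zero`): for
almost periodic g ≠ 0, convolution with g is a nonzero operator C commuting with translations. The
operator C*C is positive for the mean inner product, so its powers decay at most geometrically and
its spectral radius is positive. Gelfand theory gives a multiplicative functional not vanishing on
C; on translations it is an exponential, at which g has a nonzero coefficient.

Bochner–Fejér approximation (`TubeAP.tendstoUniformlyOn_bochnerFejer`): the sums are means of f(z +
t) against a nonnegative kernel of mean 1 that concentrates where all e^{i⟨t, b_i⟩} are close to 1.
By periodicity modulo the dual lattice, f(z + t) is uniformly close to f(z) there (`IsHAP.tubeAP`).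
-/

open scoped BoundedContinuousFunction

noncomputable section

set_option linter.unusedSectionVars false

/-! ### Averages over cubes and mean values of almost periodic functions -/

section Means

variable {n : ℕ} {X : Type*} [NormedAddCommGroup X] [NormedSpace ℂ X]

/-- The open cube `{x : |xₖ| < s}`. -/
def cube (n : ℕ) (s : ℝ) : Set (Fin n → ℝ) := {x | ∀ k, |x k| < s}

/-- The average of `u` over the cube `{x : |xₖ| < s}`. -/
def cubeAvg (s : ℝ) (u : (Fin n → ℝ) → X) : X :=
  ((1 : ℂ) / (2 * (s : ℂ)) ^ n) • ∫ x in cube n s, u x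

/-- `u` has mean value `m`. -/
def HasMean (u : (Fin n → ℝ) → X) (m : X) : Prop :=
  Tendsto (fun s : ℝ => cubeAvg s u) atTop (𝓝 m)

lemma cube_eq_pi (s : ℝ) : cube n s = Set.univ.pi (fun _ => Set.Ioo (-s) s) := by
  ext x; simp [cube, abs_lt]

lemma measurableSet_cube (s : ℝ) : MeasurableSet (cube n s) := by
  rw [cube_eq_pi]; exact MeasurableSet.univ_pi fun _ => measurableSet_Ioo

lemma volume_cube (s : ℝ) : volume (cube n s) = ENNReal.ofReal (2 * s) ^ n := by
  rw [cube_eq_pi, Real.volume_pi_Ioo]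
  simp [two_mul]

lemma volume_cube_lt_top (s : ℝ) : volume (cube n s) < ⊤ := by
  rw [volume_cube]; exact ENNReal.pow_lt_top ENNReal.ofReal_lt_top

lemma volume_real_cube {s : ℝ} (hs : 0 ≤ s) : volume.real (cube n s) = (2 * s) ^ n := by
  rw [measureReal_def, volume_cube, ENNReal.toReal_pow, ENNReal.toReal_ofReal (by positivity)]

lemma integrableOn_cube {u : (Fin n → ℝ) → X} (hu : Continuous u) {B : ℝ} (hB : ∀ x, ‖u x‖ ≤ B)
    (s : ℝ) : IntegrableOn u (cube n s) :=
  Measure.integrableOn_of_bounded (volume_cube_lt_top s).ne hu.aestronglyMeasurable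
    (Eventually.of_forall hB)

lemma norm_cubeFactor {s : ℝ} (hs : 0 < s) :
    ‖(1 : ℂ) / (2 * (s : ℂ)) ^ n‖ = 1 / (2 * s) ^ n := by
  simp [abs_of_pos hs]

lemma norm_cubeAvg_le {u : (Fin n → ℝ) → X} {B : ℝ} (hB : ∀ x, ‖u x‖ ≤ B) {s : ℝ} (hs : 0 < s) :
    ‖cubeAvg s u‖ ≤ B := by
  rw [cubeAvg, norm_smul, norm_cubeFactor hs]
  have h := norm_setIntegral_le_of_norm_le_const (μ := volume) (volume_cube_lt_top (n := n) s)
    (fun x _ => hB x)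
  rw [volume_real_cube hs.le] at h
  rw [one_div, inv_mul_le_iff₀ (by positivity)]
  linarith [mul_comm B ((2 * s) ^ n)]

lemma cubeAvg_const [CompleteSpace X] (c : X) {s : ℝ} (hs : 0 < s) :
    cubeAvg s (fun _ : Fin n → ℝ => c) = c := by
  rw [cubeAvg, setIntegral_const, volume_real_cube hs.le, ← Complex.coe_smul, smul_smul]
  have : ((2 : ℂ) * (s : ℂ)) ^ n ≠ 0 := by
    have : (s : ℂ) ≠ 0 := by exact_mod_cast hs.ne'
    exact pow_ne_zero _ (mul_ne_zero two_ne_zero this)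
  push_cast
  rw [one_div_mul_cancel this, one_smul]

lemma cubeAvg_add {u v : (Fin n → ℝ) → X} {s : ℝ} (hu : IntegrableOn u (cube n s))
    (hv : IntegrableOn v (cube n s)) :
    cubeAvg s (fun x => u x + v x) = cubeAvg s u + cubeAvg s v := by
  simp only [cubeAvg]; rw [integral_add hu hv, smul_add]

lemma cubeAvg_sub {u v : (Fin n → ℝ) → X} {s : ℝ} (hu : IntegrableOn u (cube n s))
    (hv : IntegrableOn v (cube n s)) :
    cubeAvg s (fun x => u x - v x) = cubeAvg s u - cubeAvg s v := by
  simp only [cubeAvg]; rw [integral_sub hu hv, smul_sub]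

lemma cubeAvg_smul (c : ℂ) (u : (Fin n → ℝ) → X) (s : ℝ) :
    cubeAvg s (fun x => c • u x) = c • cubeAvg s u := by
  simp only [cubeAvg]; rw [integral_smul, smul_comm]

lemma cubeAvg_clm {Y : Type*} [NormedAddCommGroup Y] [NormedSpace ℂ Y] [CompleteSpace X]
    [CompleteSpace Y] (L : X →L[ℂ] Y) {u : (Fin n → ℝ) → X} {s : ℝ}
    (hu : IntegrableOn u (cube n s)) :
    cubeAvg s (fun x => L (u x)) = L (cubeAvg s u) := by
  simp only [cubeAvg]; rw [L.integral_comp_comm hu, map_smul]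

lemma cubeAvg_neg_arg (u : (Fin n → ℝ) → X) (s : ℝ) :
    cubeAvg s (fun x => u (-x)) = cubeAvg s u := by
  simp only [cubeAvg]
  congr 1
  have h := (Measure.measurePreserving_neg (volume : Measure (Fin n → ℝ))).setIntegral_preimage_emb
    (MeasurableEquiv.neg _).measurableEmbedding u (cube n s)
  rw [← h]
  congr 2
  ext x; simp [cube]

lemma cubeAvg_star (u : (Fin n → ℝ) → ℂ) (s : ℝ) :
    cubeAvg s (fun x => starRingEnd ℂ (u x)) = starRingEnd ℂ (cubeAvg s u) := by
  simp only [cubeAvg, smul_eq_mul, map_mul]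
  rw [← integral_conj]
  simp [map_ofNat]

lemma cubeAvg_re_mono {u v : (Fin n → ℝ) → ℂ} {s : ℝ} (hs : 0 < s)
    (hu : IntegrableOn u (cube n s)) (hv : IntegrableOn v (cube n s))
    (h : ∀ x, (u x).re ≤ (v x).re) : (cubeAvg s u).re ≤ (cubeAvg s v).re := by
  have e : ((1 : ℂ) / (2 * (s : ℂ)) ^ n) = ((1 / (2 * s) ^ n : ℝ) : ℂ) := by push_cast; rfl
  simp only [cubeAvg, smul_eq_mul]
  rw [e, Complex.re_ofReal_mul, Complex.re_ofReal_mul]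
  have hu' := integral_re hu
  have hv' := integral_re hv
  simp only [RCLike.re_to_complex] at hu' hv'
  rw [← hu', ← hv']
  exact mul_le_mul_of_nonneg_left (setIntegral_mono hu.re hv.re h) (by positivity)

lemma norm_integral_cube_sub_le {u : (Fin n → ℝ) → X} (hu : Continuous u) {B : ℝ}
    (hB : ∀ x, ‖u x‖ ≤ B) {s s' : ℝ} (hs : 0 ≤ s) (hs' : 0 ≤ s') {S : Set (Fin n → ℝ)}
    (hSm : MeasurableSet S) (hS : S ⊆ cube n s') (hvol : volume S = volume (cube n s)) :
    ‖(∫ x in cube n s', u x) - ∫ x in S, u x‖ ≤ B * ((2 * s') ^ n - (2 * s) ^ n) := by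
  rw [← setIntegral_sdiff hSm (integrableOn_cube hu hB s') hS]
  have hlt : volume (cube n s' \ S) < ⊤ :=
    (measure_mono Set.sdiff_subset).trans_lt (volume_cube_lt_top s')
  have h := norm_setIntegral_le_of_norm_le_const (μ := volume) hlt (fun x _ => hB x)
  have hS_real : volume.real S = (2 * s) ^ n := by
    rw [measureReal_def, hvol, ← measureReal_def, volume_real_cube hs]
  rwa [measureReal_sdiff hS hSm (volume_cube_lt_top s').ne, volume_real_cube hs', hS_real] at h

/-- The cube of half-side s and its translate by t both lie in the cube of half-side s + R and have
equal volume; each misses only a shell whose relative volume is (1 + R/s)ⁿ - 1. -/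
lemma norm_cubeAvg_shift_sub_le {u : (Fin n → ℝ) → X} (hu : Continuous u) {B : ℝ}
    (hB : ∀ x, ‖u x‖ ≤ B) {t : Fin n → ℝ} {R : ℝ} (hR : ‖t‖ ≤ R) {s : ℝ} (hs : 0 < s) :
    ‖cubeAvg s (fun x => u (x + t)) - cubeAvg s u‖ ≤ 2 * B * ((1 + R / s) ^ n - 1) := by
  have hR0 : 0 ≤ R := (norm_nonneg t).trans hR
  set S : Set (Fin n → ℝ) := (fun x => x + -t) ⁻¹' cube n s with hSdef
  have hSm : MeasurableSet S := (measurable_add_const _) (measurableSet_cube s)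
  have hpre : (fun x => x + t) ⁻¹' S = cube n s := by ext x; simp [S]
  have h1 : ∫ x in cube n s, u (x + t) = ∫ x in S, u x := by
    have := (measurePreserving_add_right (volume : Measure (Fin n → ℝ)) t).setIntegral_preimage_emb
      (MeasurableEquiv.addRight t).measurableEmbedding u S
    rwa [hpre] at this
  have hvol : volume S = volume (cube n s) :=
    (measurePreserving_add_right (volume : Measure (Fin n → ℝ)) (-t)).measure_preimage
      (measurableSet_cube s).nullMeasurableSet
  have hS : S ⊆ cube n (s + R) := by
    intro x hx k
    have h2 : |x k + -t k| < s := hx k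
    have h3 : |t k| ≤ R := (norm_le_pi_norm t k).trans hR
    have h4 : |x k| ≤ |x k + -t k| + |t k| := by
      have := abs_add_le (x k + -t k) (t k)
      simpa using this
    linarith
  have hS' : cube n s ⊆ cube n (s + R) := fun x hx k => (hx k).trans_le (by linarith)
  have e1 := norm_integral_cube_sub_le hu hB hs.le (by positivity : 0 ≤ s + R) hSm hS hvol
  have e2 := norm_integral_cube_sub_le hu hB hs.le (by positivity : 0 ≤ s + R)
    (measurableSet_cube s) hS' rfl
  simp only [cubeAvg]
  rw [h1, ← smul_sub, norm_smul, norm_cubeFactor hs, one_div, inv_mul_le_iff₀ (by positivity)]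
  have e3 : (2 * s) ^ n * (2 * B * ((1 + R / s) ^ n - 1)) =
      2 * (B * ((2 * (s + R)) ^ n - (2 * s) ^ n)) := by
    have : 2 * (s + R) = 2 * s * (1 + R / s) := by field_simp
    rw [this, mul_pow (2 * s)]; ring
  rw [e3]
  calc _ = ‖((∫ x in cube n (s + R), u x) - ∫ x in cube n s, u x) -
        ((∫ x in cube n (s + R), u x) - ∫ x in S, u x)‖ := by congr 1; abel
    _ ≤ _ := norm_sub_le _ _
    _ ≤ _ := by linarith

lemma tendsto_shift_error (B R : ℝ) (n : ℕ) :
    Tendsto (fun s : ℝ => 2 * B * ((1 + R / s) ^ n - 1)) atTop (𝓝 0) := by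
  have h : Tendsto (fun s : ℝ => R / s) atTop (𝓝 0) := tendsto_const_nhds.div_atTop tendsto_id
  have := (((h.const_add 1).pow n).sub_const 1).const_mul (2 * B)
  simpa using this

/-- Averages of bounded functions are asymptotically invariant under translations. -/
lemma tendsto_cubeAvg_shift_sub {u : (Fin n → ℝ) → X} (hu : Continuous u) {B : ℝ}
    (hB : ∀ x, ‖u x‖ ≤ B) (t : Fin n → ℝ) :
    Tendsto (fun s => cubeAvg s (fun x => u (x + t)) - cubeAvg s u) atTop (𝓝 0) := by
  refine squeeze_zero_norm' ?_ (tendsto_shift_error B ‖t‖ n)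
  filter_upwards [eventually_gt_atTop 0] with s hs
  exact norm_cubeAvg_shift_sub_le hu hB le_rfl hs

lemma HasMean.shift {u : (Fin n → ℝ) → X} {m : X} (h : HasMean u m) (hu : Continuous u) {B : ℝ}
    (hB : ∀ x, ‖u x‖ ≤ B) (t : Fin n → ℝ) : HasMean (fun x => u (x + t)) m := by
  have := (tendsto_cubeAvg_shift_sub hu hB t).add h
  simpa [HasMean] using this

/-- A function `d` on `ℝⁿ` that is small near `0`, and such that finitely many translates of each
of the sets `{d < δ}` cover `ℝⁿ`. -/
structure IsGauge (d : (Fin n → ℝ) → ℝ) : Prop where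
  net : ∀ δ > 0, ∃ T : Finset (Fin n → ℝ), ∀ x, ∃ t ∈ T, d (x - t) < δ
  small : ∀ δ > 0, ∀ᶠ τ in 𝓝 0, d τ < δ

/-- `u` is almost periodic, with almost periods controlled by the gauge `d`. -/
def UniformAP (d : (Fin n → ℝ) → ℝ) (u : (Fin n → ℝ) → X) : Prop :=
  ∀ ε > 0, ∃ δ > 0, ∀ τ, d τ < δ → ∀ x, ‖u (x + τ) - u x‖ ≤ ε

variable {d : (Fin n → ℝ) → ℝ}

lemma UniformAP.uniformContinuous (hd : IsGauge d) {u : (Fin n → ℝ) → X} (hu : UniformAP d u) :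
    UniformContinuous u := by
  rw [Metric.uniformContinuous_iff]
  intro ε hε
  obtain ⟨δ, hδ, h⟩ := hu (ε / 2) (by positivity)
  obtain ⟨ρ, hρ, hr⟩ := Metric.eventually_nhds_iff.1 (hd.small δ hδ)
  refine ⟨ρ, hρ, fun {x y} hxy => ?_⟩
  have h1 : d (x - y) < δ := hr (by simpa [dist_eq_norm] using hxy)
  have h2 := h _ h1 y
  rw [add_sub_cancel] at h2
  rw [dist_eq_norm]
  linarith

lemma UniformAP.continuous (hd : IsGauge d) {u : (Fin n → ℝ) → X} (hu : UniformAP d u) :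
    Continuous u := (hu.uniformContinuous hd).continuous

/-- Up to an error 1, every value is taken at one of the finitely many points of a net. -/
lemma UniformAP.bounded (hd : IsGauge d) {u : (Fin n → ℝ) → X} (hu : UniformAP d u) :
    ∃ B, ∀ x, ‖u x‖ ≤ B := by
  obtain ⟨δ, hδ, h⟩ := hu 1 one_pos
  obtain ⟨T, hT⟩ := hd.net δ hδ
  refine ⟨1 + ∑ t ∈ T, ‖u t‖, fun x => ?_⟩
  obtain ⟨t, ht, hxt⟩ := hT x
  have h1 := h _ hxt t
  rw [add_sub_cancel] at h1
  have h2 : ‖u t‖ ≤ ∑ t ∈ T, ‖u t‖ :=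
    Finset.single_le_sum (f := fun t => ‖u t‖) (fun _ _ => norm_nonneg _) ht
  have h3 := norm_add_le (u x - u t) (u t)
  rw [sub_add_cancel] at h3
  linarith

lemma UniformAP.integrableOn (hd : IsGauge d) {u : (Fin n → ℝ) → X} (hu : UniformAP d u) (s : ℝ) :
    IntegrableOn u (cube n s) :=
  let ⟨_, hB⟩ := hu.bounded hd
  integrableOn_cube (hu.continuous hd) hB s

lemma cubeAvg_comm {u : (Fin n → ℝ) → X} (hu : Continuous u) {B : ℝ} (hB : ∀ x, ‖u x‖ ≤ B)
    (s s' : ℝ) :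
    cubeAvg s (fun x => cubeAvg s' fun y => u (y + x)) =
      cubeAvg s' (fun y => cubeAvg s fun x => u (x + y)) := by
  simp only [cubeAvg]
  rw [integral_smul, integral_smul, smul_comm]
  congr 2
  have e : ∀ x y : Fin n → ℝ, u (x + y) = u (y + x) := fun x y => by rw [add_comm]
  simp_rw [e]
  rw [integral_integral_swap]
  · simp_rw [e]
  have : IsFiniteMeasure ((volume : Measure (Fin n → ℝ)).restrict (cube n s)) :=
    ⟨by simpa using volume_cube_lt_top s⟩
  have : IsFiniteMeasure ((volume : Measure (Fin n → ℝ)).restrict (cube n s')) :=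
    ⟨by simpa using volume_cube_lt_top s'⟩
  refine Integrable.of_bound (C := B) ?_ (Eventually.of_forall fun p => hB _)
  exact (hu.comp (by fun_prop)).aestronglyMeasurable

/-- Up to an almost period, an arbitrary shift is one of finitely many, and for those the shell
estimate applies. The threshold s₀ is chosen before u; this uniformity is what later gives
convergence of means uniformly on tubes. -/
lemma exists_forall_shift_close (hd : IsGauge d) {ε δ : ℝ} (B : ℝ) (hε : 0 < ε) (hδ : 0 < δ) :
    ∃ s₀ > 0, ∀ u : (Fin n → ℝ) → X, Continuous u → (∀ x, ‖u x‖ ≤ B) →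
      (∀ τ, d τ < δ → ∀ x, ‖u (x + τ) - u x‖ ≤ ε) →
      ∀ s ≥ s₀, ∀ x, ‖cubeAvg s (fun y => u (y + x)) - cubeAvg s u‖ ≤ 2 * ε := by
  obtain ⟨T, hT⟩ := hd.net δ hδ
  obtain ⟨s₀, hs₀⟩ := ((tendsto_shift_error B (∑ t ∈ T, ‖t‖) n).eventually
    (ge_mem_nhds hε)).exists_forall_of_atTop
  refine ⟨max s₀ 1, by positivity, fun u hu hB hτ s hs x => ?_⟩
  have hs0 : 0 < s := lt_of_lt_of_le (by positivity) hs
  obtain ⟨t, ht, hxt⟩ := hT x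
  have h1 : ‖cubeAvg s (fun y => u (y + t)) - cubeAvg s u‖ ≤ ε :=
    (norm_cubeAvg_shift_sub_le hu hB (R := ∑ t ∈ T, ‖t‖)
      (Finset.single_le_sum (f := fun t => ‖t‖) (fun _ _ => norm_nonneg _) ht) hs0).trans
      (hs₀ s ((le_max_left _ _).trans hs))
  have h2 : ‖cubeAvg s (fun y => u (y + x)) - cubeAvg s (fun y => u (y + t))‖ ≤ ε := by
    rw [← cubeAvg_sub (integrableOn_cube (by fun_prop) (fun y => hB _) s)
      (integrableOn_cube (by fun_prop) (fun y => hB _) s)]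
    refine norm_cubeAvg_le (fun y => ?_) hs0
    have := hτ _ hxt (y + t)
    rwa [add_assoc, add_sub_cancel] at this
  calc _ = ‖(cubeAvg s (fun y => u (y + x)) - cubeAvg s (fun y => u (y + t))) +
        (cubeAvg s (fun y => u (y + t)) - cubeAvg s u)‖ := by congr 1; abel
    _ ≤ _ := norm_add_le _ _
    _ ≤ _ := by linarith

/-- The averages of almost periodic functions form a Cauchy family, with a rate that depends only
on a bound and on the almost periods. -/
lemma exists_forall_cubeAvg_close [CompleteSpace X] (hd : IsGauge d) {ε δ : ℝ} (B : ℝ)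
    (hε : 0 < ε) (hδ : 0 < δ) :
    ∃ s₀ > 0, ∀ u : (Fin n → ℝ) → X, Continuous u → (∀ x, ‖u x‖ ≤ B) →
      (∀ τ, d τ < δ → ∀ x, ‖u (x + τ) - u x‖ ≤ ε) →
      ∀ s ≥ s₀, ∀ s' ≥ s₀, ‖cubeAvg s u - cubeAvg s' u‖ ≤ 4 * ε := by
  obtain ⟨s₀, hs₀, h⟩ := exists_forall_shift_close (X := X) hd B hε hδ
  refine ⟨s₀, hs₀, fun u hu hB hτ => ?_⟩
  -- Averaging the shift estimate over x compares the double average with the single one.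
  have key : ∀ s ≥ s₀, ∀ s' ≥ s₀,
      ‖cubeAvg s (fun x => cubeAvg s' fun y => u (y + x)) - cubeAvg s' u‖ ≤ 2 * ε := by
    intro s hs s' hs'
    have hs0 : 0 < s := hs₀.trans_le hs
    have hs0' : 0 < s' := hs₀.trans_le hs'
    have hcont : Continuous fun x => cubeAvg s' fun y => u (y + x) := by
      unfold cubeAvg
      refine Continuous.const_smul ?_ _
      refine continuous_of_dominated (bound := fun _ => B) (fun x => ?_)
        (fun x => Eventually.of_forall fun y => hB _) ?_ (Eventually.of_forall fun y => ?_)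
      · exact (hu.comp (by fun_prop)).aestronglyMeasurable
      · exact integrableOn_const (volume_cube_lt_top s').ne
      · fun_prop
    have hint : IntegrableOn (fun x => cubeAvg s' fun y => u (y + x)) (cube n s) :=
      integrableOn_cube hcont (B := B) (fun x => norm_cubeAvg_le (fun y => hB _) hs0') s
    have hint' : IntegrableOn (fun _ : Fin n → ℝ => cubeAvg s' u) (cube n s) :=
      integrableOn_const (volume_cube_lt_top s).ne
    have e : cubeAvg s (fun x => cubeAvg s' fun y => u (y + x)) - cubeAvg s' u =
        cubeAvg s (fun x => (cubeAvg s' fun y => u (y + x)) - cubeAvg s' u) := by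
      rw [cubeAvg_sub hint hint', cubeAvg_const _ hs0]
    rw [e]
    exact norm_cubeAvg_le (fun x => h u hu hB hτ s' hs' x) hs0
  intro s hs s' hs'
  have h1 := key s hs s' hs'
  have h2 := key s' hs' s hs
  -- By Fubini the double average is symmetric in s and s', so it is close to both single averages.
  rw [← cubeAvg_comm hu hB s s'] at h2
  calc _ = ‖(cubeAvg s (fun x => cubeAvg s' fun y => u (y + x)) - cubeAvg s' u) -
        (cubeAvg s (fun x => cubeAvg s' fun y => u (y + x)) - cubeAvg s u)‖ := by congr 1; abel
    _ ≤ _ := norm_sub_le _ _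
    _ ≤ _ := by linarith

/-- The mean value of `u`. -/
def bohrMean (u : (Fin n → ℝ) → X) : X := limUnder atTop fun s : ℝ => cubeAvg s u

lemma HasMean.bohrMean_eq {u : (Fin n → ℝ) → X} {m : X} (h : HasMean u m) : bohrMean u = m :=
  h.limUnder_eq

lemma HasMean.unique {u : (Fin n → ℝ) → X} {m m' : X} (h : HasMean u m) (h' : HasMean u m') :
    m = m' := tendsto_nhds_unique h h'

theorem UniformAP.hasMean [CompleteSpace X] (hd : IsGauge d) {u : (Fin n → ℝ) → X}
    (hu : UniformAP d u) : HasMean u (bohrMean u) := by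
  obtain ⟨B, hB⟩ := hu.bounded hd
  have hc : Cauchy (map (fun s : ℝ => cubeAvg s u) atTop) := by
    rw [Metric.cauchy_iff]
    refine ⟨inferInstance, fun ε hε => ?_⟩
    obtain ⟨δ, hδ, h⟩ := hu (ε / 8) (by positivity)
    obtain ⟨s₀, -, h'⟩ := exists_forall_cubeAvg_close (X := X) hd B (ε := ε / 8) (by positivity) hδ
    refine ⟨(fun s : ℝ => cubeAvg s u) '' Set.Ici s₀, image_mem_map (Ici_mem_atTop s₀), ?_⟩
    rintro _ ⟨s, hs, rfl⟩ _ ⟨s', hs', rfl⟩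
    rw [dist_eq_norm]
    have := h' u (hu.continuous hd) hB h s hs s' hs'
    linarith
  obtain ⟨m, hm⟩ := cauchy_iff_exists_le_nhds.1 hc
  exact tendsto_nhds_limUnder ⟨m, hm⟩

lemma HasMean.norm_le {u : (Fin n → ℝ) → X} {m : X} (h : HasMean u m) {B : ℝ}
    (hB : ∀ x, ‖u x‖ ≤ B) : ‖m‖ ≤ B := by
  refine le_of_tendsto h.norm ?_
  filter_upwards [eventually_gt_atTop 0] with s hs
  exact norm_cubeAvg_le hB hs

lemma HasMean.const_smul {u : (Fin n → ℝ) → X} {m : X} (h : HasMean u m) (c : ℂ) :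
    HasMean (fun x => c • u x) (c • m) := by
  unfold HasMean
  simp_rw [cubeAvg_smul]
  exact Tendsto.const_smul h c

lemma HasMean.add {u v : (Fin n → ℝ) → X} {m m' : X} (h : HasMean u m) (h' : HasMean v m')
    (hu : ∀ s, IntegrableOn u (cube n s)) (hv : ∀ s, IntegrableOn v (cube n s)) :
    HasMean (fun x => u x + v x) (m + m') := by
  unfold HasMean
  simp_rw [cubeAvg_add (hu _) (hv _)]
  exact Tendsto.add h h'

lemma HasMean.sub {u v : (Fin n → ℝ) → X} {m m' : X} (h : HasMean u m) (h' : HasMean v m')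
    (hu : ∀ s, IntegrableOn u (cube n s)) (hv : ∀ s, IntegrableOn v (cube n s)) :
    HasMean (fun x => u x - v x) (m - m') := by
  unfold HasMean
  simp_rw [cubeAvg_sub (hu _) (hv _)]
  exact Tendsto.sub h h'

lemma HasMean.sum {ι : Type*} (S : Finset ι) {u : ι → (Fin n → ℝ) → X} {m : ι → X}
    (h : ∀ i ∈ S, HasMean (u i) (m i)) (hu : ∀ i ∈ S, ∀ s, IntegrableOn (u i) (cube n s)) :
    HasMean (fun x => ∑ i ∈ S, u i x) (∑ i ∈ S, m i) := by
  classical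
  induction S using Finset.induction_on with
  | empty =>
    simp only [Finset.sum_empty, HasMean, cubeAvg, integral_zero, smul_zero]
    exact tendsto_const_nhds
  | insert i S hi ih =>
    simp only [Finset.sum_insert hi]
    refine HasMean.add (h i (Finset.mem_insert_self _ _))
      (ih (fun j hj => h j (Finset.mem_insert_of_mem hj))
        fun j hj => hu j (Finset.mem_insert_of_mem hj)) (hu i (Finset.mem_insert_self _ _)) ?_
    intro s
    exact integrable_finsetSum _ fun j hj => hu j (Finset.mem_insert_of_mem hj) s

lemma hasMean_const [CompleteSpace X] (c : X) : HasMean (fun _ : Fin n → ℝ => c) c := by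
  refine tendsto_const_nhds.congr' ?_
  filter_upwards [eventually_gt_atTop 0] with s hs
  rw [cubeAvg_const c hs]

lemma HasMean.clm {Y : Type*} [NormedAddCommGroup Y] [NormedSpace ℂ Y] [CompleteSpace X]
    [CompleteSpace Y] (L : X →L[ℂ] Y) {u : (Fin n → ℝ) → X} {m : X} (h : HasMean u m)
    (hu : ∀ s, IntegrableOn u (cube n s)) : HasMean (fun x => L (u x)) (L m) := by
  unfold HasMean
  simp_rw [cubeAvg_clm L (hu _)]
  exact (L.continuous.tendsto m).comp h

lemma HasMean.neg_arg {u : (Fin n → ℝ) → X} {m : X} (h : HasMean u m) :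
    HasMean (fun x => u (-x)) m := by
  unfold HasMean
  simp_rw [cubeAvg_neg_arg]
  exact h

lemma HasMean.star {u : (Fin n → ℝ) → ℂ} {m : ℂ} (h : HasMean u m) :
    HasMean (fun x => starRingEnd ℂ (u x)) (starRingEnd ℂ m) := by
  unfold HasMean
  simp_rw [cubeAvg_star]
  exact (Complex.continuous_conj.tendsto m).comp h

lemma HasMean.re_mono {u v : (Fin n → ℝ) → ℂ} {m m' : ℂ} (h : HasMean u m) (h' : HasMean v m')
    (hu : ∀ s, IntegrableOn u (cube n s)) (hv : ∀ s, IntegrableOn v (cube n s))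
    (huv : ∀ x, (u x).re ≤ (v x).re) : m.re ≤ m'.re := by
  refine le_of_tendsto_of_tendsto ((Complex.continuous_re.tendsto m).comp h)
    ((Complex.continuous_re.tendsto m').comp h') ?_
  filter_upwards [eventually_gt_atTop 0] with s hs
  exact cubeAvg_re_mono hs (hu s) (hv s) huv

end Means

/-! ### Multiplicative functionals and continuous characters of ℝⁿ -/

section Characters

/-- A complex Banach algebra element with geometrically bounded below powers that lies in a
commuting set is not killed by some multiplicative functional on the algebra generated by the
set. -/
lemma exists_multiplicative_functional {A : Type*} [NormedRing A] [NormedAlgebra ℂ A]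
    [CompleteSpace A] [Nontrivial A] {S : Set A} (hS : ∀ a ∈ S, ∀ b ∈ S, a * b = b * a) {b : A}
    (hb : b ∈ Algebra.adjoin ℂ S) {c ρ : ℝ} (hc : 0 < c) (hρ : 0 < ρ)
    (hpow : ∀ k : ℕ, c * ρ ^ k ≤ ‖b ^ k‖) :
    ∃ Φ : A →L[ℂ] ℂ, (∀ x ∈ Algebra.adjoin ℂ S, ∀ y ∈ Algebra.adjoin ℂ S, Φ (x * y) = Φ x * Φ y) ∧
      Φ 1 = 1 ∧ Φ b ≠ 0 := by
  -- The closure of the generated algebra is a commutative Banach algebra, to which Gelfand theory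
  -- applies.
  set A₀ : Subalgebra ℂ A := (Algebra.adjoin ℂ S).topologicalClosure with hA₀
  have hle : Algebra.adjoin ℂ S ≤ A₀ := Subalgebra.le_topologicalClosure _
  have hcomm₀ : ∀ x y : Algebra.adjoin ℂ S, x * y = y * x :=
    (Algebra.isMulCommutative_adjoin ℂ hS).is_comm.comm
  have hcomm : ∀ x y : A₀, x * y = y * x :=
    ((Algebra.adjoin ℂ S).commRingTopologicalClosure hcomm₀).mul_comm
  let _ : NormedCommRing A₀ := { (inferInstance : NormedRing A₀) with mul_comm := hcomm }
  have : CompleteSpace A₀ := (Subalgebra.isClosed_topologicalClosure _).completeSpace_coe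
  let b₀ : A₀ := ⟨b, hle hb⟩
  obtain ⟨z, hz, hzr⟩ := spectrum.exists_nnnorm_eq_spectralRadius (A := A₀) b₀
  -- If the spectral radius vanished, Gelfand's formula would give ‖bᵏ‖ < (ρ/2)ᵏ for large k,
  -- against the lower bound c ρᵏ.
  have hz0 : z ≠ 0 := by
    rintro rfl
    have hlim := spectrum.pow_norm_pow_one_div_tendsto_nhds_spectralRadius b₀
    rw [← hzr] at hlim
    simp only [nnnorm_zero, ENNReal.coe_zero] at hlim
    have h1 := hlim.eventually (gt_mem_nhds (ENNReal.ofReal_pos.2 (half_pos hρ)))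
    have h2 : ∀ᶠ k : ℕ in atTop, 1 / c < 2 ^ k :=
      (tendsto_pow_atTop_atTop_of_one_lt (by norm_num : (1 : ℝ) < 2)).eventually_gt_atTop _
    obtain ⟨k, ⟨hk1, hk2⟩, hk0⟩ := ((h1.and h2).and (eventually_gt_atTop 0)).exists
    rw [ENNReal.ofReal_lt_ofReal_iff (half_pos hρ)] at hk1
    have h3 : ‖b₀ ^ k‖ < (ρ / 2) ^ k := by
      have := pow_lt_pow_left₀ hk1 (by positivity) hk0.ne'
      rwa [one_div, Real.rpow_inv_natCast_pow (norm_nonneg _) hk0.ne'] at this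
    have h4 : c * ρ ^ k ≤ ‖b₀ ^ k‖ := hpow k
    rw [div_pow, lt_div_iff₀ (by positivity)] at h3
    rw [div_lt_iff₀ hc] at hk2
    have h5 : 0 < ρ ^ k := by positivity
    nlinarith [mul_le_mul_of_nonneg_right h4 (by positivity : (0 : ℝ) ≤ 2 ^ k)]
  obtain ⟨ψ, hψ⟩ := (WeakDual.CharacterSpace.mem_spectrum_iff_exists (A := A₀)).1 hz
  -- Hahn–Banach extends the character to the whole algebra only as a linear functional;
  -- multiplicativity survives on the subalgebra.
  obtain ⟨Φ, hΦ, -⟩ := exists_extension_norm_eq (𝕜 := ℂ) (Subalgebra.toSubmodule A₀)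
    (WeakDual.CharacterSpace.toCLM ψ : A₀ →L[ℂ] ℂ)
  have hΦ' : ∀ x : A₀, Φ x = ψ x := fun x => hΦ x
  refine ⟨Φ, fun x hx y hy => ?_, ?_, ?_⟩
  · have := map_mul ψ (⟨x, hle hx⟩ : A₀) ⟨y, hle hy⟩
    rw [← hΦ', ← hΦ', ← hΦ'] at this
    exact this
  · have := map_one ψ
    rw [← hΦ'] at this
    exact this
  · have := hΦ' b₀
    rw [hψ] at this
    rwa [this]

/-- The exponential `x ↦ e^{i⟨x, l⟩}` on `ℝⁿ`. -/
def realExp {n : ℕ} (l x : Fin n → ℝ) : ℂ :=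
  Complex.exp (Complex.I * pairing (fun k => (x k : ℂ)) l)

/-- Continuous exponential functions of a real variable are exponentials. -/
lemma exists_exp_of_continuous_mul {χ : ℝ → ℂ} (hc : Continuous χ) (h0 : χ 0 = 1)
    (hmul : ∀ s t, χ (s + t) = χ s * χ t) : ∃ a : ℂ, ∀ t : ℝ, χ t = Complex.exp (a * t) := by
  -- The primitive of χ has derivative χ 0 = 1 at 0, so it is not identically zero.
  obtain ⟨p, hp⟩ : ∃ p : ℝ, ∫ t in (0 : ℝ)..p, χ t ≠ 0 := by
    by_contra! h
    have h1 : HasDerivAt (fun p => ∫ t in (0 : ℝ)..p, χ t) (χ 0) 0 :=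
      intervalIntegral.integral_hasDerivAt_right (hc.intervalIntegrable _ _)
        (hc.stronglyMeasurableAtFilter _ _) hc.continuousAt
    have h2 : (fun p => ∫ t in (0 : ℝ)..p, χ t) = fun _ => 0 := funext h
    rw [h2] at h1
    have := h1.unique (hasDerivAt_const _ _)
    rw [h0] at this
    exact one_ne_zero this
  set J := ∫ t in (0 : ℝ)..p, χ t with hJ
  -- Integrating the functional equation over [0, p] writes χ through its own primitive; continuity
  -- thus upgrades to differentiability.
  have hform : ∀ s, χ s = J⁻¹ * ((∫ t in (0 : ℝ)..(s + p), χ t) - ∫ t in (0 : ℝ)..s, χ t) := by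
    intro s
    rw [intervalIntegral.integral_interval_sub_left (hc.intervalIntegrable _ _)
      (hc.intervalIntegrable _ _)]
    have h1 : ∫ t in s..(s + p), χ t = χ s * J := by
      have := intervalIntegral.integral_comp_add_left (f := χ) (a := 0) (b := p) s
      rw [add_zero] at this
      rw [← this]
      simp_rw [hmul s]
      rw [intervalIntegral.integral_const_mul]
    rw [h1]; field_simp
  have hF : ∀ s, HasDerivAt (fun p => ∫ t in (0 : ℝ)..p, χ t) (χ s) s := fun s =>
    intervalIntegral.integral_hasDerivAt_right (hc.intervalIntegrable _ _)
      (hc.stronglyMeasurableAtFilter _ _) hc.continuousAt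
  set a : ℂ := J⁻¹ * (χ p - 1) with ha
  have hd : ∀ s, HasDerivAt χ (a * χ s) s := by
    intro s
    have h1 := (((hF (s + p)).comp_add_const s p).sub (hF s)).const_mul J⁻¹
    have h2 : J⁻¹ * (χ (s + p) - χ s) = a * χ s := by rw [hmul, ha]; ring
    rw [h2] at h1
    refine h1.congr_of_eventuallyEq (Eventually.of_forall fun x => ?_)
    exact hform x
  refine ⟨a, fun t => ?_⟩
  have he : ∀ s : ℝ, HasDerivAt (fun s : ℝ => Complex.exp (-(a * s))) (Complex.exp (-(a * s)) * (-a)) s := by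
    intro s
    have h1 : HasDerivAt (fun s : ℝ => (s : ℂ)) 1 s := Complex.ofRealCLM.hasDerivAt
    have h2 := ((h1.const_mul a).neg).cexp
    simpa using h2
  have hprod : ∀ s : ℝ, HasDerivAt (fun s : ℝ => χ s * Complex.exp (-(a * s))) 0 s := by
    intro s
    have := (hd s).mul (he s)
    have e : a * χ s * Complex.exp (-(a * s)) + χ s * (Complex.exp (-(a * s)) * -a) = 0 := by ring
    rw [e] at this
    exact this
  have hconst := is_const_of_deriv_eq_zero (fun s => (hprod s).differentiableAt)
    (fun s => (hprod s).deriv) t 0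
  simp only [h0, Complex.ofReal_zero, mul_zero, neg_zero, Complex.exp_zero, mul_one] at hconst
  rw [Complex.exp_neg] at hconst
  have := Complex.exp_ne_zero (a * t)
  field_simp at hconst
  exact hconst

/-- Continuous unitary characters of `ℝⁿ` are the exponentials `e^{i⟨x, l⟩}`. -/
lemma exists_realExp_of_continuous {n : ℕ} {χ : (Fin n → ℝ) → ℂ} (hc : Continuous χ)
    (h0 : χ 0 = 1) (hmul : ∀ s t, χ (s + t) = χ s * χ t) (hn : ∀ t, ‖χ t‖ = 1) :
    ∃ l, ∀ t, χ t = realExp l t := by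
  have h1 : ∀ k : Fin n, ∃ l : ℝ, ∀ t : ℝ, χ (Pi.single k t) = Complex.exp (Complex.I * (t * l)) := by
    intro k
    obtain ⟨a, ha⟩ := exists_exp_of_continuous_mul (χ := fun t : ℝ => χ (Pi.single k t))
      (hc.comp (continuous_single (A := fun _ : Fin n => ℝ) k)) (by simpa using h0)
      (fun s t => by rw [Pi.single_add, hmul])
    -- Modulus one forces the exponent to be purely imaginary.
    have hre : a.re = 0 := by
      have := hn (Pi.single k 1)
      rw [ha 1, Complex.norm_exp] at this
      simpa using this
    refine ⟨a.im, fun t => ?_⟩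
    rw [ha t]
    congr 1
    apply Complex.ext <;> simp [hre, mul_comm]
  choose l hl using h1
  refine ⟨l, fun t => ?_⟩
  have h2 : ∀ S : Finset (Fin n), χ (∑ k ∈ S, Pi.single k (t k)) = ∏ k ∈ S, χ (Pi.single k (t k)) := by
    classical
    intro S
    induction S using Finset.induction_on with
    | empty => simpa using h0
    | insert k S hk ih => rw [Finset.sum_insert hk, Finset.prod_insert hk, hmul, ih]
  have h3 := h2 Finset.univ
  rw [Finset.univ_sum_single] at h3
  rw [h3, realExp, pairing, Finset.mul_sum, Complex.exp_sum]
  exact Finset.prod_congr rfl fun k _ => hl k (t k)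

end Characters

/-! ### The uniqueness theorem: closure properties of almost periodic functions -/

section Uniqueness

variable {n : ℕ} {d : (Fin n → ℝ) → ℝ}
variable {X : Type*} [NormedAddCommGroup X] [NormedSpace ℂ X]

lemma UniformAP.add {u v : (Fin n → ℝ) → X} (hu : UniformAP d u) (hv : UniformAP d v) :
    UniformAP d (fun x => u x + v x) := by
  intro ε hε
  obtain ⟨δ, hδ, h⟩ := hu (ε / 2) (by positivity)
  obtain ⟨δ', hδ', h'⟩ := hv (ε / 2) (by positivity)
  refine ⟨min δ δ', lt_min hδ hδ', fun τ hτ x => ?_⟩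
  have h1 := h τ (hτ.trans_le (min_le_left _ _)) x
  have h2 := h' τ (hτ.trans_le (min_le_right _ _)) x
  have h3 := norm_add_le (u (x + τ) - u x) (v (x + τ) - v x)
  rw [show u (x + τ) + v (x + τ) - (u x + v x) = u (x + τ) - u x + (v (x + τ) - v x) by abel]
  linarith

lemma uniformAP_const (c : X) : UniformAP d (fun _ => c) := fun ε hε =>
  ⟨1, one_pos, fun _ _ _ => by simpa using hε.le⟩

lemma UniformAP.star {u : (Fin n → ℝ) → ℂ} (hu : UniformAP d u) :
    UniformAP d (fun x => starRingEnd ℂ (u x)) := by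
  intro ε hε
  obtain ⟨δ, hδ, h⟩ := hu ε hε
  refine ⟨δ, hδ, fun τ hτ x => ?_⟩
  rw [← map_sub, RCLike.norm_conj]
  exact h τ hτ x

lemma UniformAP.neg_arg {u : (Fin n → ℝ) → X} (hu : UniformAP d u) :
    UniformAP d (fun x => u (-x)) := by
  intro ε hε
  obtain ⟨δ, hδ, h⟩ := hu ε hε
  refine ⟨δ, hδ, fun τ hτ x => ?_⟩
  have := h τ hτ (-(x + τ))
  rw [norm_sub_rev]
  simpa using this

lemma UniformAP.shift {u : (Fin n → ℝ) → X} (hu : UniformAP d u) (t : Fin n → ℝ) :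
    UniformAP d (fun x => u (x + t)) := by
  intro ε hε
  obtain ⟨δ, hδ, h⟩ := hu ε hε
  refine ⟨δ, hδ, fun τ hτ x => ?_⟩
  have := h τ hτ (x + t)
  rwa [add_right_comm] at this

lemma UniformAP.smul (hd : IsGauge d) {g : (Fin n → ℝ) → ℂ} {u : (Fin n → ℝ) → X}
    (hg : UniformAP d g) (hu : UniformAP d u) : UniformAP d (fun x => g x • u x) := by
  obtain ⟨B, hB⟩ := hg.bounded hd
  obtain ⟨B', hB'⟩ := hu.bounded hd
  intro ε hε
  have hB0 : 0 ≤ B := (norm_nonneg _).trans (hB 0)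
  have hB0' : 0 ≤ B' := (norm_nonneg _).trans (hB' 0)
  obtain ⟨δ, hδ, h⟩ := hg (ε / (2 * (B' + 1))) (by positivity)
  obtain ⟨δ', hδ', h'⟩ := hu (ε / (2 * (B + 1))) (by positivity)
  refine ⟨min δ δ', lt_min hδ hδ', fun τ hτ x => ?_⟩
  have h1 := h τ (hτ.trans_le (min_le_left _ _)) x
  have h2 := h' τ (hτ.trans_le (min_le_right _ _)) x
  have e : g (x + τ) • u (x + τ) - g x • u x =
      g (x + τ) • (u (x + τ) - u x) + (g (x + τ) - g x) • u x := by
    rw [smul_sub, sub_smul]; abel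
  rw [e]
  calc _ ≤ ‖g (x + τ)‖ * ‖u (x + τ) - u x‖ + ‖g (x + τ) - g x‖ * ‖u x‖ := by
        rw [← norm_smul, ← norm_smul]; exact norm_add_le _ _
    _ ≤ (B + 1) * (ε / (2 * (B + 1))) + ε / (2 * (B' + 1)) * (B' + 1) := by
        gcongr
        · linarith [hB (x + τ)]
        · linarith [hB' x]
    _ = ε := by field_simp; ring

lemma UniformAP.mul (hd : IsGauge d) {g u : (Fin n → ℝ) → ℂ} (hg : UniformAP d g)
    (hu : UniformAP d u) : UniformAP d (fun x => g x * u x) := hg.smul hd hu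

lemma UniformAP.const_smul {u : (Fin n → ℝ) → X} (hu : UniformAP d u) (c : ℂ) :
    UniformAP d (fun x => c • u x) := by
  intro ε hε
  obtain ⟨δ, hδ, h⟩ := hu (ε / (‖c‖ + 1)) (by positivity)
  refine ⟨δ, hδ, fun τ hτ x => ?_⟩
  have h1 := h τ hτ x
  rw [← smul_sub, norm_smul]
  calc _ ≤ (‖c‖ + 1) * (ε / (‖c‖ + 1)) := by gcongr; linarith
    _ = ε := by field_simp

lemma UniformAP.clm {Y : Type*} [NormedAddCommGroup Y] [NormedSpace ℂ Y] (L : X →L[ℂ] Y)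
    {u : (Fin n → ℝ) → X} (hu : UniformAP d u) : UniformAP d (fun x => L (u x)) := by
  intro ε hε
  obtain ⟨δ, hδ, h⟩ := hu (ε / (‖L‖ + 1)) (by positivity)
  refine ⟨δ, hδ, fun τ hτ x => ?_⟩
  have h1 := h τ hτ x
  rw [← map_sub]
  calc _ ≤ ‖L‖ * ‖u (x + τ) - u x‖ := L.le_opNorm _
    _ ≤ (‖L‖ + 1) * (ε / (‖L‖ + 1)) := by gcongr; linarith
    _ = ε := by field_simp

/-! ### The Banach space of almost periodic functions and its translations -/

variable (d) in
/-- The Banach space of scalar almost periodic functions controlled by the gauge `d`. -/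
def apSpace : Submodule ℂ ((Fin n → ℝ) →ᵇ ℂ) where
  carrier := {f | UniformAP d f}
  add_mem' hf hg := hf.add hg
  zero_mem' := uniformAP_const 0
  smul_mem' c _ hf := hf.const_smul c

lemma isClosed_apSpace : IsClosed (apSpace d : Set ((Fin n → ℝ) →ᵇ ℂ)) := by
  refine isClosed_of_closure_subset fun f hf => ?_
  intro ε hε
  obtain ⟨g, hg, hfg⟩ := Metric.mem_closure_iff.1 hf (ε / 3) (by positivity)
  obtain ⟨δ, hδ, h⟩ := hg (ε / 3) (by positivity)
  refine ⟨δ, hδ, fun τ hτ x => ?_⟩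
  have h1 := h τ hτ x
  have h2 := (BoundedContinuousFunction.dist_coe_le_dist (f := f) (g := g) (x + τ)).trans hfg.le
  have h3 := (BoundedContinuousFunction.dist_coe_le_dist (f := f) (g := g) x).trans hfg.le
  rw [dist_eq_norm] at h2 h3
  rw [norm_sub_rev] at h3
  have e : f (x + τ) - f x = (f (x + τ) - g (x + τ)) + (g (x + τ) - g x) + (g x - f x) := by ring
  rw [e]
  refine (norm_add₃_le).trans ?_
  linarith

variable (d) in
/-- The type of scalar almost periodic functions controlled by the gauge `d`. -/
def APFun : Type := apSpace d

instance : NormedAddCommGroup (APFun d) := inferInstanceAs (NormedAddCommGroup (apSpace d))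

instance : NormedSpace ℂ (APFun d) := inferInstanceAs (NormedSpace ℂ (apSpace d))

instance : CompleteSpace (APFun d) := isClosed_apSpace.completeSpace_coe

/-- Evaluation at a point. -/
def apEval (x : Fin n → ℝ) : APFun d →L[ℂ] ℂ :=
  LinearMap.mkContinuous
    { toFun := fun f => f.1 x
      map_add' := fun _ _ => rfl
      map_smul' := fun _ _ => rfl } 1 (fun f => by
        rw [one_mul]
        exact f.1.norm_coe_le_norm x)

lemma apSpace_norm_le (f : APFun d) (x : Fin n → ℝ) : ‖f.1 x‖ ≤ ‖f‖ := f.1.norm_coe_le_norm x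

lemma apSpace_norm_le_of_forall {f : APFun d} {C : ℝ} (hC : 0 ≤ C) (h : ∀ x, ‖f.1 x‖ ≤ C) :
    ‖f‖ ≤ C := (BoundedContinuousFunction.norm_le hC).2 h

/-- The element of `APFun d` given by an almost periodic function. -/
def toApSpace (hd : IsGauge d) (u : (Fin n → ℝ) → ℂ) (hu : UniformAP d u) : APFun d :=
  (⟨BoundedContinuousFunction.ofNormedAddCommGroup u (hu.continuous hd) (hu.bounded hd).choose
    (hu.bounded hd).choose_spec, hu⟩ : apSpace d)

@[simp] lemma toApSpace_apply (hd : IsGauge d) (u : (Fin n → ℝ) → ℂ) (hu : UniformAP d u)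
    (x : Fin n → ℝ) : (toApSpace hd u hu).1 x = u x := rfl

/-- Translation by `t` on `APFun d`. -/
def apShift (t : Fin n → ℝ) : APFun d →L[ℂ] APFun d :=
  LinearMap.mkContinuous
    { toFun := fun f =>
        (⟨f.1.compContinuous ⟨fun x => x + t, by fun_prop⟩, UniformAP.shift f.2 t⟩ : apSpace d)
      map_add' := fun _ _ => rfl
      map_smul' := fun _ _ => rfl } 1 (fun f => by
        rw [one_mul]
        exact apSpace_norm_le_of_forall (norm_nonneg _) fun _ => apSpace_norm_le f _)

@[simp] lemma apShift_apply (t : Fin n → ℝ) (f : APFun d) (x : Fin n → ℝ) :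
    (apShift t f).1 x = f.1 (x + t) := rfl

lemma norm_apShift_apply_le (t : Fin n → ℝ) (f : APFun d) : ‖apShift t f‖ ≤ ‖f‖ :=
  apSpace_norm_le_of_forall (norm_nonneg _) fun _ => apSpace_norm_le f _

lemma norm_apShift_le (t : Fin n → ℝ) : ‖(apShift t : APFun d →L[ℂ] APFun d)‖ ≤ 1 :=
  LinearMap.mkContinuous_norm_le _ zero_le_one _

lemma apSpace_ext {f g : APFun d} (h : ∀ x, f.1 x = g.1 x) : f = g :=
  Subtype.ext (BoundedContinuousFunction.ext h)

lemma apShift_add (s t : Fin n → ℝ) :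
    (apShift (s + t) : APFun d →L[ℂ] APFun d) = apShift s * apShift t := by
  refine ContinuousLinearMap.ext fun f => apSpace_ext fun x => ?_
  change f.1 (x + (s + t)) = f.1 (x + s + t)
  rw [add_assoc]

lemma apShift_zero : (apShift 0 : APFun d →L[ℂ] APFun d) = 1 :=
  ContinuousLinearMap.ext fun f => apSpace_ext fun x => by
    change f.1 (x + 0) = f.1 x
    rw [add_zero]

lemma apShift_comm (s t : Fin n → ℝ) :
    (apShift s : APFun d →L[ℂ] APFun d) * apShift t = apShift t * apShift s := by
  rw [← apShift_add, ← apShift_add, add_comm]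

/-- Almost periodicity of the orbit in the sup norm is what lets means be taken in the Banach space
itself, not just pointwise. -/
lemma uniformAP_apShift (k : APFun d) : UniformAP d (fun t => apShift t k) := by
  intro ε hε
  obtain ⟨δ, hδ, h⟩ := k.2 ε hε
  refine ⟨δ, hδ, fun τ hτ t => apSpace_norm_le_of_forall hε.le fun x => ?_⟩
  have := h τ hτ (x + t)
  rwa [add_assoc] at this

/-! ### Convolution operators -/

variable (hd : IsGauge d)

include hd in
lemma uniformAP_smul_apShift (g k : APFun d) : UniformAP d (fun t => g.1 t • apShift t k) :=
  UniformAP.smul hd g.2 (uniformAP_apShift k)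

include hd in
lemma norm_bohrMean_smul_apShift_le (g k : APFun d) :
    ‖bohrMean (fun t => g.1 t • apShift t k)‖ ≤ ‖g‖ * ‖k‖ := by
  refine HasMean.norm_le ((uniformAP_smul_apShift hd g k).hasMean hd) fun t => ?_
  rw [norm_smul]
  exact mul_le_mul (apSpace_norm_le g t) (norm_apShift_apply_le t k) (norm_nonneg _)
    (norm_nonneg _)

/-- The convolution type operator `k ↦ M_t (g(t) k(· + t))`. -/
def apConv (g : APFun d) : APFun d →L[ℂ] APFun d :=
  LinearMap.mkContinuous
    { toFun := fun k => bohrMean (fun t => g.1 t • apShift t k)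
      map_add' := fun k k' => by
        refine HasMean.bohrMean_eq ?_
        have h := ((uniformAP_smul_apShift hd g k).hasMean hd).add
          ((uniformAP_smul_apShift hd g k').hasMean hd)
          ((uniformAP_smul_apShift hd g k).integrableOn hd)
          ((uniformAP_smul_apShift hd g k').integrableOn hd)
        simpa only [map_add, smul_add] using h
      map_smul' := fun c k => by
        refine HasMean.bohrMean_eq ?_
        have h := ((uniformAP_smul_apShift hd g k).hasMean hd).const_smul c
        simpa only [map_smul, smul_comm c, RingHom.id_apply] using h }
    ‖g‖ (norm_bohrMean_smul_apShift_le hd g)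

lemma hasMean_apConv (g k : APFun d) :
    HasMean (fun t => g.1 t • apShift t k) (apConv hd g k) :=
  (uniformAP_smul_apShift hd g k).hasMean hd

lemma norm_apConv_le (g : APFun d) : ‖apConv hd g‖ ≤ ‖g‖ :=
  LinearMap.mkContinuous_norm_le _ (norm_nonneg _) _

lemma apConv_sub (g g' : APFun d) : apConv hd (g - g') = apConv hd g - apConv hd g' := by
  refine ContinuousLinearMap.ext fun k => ?_
  refine (hasMean_apConv hd (g - g') k).unique ?_
  have h := (hasMean_apConv hd g k).sub (hasMean_apConv hd g' k)
    ((uniformAP_smul_apShift hd g k).integrableOn hd)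
    ((uniformAP_smul_apShift hd g' k).integrableOn hd)
  refine Eq.mp ?_ h
  congr 1
  funext t
  exact (sub_smul _ _ _).symm

/-- An operator that commutes with the translations commutes with the convolution operators. -/
lemma apConv_commute {L : APFun d →L[ℂ] APFun d} (hL : ∀ t, L * apShift t = apShift t * L)
    (g : APFun d) : L * apConv hd g = apConv hd g * L := by
  refine ContinuousLinearMap.ext fun k => ?_
  refine HasMean.unique ((hasMean_apConv hd g k).clm L
    ((uniformAP_smul_apShift hd g k).integrableOn hd)) ?_
  have h := hasMean_apConv hd g (L k)
  refine Eq.mp ?_ h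
  congr 1
  funext t
  have h1 : L (apShift t k) = apShift t (L k) :=
    congrArg (fun P : APFun d →L[ℂ] APFun d => P k) (hL t)
  rw [map_smul, h1]

lemma apShift_mul_apConv (s : Fin n → ℝ) (g : APFun d) :
    apShift s * apConv hd g = apConv hd g * apShift s :=
  apConv_commute hd (fun t => apShift_comm s t) g

/-- A convolution operator is a mean of translations, so whatever commutes with all translations
commutes with it; convolution operators themselves do. -/
lemma apConv_mul_comm (g h : APFun d) :
    apConv hd g * apConv hd h = apConv hd h * apConv hd g :=
  apConv_commute hd (fun t => (apShift_mul_apConv hd t g).symm) h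

/-- The translation is absorbed into g by invariance of the mean. Hence t ↦ T_t C_g is almost
periodic in operator norm, although t ↦ T_t alone need not even be norm continuous. -/
lemma apShift_mul_apConv_eq (s : Fin n → ℝ) (g : APFun d) :
    apShift s * apConv hd g = apConv hd (apShift (-s) g) := by
  rw [apShift_mul_apConv]
  refine ContinuousLinearMap.ext fun k => ?_
  refine (hasMean_apConv hd g (apShift s k)).unique ?_
  have h := hasMean_apConv hd (apShift (-s) g) k
  obtain ⟨B, hB⟩ := (uniformAP_smul_apShift hd (apShift (-s) g) k).bounded hd
  have h' := h.shift ((uniformAP_smul_apShift hd (apShift (-s) g) k).continuous hd) hB s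
  refine Eq.mp ?_ h'
  congr 1
  funext t
  rw [apShift_apply, apShift_add, add_neg_cancel_right]
  rfl

include hd in
lemma norm_apShift_mul_apConv_sub_le {ε δ : ℝ} {g : APFun d} (hε : 0 ≤ ε)
    (h : ∀ τ, d τ < δ → ∀ x, ‖g.1 (x + τ) - g.1 x‖ ≤ ε) {τ : Fin n → ℝ} (hτ : d τ < δ)
    (t : Fin n → ℝ) :
    ‖apShift (t + τ) * apConv hd g - apShift t * apConv hd g‖ ≤ ε := by
  have e : apShift (t + τ) * apConv hd g - apShift t * apConv hd g =
      apShift t * apConv hd (apShift (-τ) g - g) := by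
    rw [apShift_add, mul_assoc, apShift_mul_apConv_eq hd τ, apConv_sub]
    exact (mul_sub (apShift t : APFun d →L[ℂ] APFun d) _ _).symm
  rw [e]
  calc _ ≤ ‖(apShift t : APFun d →L[ℂ] APFun d)‖ * ‖apConv hd (apShift (-τ) g - g)‖ :=
        ContinuousLinearMap.opNorm_comp_le _ _
    _ ≤ 1 * ‖apShift (-τ) g - g‖ := by
        gcongr
        · exact norm_apShift_le t
        · exact norm_apConv_le hd _
    _ ≤ ε := by
        rw [one_mul]
        refine apSpace_norm_le_of_forall hε fun x => ?_
        have := h τ hτ (x + -τ)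
        rw [neg_add_cancel_right, norm_sub_rev] at this
        exact this

include hd in
lemma uniformAP_apShift_mul_apConv (g : APFun d) :
    UniformAP d (fun t => apShift t * apConv hd g) := by
  intro ε hε
  obtain ⟨δ, hδ, h⟩ := g.2 ε hε
  exact ⟨δ, hδ, fun τ hτ t => norm_apShift_mul_apConv_sub_le hd hε.le h hτ t⟩

/-- The mean converges in operator norm, so a continuous functional on operators can be pulled
through it. The limit is identified by evaluating at each vector. -/
lemma hasMean_smul_apShift_mul_apConv (g h : APFun d) :
    HasMean (fun t => g.1 t • (apShift t * apConv hd h)) (apConv hd g * apConv hd h) := by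
  have hu : UniformAP d (fun t => g.1 t • (apShift t * apConv hd h)) :=
    UniformAP.smul hd g.2 (uniformAP_apShift_mul_apConv hd h)
  have hm := hu.hasMean hd
  suffices e : bohrMean (fun t => g.1 t • (apShift t * apConv hd h)) =
      apConv hd g * apConv hd h by rwa [e] at hm
  refine ContinuousLinearMap.ext fun k => ?_
  have h1 := hm.clm (ContinuousLinearMap.apply ℂ (APFun d) k) (hu.integrableOn hd)
  exact h1.unique (hasMean_apConv hd g (apConv hd h k))

/-! ### The mean inner product and the spectral lower bound -/

/-- The mean value sesquilinear form on `APFun d`. -/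
def apInner (u v : APFun d) : ℂ := bohrMean (fun x => u.1 x * starRingEnd ℂ (v.1 x))

include hd in
lemma uniformAP_mul_star (u v : APFun d) :
    UniformAP d (fun x => u.1 x * starRingEnd ℂ (v.1 x)) := UniformAP.mul hd u.2 (UniformAP.star v.2)

include hd in
lemma hasMean_apInner (u v : APFun d) :
    HasMean (fun x => u.1 x * starRingEnd ℂ (v.1 x)) (apInner u v) :=
  (uniformAP_mul_star hd u v).hasMean hd

include hd in
lemma apInner_conj (u v : APFun d) : starRingEnd ℂ (apInner u v) = apInner v u := by
  refine (hasMean_apInner hd u v).star.unique ?_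
  have h := hasMean_apInner hd v u
  simpa [mul_comm] using h

include hd in
lemma apInner_add_left (u u' v : APFun d) :
    apInner (u + u') v = apInner u v + apInner u' v := by
  refine (hasMean_apInner hd (u + u') v).unique ?_
  have h := (hasMean_apInner hd u v).add (hasMean_apInner hd u' v)
    ((uniformAP_mul_star hd u v).integrableOn hd) ((uniformAP_mul_star hd u' v).integrableOn hd)
  refine Eq.mp ?_ h
  congr 1
  funext x
  exact (add_mul (u.1 x) (u'.1 x) _).symm

include hd in
lemma apInner_smul_left (c : ℂ) (u v : APFun d) : apInner (c • u) v = c * apInner u v := by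
  refine (hasMean_apInner hd (c • u) v).unique ?_
  have h := (hasMean_apInner hd u v).const_smul c
  refine Eq.mp ?_ h
  congr 1
  funext x
  exact (mul_assoc c (u.1 x) _).symm

include hd in
lemma norm_apInner_le (u v : APFun d) : ‖apInner u v‖ ≤ ‖u‖ * ‖v‖ := by
  refine (hasMean_apInner hd u v).norm_le fun x => ?_
  rw [norm_mul, RCLike.norm_conj]
  exact mul_le_mul (apSpace_norm_le u x) (apSpace_norm_le v x) (norm_nonneg _) (norm_nonneg _)

/-- The functional `u ↦ apInner u v`. -/
def apInnerLeft (v : APFun d) : APFun d →L[ℂ] ℂ :=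
  LinearMap.mkContinuous
    { toFun := fun u => apInner u v
      map_add' := fun u u' => apInner_add_left hd u u' v
      map_smul' := fun c u => apInner_smul_left hd c u v } ‖v‖
    (fun u => (norm_apInner_le hd u v).trans (mul_comm _ _).le)

include hd in
lemma apInner_shift (u v : APFun d) (t : Fin n → ℝ) :
    apInner (apShift t u) v = apInner u (apShift (-t) v) := by
  obtain ⟨B, hB⟩ := (uniformAP_mul_star hd u (apShift (-t) v)).bounded hd
  have h := (hasMean_apInner hd u (apShift (-t) v)).shift
    ((uniformAP_mul_star hd u (apShift (-t) v)).continuous hd) hB t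
  refine (hasMean_apInner hd (apShift t u) v).unique ?_
  simpa using h

/-- The involution `g ↦ conj g(-·)`. -/
def apAdj (g : APFun d) : APFun d :=
  toApSpace hd (fun x => starRingEnd ℂ (g.1 (-x))) (UniformAP.star (UniformAP.neg_arg g.2))

lemma hasMean_apInner_apConv (g u v : APFun d) :
    HasMean (fun t => g.1 t * apInner (apShift t u) v) (apInner (apConv hd g u) v) := by
  have h := (hasMean_apConv hd g u).clm (apInnerLeft hd v)
    ((uniformAP_smul_apShift hd g u).integrableOn hd)
  simp only [map_smul, smul_eq_mul] at h
  exact h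

/-- The adjoint of translation by t is translation by -t; conjugating and substituting -t for t in
the mean gives the adjoint convolution. -/
lemma apInner_apConv (g u v : APFun d) :
    apInner (apConv hd g u) v = apInner u (apConv hd (apAdj hd g) v) := by
  rw [← apInner_conj hd _ u]
  refine (hasMean_apInner_apConv hd g u v).unique ?_
  have h := (hasMean_apInner_apConv hd (apAdj hd g) v u).star.neg_arg
  refine Eq.mp ?_ h
  congr 1
  funext t
  simp only [apAdj, toApSpace_apply, map_mul, neg_neg, Complex.conj_conj]
  rw [apInner_conj hd, apInner_shift hd u v t]

lemma apAdj_apAdj (g : APFun d) : apAdj hd (apAdj hd g) = g :=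
  apSpace_ext fun x => by simp [apAdj]

include hd in
lemma apInner_self_re_nonneg (u : APFun d) : 0 ≤ (apInner u u).re := by
  have := (hasMean_const (n := n) (0 : ℂ)).re_mono (hasMean_apInner hd u u)
    ((uniformAP_const (d := d) (0 : ℂ)).integrableOn hd)
    ((uniformAP_mul_star hd u u).integrableOn hd)
    (fun x => by rw [Complex.mul_conj, Complex.ofReal_re]; exact Complex.normSq_nonneg _)
  simpa using this

include hd in
-- Since |u|² is at least a/2 at almost-period translates of x₀, finitely many translates of |u|²
-- have sum at least a/2 everywhere. Each translate has the same mean, so that mean is positive.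
lemma apInner_self_re_pos {u : APFun d} (hu : u ≠ 0) : 0 < (apInner u u).re := by
  obtain ⟨x₀, hx₀⟩ : ∃ x₀, u.1 x₀ ≠ 0 := by
    by_contra! h
    exact hu (apSpace_ext h)
  set a := Complex.normSq (u.1 x₀) with ha
  have hapos : 0 < a := Complex.normSq_pos.2 hx₀
  set w : (Fin n → ℝ) → ℂ := fun x => u.1 x * starRingEnd ℂ (u.1 x) with hw
  have hwAP : UniformAP d w := uniformAP_mul_star hd u u
  have hwre : ∀ x, (w x).re = Complex.normSq (u.1 x) := fun x => by
    rw [hw]; simp only [Complex.mul_conj, Complex.ofReal_re]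
  obtain ⟨δ, hδ, h⟩ := hwAP (a / 2) (by positivity)
  obtain ⟨T, hT⟩ := hd.net δ hδ
  obtain ⟨B, hB⟩ := hwAP.bounded hd
  have hmean : HasMean (fun x => ∑ t ∈ T, w (x + (x₀ - t))) (∑ t ∈ T, apInner u u) :=
    HasMean.sum T (fun t _ => (hasMean_apInner hd u u).shift (hwAP.continuous hd) hB _)
      (fun t _ => (hwAP.shift _).integrableOn hd)
  have hlow := (hasMean_const (n := n) ((a / 2 : ℝ) : ℂ)).re_mono hmean
    ((uniformAP_const (d := d) _).integrableOn hd)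
    (fun s => integrable_finsetSum _ fun t _ => (hwAP.shift _).integrableOn hd s) (fun x => by
      obtain ⟨t, ht, hxt⟩ := hT x
      have h1 := h _ hxt x₀
      have h2 : |(w (x₀ + (x - t)) - w x₀).re| ≤ a / 2 := (Complex.abs_re_le_norm _).trans h1
      rw [Complex.sub_re, hwre x₀] at h2
      have h3 : a / 2 ≤ (w (x + (x₀ - t))).re := by
        rw [show x + (x₀ - t) = x₀ + (x - t) by abel]
        linarith [(abs_le.1 h2).1]
      rw [Complex.ofReal_re, Complex.re_sum]
      exact h3.trans (Finset.single_le_sum (f := fun t => (w (x + (x₀ - t))).re)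
        (fun t _ => by simp only [hwre]; exact Complex.normSq_nonneg _) ht))
  rw [Complex.ofReal_re, Finset.sum_const, nsmul_eq_mul, ← Complex.ofReal_natCast,
    Complex.re_ofReal_mul] at hlow
  by_contra! hneg
  have := mul_nonpos_of_nonneg_of_nonpos (Nat.cast_nonneg (α := ℝ) T.card) hneg
  linarith

include hd in
lemma apInner_re_sq_le (u v : APFun d) :
    (apInner u v).re ^ 2 ≤ (apInner u u).re * (apInner v v).re := by
  -- This quadratic is the real part of the inner square of x u + v; its discriminant gives
  -- Cauchy–Schwarz.
  have hq : ∀ x : ℝ, 0 ≤ (apInner u u).re * (x * x) + 2 * (apInner u v).re * x +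
      (apInner v v).re := by
    intro x
    have h := apInner_self_re_nonneg hd ((x : ℂ) • u + v)
    have e : apInner ((x : ℂ) • u + v) ((x : ℂ) • u + v) =
        x * (x * apInner u u) + x * apInner u v + (x * apInner v u + apInner v v) := by
      rw [apInner_add_left hd, apInner_smul_left hd, ← apInner_conj hd _ u, ← apInner_conj hd _ v,
        apInner_add_left hd, apInner_add_left hd, apInner_smul_left hd, apInner_smul_left hd]
      simp only [map_add, map_mul, apInner_conj hd, Complex.conj_ofReal]
      ring
    rw [e, ← apInner_conj hd u v] at h
    simp only [Complex.add_re, Complex.re_ofReal_mul, Complex.conj_re] at h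
    nlinarith
  have := discrim_le_zero hq
  rw [discrim] at this
  nlinarith

include hd in
lemma apInner_self_le_norm_sq (u : APFun d) : (apInner u u).re ≤ ‖u‖ ^ 2 := by
  have h1 := (Complex.re_le_norm _).trans (norm_apInner_le hd u u)
  nlinarith

include hd in
/-- The powers of a nonzero positive operator are bounded below geometrically. -/
lemma exists_pow_lower_bound {P : APFun d →L[ℂ] APFun d}
    (hsymm : ∀ u v, apInner (P u) v = apInner u (P v)) {u : APFun d}
    (hu : P u ≠ 0) : ∃ c > 0, ∃ ρ > 0, ∀ k : ℕ, c * ρ ^ k ≤ ‖P ^ k‖ := by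
  set m : ℕ → ℝ := fun k => (apInner ((P ^ k) u) ((P ^ k) u)).re with hm
  have hsucc : ∀ k w, (P ^ (k + 1)) w = P ((P ^ k) w) := fun k w => by rw [pow_succ']; rfl
  have hu0 : u ≠ 0 := by rintro rfl; exact hu (map_zero P)
  have hm0 : 0 < m 0 := by simpa [hm] using apInner_self_re_pos hd hu0
  have hm1 : 0 < m 1 := by simpa [hm] using apInner_self_re_pos hd hu
  -- Log-convexity: symmetry moves one factor P across, so m (k + 1) is the inner product of Pᵏu
  -- with Pᵏ⁺²u.
  have hlog : ∀ k, m (k + 1) ^ 2 ≤ m k * m (k + 2) := by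
    intro k
    have e : m (k + 1) = (apInner ((P ^ k) u) ((P ^ (k + 2)) u)).re := by
      rw [hm]
      simp only
      rw [hsucc k, hsymm, ← hsucc k, ← hsucc (k + 1)]
    rw [e]
    exact apInner_re_sq_le hd _ _
  set r : ℝ := m 1 / m 0 with hr
  have hrpos : 0 < r := div_pos hm1 hm0
  -- Log-convexity makes successive ratios nondecreasing, so all are at least the first ratio r.
  have hind : ∀ k, 0 < m k ∧ r * m k ≤ m (k + 1) := by
    intro k
    induction k with
    | zero => exact ⟨hm0, by rw [hr, div_mul_cancel₀ _ hm0.ne']⟩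
    | succ k ih =>
      have hpos : 0 < m (k + 1) := (mul_pos hrpos ih.1).trans_le ih.2
      refine ⟨hpos, ?_⟩
      have h1 := hlog k
      have h2 : m k * (r * m (k + 1)) ≤ m k * m (k + 2) := by
        nlinarith [mul_le_mul_of_nonneg_right ih.2 hpos.le]
      exact le_of_mul_le_mul_left h2 ih.1
  have hlow : ∀ k, m 0 * r ^ k ≤ m k := by
    intro k
    induction k with
    | zero => simp
    | succ k ih =>
      calc m 0 * r ^ (k + 1) = r * (m 0 * r ^ k) := by ring
        _ ≤ r * m k := by gcongr
        _ ≤ _ := (hind k).2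
  have hunorm : 0 < ‖u‖ := norm_pos_iff.2 hu0
  -- Square roots appear because m k is a squared mean norm, dominated by the squared sup norm of
  -- Pᵏu.
  refine ⟨√(m 0) / ‖u‖, by positivity, √r, by positivity, fun k => ?_⟩
  have h1 : √(m 0) * √r ^ k ≤ ‖(P ^ k) u‖ := by
    refine abs_le_of_sq_le_sq' ?_ (norm_nonneg _) |>.2
    rw [mul_pow, Real.sq_sqrt hm0.le, ← pow_mul, mul_comm k, pow_mul, Real.sq_sqrt hrpos.le]
    exact (hlow k).trans (apInner_self_le_norm_sq hd _)
  have h2 := (P ^ k).le_opNorm u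
  rw [div_mul_eq_mul_div, div_le_iff₀ hunorm]
  linarith

/-- **Uniqueness theorem**: a nonzero almost periodic function has a nonzero Bohr coefficient, at
a frequency controlled by the same gauge. -/
theorem exists_bohrMean_ne_zero (hd : IsGauge d) {g : (Fin n → ℝ) → ℂ} (hg : UniformAP d g) (hne : g ≠ 0) :
    ∃ l, UniformAP d (realExp l) ∧ bohrMean (fun t => g t * realExp l t) ≠ 0 := by
  set G : APFun d := toApSpace hd g hg with hG
  have hG0 : G ≠ 0 := fun h => hne (funext fun x => by
    exact congrArg (apEval x) h)
  have : Nontrivial (APFun d) := ⟨G, 0, hG0⟩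
  set C := apConv hd G with hC
  set Ca := apConv hd (apAdj hd G) with hCa
  set P := Ca * C with hP
  have hsymm : ∀ u v, apInner (P u) v = apInner u (P v) := by
    intro u v
    change apInner (Ca (C u)) v = apInner u (Ca (C v))
    rw [hCa, apInner_apConv hd, apAdj_apAdj, hC, apInner_apConv hd]
  -- For this test vector, C U takes at 0 the value M(|g|²) > 0.
  set U : APFun d := toApSpace hd (fun x => starRingEnd ℂ (G.1 x)) (UniformAP.star G.2) with hU
  have hCU : C U ≠ 0 := by
    intro h0
    have h1 := hasMean_apConv hd G U
    have hev : HasMean (fun t => (g t * starRingEnd ℂ (g t))) ((C U).1 0) := by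
      have h2 := h1.clm (apEval 0) ((uniformAP_smul_apShift hd G U).integrableOn hd)
      refine Eq.mp ?_ h2
      congr 1
      funext t
      change g t * starRingEnd ℂ (g (0 + t)) = g t * starRingEnd ℂ (g t)
      rw [zero_add]
    have h3 := hev.unique (hasMean_apInner hd G G)
    have h4 := apInner_self_re_pos hd hG0
    rw [← h3, h0] at h4
    exact lt_irrefl (0 : ℝ) h4
  -- The inner product of P U with U is that of C U with itself.
  have hPU : P U ≠ 0 := by
    intro h0
    have h1 := apInner_self_re_pos hd hCU
    rw [hC, apInner_apConv hd, ← hC, ← hCa] at h1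
    have h2 : Ca (C U) = 0 := h0
    rw [h2, ← apInner_conj hd, ← zero_smul ℂ (0 : APFun d), apInner_smul_left hd] at h1
    simp at h1
  obtain ⟨c, hc, ρ, hρ, hpow⟩ := exists_pow_lower_bound hd hsymm hPU
  set S : Set (APFun d →L[ℂ] APFun d) := Set.range apShift ∪ Set.range (apConv hd) with hS
  have hcomm : ∀ a ∈ S, ∀ b ∈ S, a * b = b * a := by
    rintro _ (⟨s, rfl⟩ | ⟨f, rfl⟩) _ (⟨t, rfl⟩ | ⟨h, rfl⟩)
    · exact apShift_comm s t
    · exact apShift_mul_apConv hd s h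
    · exact (apShift_mul_apConv hd t f).symm
    · exact apConv_mul_comm hd f h
  have hmemT : ∀ t, apShift t ∈ Algebra.adjoin ℂ S := fun t =>
    Algebra.subset_adjoin (Or.inl ⟨t, rfl⟩)
  have hmemC : ∀ f, apConv hd f ∈ Algebra.adjoin ℂ S := fun f =>
    Algebra.subset_adjoin (Or.inr ⟨f, rfl⟩)
  obtain ⟨Φ, hΦmul, hΦ1, hΦP⟩ := exists_multiplicative_functional hcomm
    (mul_mem (hmemC (apAdj hd G)) (hmemC G)) hc hρ hpow
  have hΦC : Φ C ≠ 0 := by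
    intro h0
    apply hΦP
    rw [hΦmul _ (hmemC _) _ (hmemC _), ← hC, h0, mul_zero]
  set χ : (Fin n → ℝ) → ℂ := fun t => Φ (apShift t) with hχ
  have hχ0 : χ 0 = 1 := by rw [hχ]; simp only [apShift_zero, hΦ1]
  have hχmul : ∀ s t, χ (s + t) = χ s * χ t := fun s t => by
    rw [hχ]; simp only [apShift_add]; exact hΦmul _ (hmemT s) _ (hmemT t)
  have hχC : ∀ t, Φ (apShift t * C) = χ t * Φ C := fun t => hΦmul _ (hmemT t) _ (hmemC G)
  -- As Φ(C) ≠ 0, χ(t) is the quotient of Φ(T_t C) by Φ(C) and inherits the norm almost periodicity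
  -- of T_t C.
  have hχAP : UniformAP d χ := by
    have h1 : UniformAP d (fun t => Φ (apShift t * C)) :=
      (uniformAP_apShift_mul_apConv hd G).clm Φ
    have h2 := h1.const_smul (Φ C)⁻¹
    simp only [hχC, smul_eq_mul] at h2
    refine Eq.mp ?_ h2
    congr 1
    funext t
    field_simp
  obtain ⟨B, hB⟩ := hχAP.bounded hd
  -- A value of modulus greater than 1 would have unbounded powers χ(kt).
  have hle1 : ∀ t, ‖χ t‖ ≤ 1 := by
    intro t
    by_contra! h
    have hpowt : ∀ k : ℕ, χ (k • t) = χ t ^ k := by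
      intro k
      induction k with
      | zero => simpa using hχ0
      | succ k ih => rw [succ_nsmul, hχmul, ih, pow_succ]
    obtain ⟨k, hk⟩ := ((tendsto_pow_atTop_atTop_of_one_lt h).eventually_gt_atTop B).exists
    have := hB (k • t)
    rw [hpowt, norm_pow] at this
    linarith
  have hnorm : ∀ t, ‖χ t‖ = 1 := by
    intro t
    refine le_antisymm (hle1 t) ?_
    have h1 := hχmul t (-t)
    rw [add_neg_cancel, hχ0] at h1
    have h2 := congrArg norm h1
    rw [norm_one, norm_mul] at h2
    nlinarith [hle1 t, hle1 (-t), norm_nonneg (χ t)]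
  obtain ⟨l, hl⟩ := exists_realExp_of_continuous (hχAP.continuous hd) hχ0 hχmul hnorm
  have hχl : χ = realExp l := funext hl
  refine ⟨l, hχl ▸ hχAP, ?_⟩
  rw [← hχl]
  -- Applying Φ to C² = M_t(g(t) T_t C) gives M(gχ) Φ(C) = Φ(C)²; cancelling identifies the
  -- coefficient as Φ(C) ≠ 0.
  have hm1 : HasMean (fun t => g t * χ t * Φ C) (Φ C * Φ C) := by
    have h1 := (hasMean_smul_apShift_mul_apConv hd G G).clm Φ
      ((UniformAP.smul hd G.2 (uniformAP_apShift_mul_apConv hd G)).integrableOn hd)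
    rw [hΦmul _ (hmemC G) _ (hmemC G)] at h1
    refine Eq.mp ?_ h1
    congr 1
    funext t
    rw [map_smul, hχC, smul_eq_mul, mul_assoc]
    rfl
  have hm2 : HasMean (fun t => g t * χ t) (Φ C) := by
    have h1 := hm1.const_smul (Φ C)⁻¹
    rw [smul_eq_mul, inv_mul_cancel_left₀ hΦC] at h1
    refine Eq.mp ?_ h1
    congr 1
    funext t
    rw [smul_eq_mul]
    field_simp
  rw [hm2.bohrMean_eq]
  exact hΦC

end Uniqueness

/-! ### Exponentials, their gauges and their means -/

section Exponentials

variable {n : ℕ}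

/-- The inclusion `ℝⁿ ⊆ ℂⁿ`. -/
def toComplex (x : Fin n → ℝ) : Fin n → ℂ := fun k => (x k : ℂ)

/-- The exponential `z ↦ e^{i⟨z, l⟩}` on `ℂⁿ`. -/
def cplxExp (l : Fin n → ℝ) (z : Fin n → ℂ) : ℂ := Complex.exp (Complex.I * pairing z l)

lemma cplxExp_toComplex (l x : Fin n → ℝ) : cplxExp l (toComplex x) = realExp l x := rfl

lemma pairing_realShift (z : Fin n → ℂ) (t l : Fin n → ℝ) :
    pairing (realShift z t) l = pairing z l + pairing (toComplex t) l := by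
  simp [pairing, realShift, toComplex, add_mul, Finset.sum_add_distrib]

lemma pairing_neg_right (z : Fin n → ℂ) (l : Fin n → ℝ) : pairing z (-l) = -pairing z l := by
  simp [pairing]

lemma pairing_toComplex (x l : Fin n → ℝ) : pairing (toComplex x) l = ((dotProduct x l : ℝ) : ℂ) := by
  simp [pairing, toComplex, dotProduct]

lemma realExp_eq (l x : Fin n → ℝ) :
    realExp l x = Complex.exp (((dotProduct x l : ℝ) : ℂ) * Complex.I) := by
  rw [← cplxExp_toComplex, cplxExp, pairing_toComplex, mul_comm]

lemma realExp_add_left (l l' x : Fin n → ℝ) : realExp (l + l') x = realExp l x * realExp l' x := by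
  simp only [realExp_eq, dotProduct_add, Complex.ofReal_add, add_mul, Complex.exp_add]

lemma realExp_add_right (l x y : Fin n → ℝ) : realExp l (x + y) = realExp l x * realExp l y := by
  simp only [realExp_eq, add_dotProduct, Complex.ofReal_add, add_mul, Complex.exp_add]

@[simp] lemma realExp_zero_left (x : Fin n → ℝ) : realExp 0 x = 1 := by
  simp [realExp_eq]

@[simp] lemma realExp_zero_right (l : Fin n → ℝ) : realExp l 0 = 1 := by
  simp [realExp_eq]

lemma norm_realExp (l x : Fin n → ℝ) : ‖realExp l x‖ = 1 := by
  rw [realExp_eq, Complex.norm_exp_ofReal_mul_I]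

lemma realExp_ne_zero (l x : Fin n → ℝ) : realExp l x ≠ 0 := Complex.exp_ne_zero _

lemma realExp_neg_left (l x : Fin n → ℝ) : realExp (-l) x = realExp l (-x) := by
  simp [realExp_eq]

lemma realExp_neg_right (l x : Fin n → ℝ) : realExp l (-x) = (realExp l x)⁻¹ := by
  simp [realExp_eq, Complex.exp_neg]

lemma continuous_realExp (l : Fin n → ℝ) : Continuous (realExp l) := by
  unfold realExp pairing
  fun_prop

lemma cplxExp_realShift (l : Fin n → ℝ) (z : Fin n → ℂ) (t : Fin n → ℝ) :
    cplxExp l (realShift z t) = cplxExp l z * realExp l t := by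
  rw [cplxExp, pairing_realShift, mul_add, Complex.exp_add]
  rfl

lemma differentiable_cplxExp (l : Fin n → ℝ) : Differentiable ℂ (cplxExp l) := by
  unfold cplxExp pairing
  fun_prop

lemma imPart_realShift (z : Fin n → ℂ) (t : Fin n → ℝ) : imPart (realShift z t) = imPart z := by
  funext k; simp [imPart, realShift]

lemma realShift_mem_tube {Ω : Set (Fin n → ℝ)} {z : Fin n → ℂ} (hz : z ∈ tube Ω)
    (t : Fin n → ℝ) : realShift z t ∈ tube Ω := by
  change imPart (realShift z t) ∈ Ω
  rwa [imPart_realShift]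

lemma realShift_realShift (z : Fin n → ℂ) (s t : Fin n → ℝ) :
    realShift (realShift z s) t = realShift z (s + t) := by
  funext k; simp [realShift, add_assoc]

lemma toComplex_add (s t : Fin n → ℝ) : toComplex (s + t) = realShift (toComplex s) t := by
  funext k; simp [toComplex, realShift]

lemma realShift_eq_add (z : Fin n → ℂ) (t : Fin n → ℝ) : realShift z t = z + toComplex t := rfl

lemma continuous_toComplex : Continuous (toComplex : (Fin n → ℝ) → Fin n → ℂ) := by
  unfold toComplex; fun_prop

lemma norm_toComplex (t : Fin n → ℝ) : ‖toComplex t‖ = ‖t‖ := by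
  simp [Pi.norm_def, toComplex]

/-- A finite family of frequencies defines a gauge. -/
lemma isGauge_sum_realExp {ι : Type*} [Fintype ι] (v : ι → Fin n → ℝ) :
    IsGauge (fun t => ∑ i, ‖realExp (v i) t - 1‖) := by
  refine ⟨fun δ hδ => ?_, fun δ hδ => ?_⟩
  · set Φ : (Fin n → ℝ) → (ι → ℂ) := fun t i => realExp (v i) t with hΦ
    have hb : Bornology.IsBounded (Set.range Φ) := by
      refine (Metric.isBounded_closedBall (x := (0 : ι → ℂ)) (r := 1)).subset ?_
      rintro _ ⟨t, rfl⟩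
      rw [mem_closedBall_zero_iff, pi_norm_le_iff_of_nonneg zero_le_one]
      exact fun i => (norm_realExp _ _).le
    have htb : TotallyBounded (Set.range Φ) :=
      (Metric.isCompact_of_isClosed_isBounded isClosed_closure hb.closure).totallyBounded.subset
        subset_closure
    obtain ⟨T, hT, hTfin, hcov⟩ := Metric.finite_approx_of_totallyBounded htb
      (δ / (Fintype.card ι + 1)) (by positivity)
    choose! σ hσ using fun y (hy : y ∈ T) => hT hy
    refine ⟨hTfin.toFinset.image σ, fun x => ?_⟩
    obtain ⟨y, hy, hxy⟩ := Set.mem_iUnion₂.1 (hcov ⟨x, rfl⟩)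
    refine ⟨σ y, Finset.mem_image_of_mem _ (hTfin.mem_toFinset.2 hy), ?_⟩
    rw [Metric.mem_ball, ← hσ y hy, dist_eq_norm] at hxy
    have h1 : ∀ i, ‖realExp (v i) (x - σ y) - 1‖ ≤ δ / (Fintype.card ι + 1) := by
      intro i
      have h2 := (norm_le_pi_norm (Φ x - Φ (σ y)) i).trans hxy.le
      have e : realExp (v i) (x - σ y) - 1 =
          realExp (v i) (-σ y) * ((Φ x - Φ (σ y)) i) := by
        rw [Pi.sub_apply, hΦ, sub_eq_add_neg x, realExp_add_right]
        simp only
        rw [mul_sub, realExp_neg_right, inv_mul_cancel₀ (realExp_ne_zero _ _), mul_comm]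
      rw [e, norm_mul, norm_realExp, one_mul]
      exact h2
    calc ∑ i, ‖realExp (v i) (x - σ y) - 1‖ ≤ ∑ _i : ι, δ / (Fintype.card ι + 1) :=
          Finset.sum_le_sum fun i _ => h1 i
      _ = Fintype.card ι * δ / (Fintype.card ι + 1) := by
          rw [Finset.sum_const, nsmul_eq_mul, Finset.card_univ, mul_div_assoc]
      _ < δ := by
          rw [div_lt_iff₀ (by positivity)]; nlinarith
  · have hc : Continuous fun t => ∑ i, ‖realExp (v i) t - 1‖ :=
      continuous_finsetSum _ fun i _ => ((continuous_realExp (v i)).sub continuous_const).norm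
    have := hc.tendsto 0
    simp only [realExp_zero_right, sub_self, norm_zero, Finset.sum_const_zero] at this
    exact this.eventually (gt_mem_nhds hδ)

lemma uniformAP_realExp {ι : Type*} [Fintype ι] (v : ι → Fin n → ℝ) (i : ι) :
    UniformAP (fun t => ∑ i, ‖realExp (v i) t - 1‖) (realExp (v i)) := by
  intro ε hε
  refine ⟨ε, hε, fun τ hτ x => ?_⟩
  rw [realExp_add_right, ← mul_sub_one, norm_mul, norm_realExp, one_mul]
  exact (Finset.single_le_sum (f := fun i => ‖realExp (v i) τ - 1‖) (fun _ _ => norm_nonneg _)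
    (Finset.mem_univ i)).trans hτ.le

lemma hasMean_realExp_self (l : Fin n → ℝ) :
    HasMean (realExp l) (bohrMean (realExp l)) :=
  (uniformAP_realExp (fun _ : Unit => l) ()).hasMean (isGauge_sum_realExp _)

lemma integrableOn_realExp (l : Fin n → ℝ) (s : ℝ) : IntegrableOn (realExp l) (cube n s) :=
  integrableOn_cube (continuous_realExp l) (fun x => (norm_realExp l x).le) s

/-- Translation by τ with e^{i⟨τ, l⟩} = -1 negates the function but preserves its mean. -/
lemma hasMean_realExp_of_ne_zero {l : Fin n → ℝ} (hl : l ≠ 0) : HasMean (realExp l) 0 := by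
  have h := hasMean_realExp_self l
  have hll : dotProduct l l ≠ 0 := fun h0 => hl (dotProduct_self_eq_zero.1 h0)
  set τ : Fin n → ℝ := (Real.pi / dotProduct l l) • l with hτ
  have he : realExp l τ = -1 := by
    rw [realExp_eq, hτ, smul_dotProduct, smul_eq_mul, div_mul_cancel₀ _ hll, Complex.exp_pi_mul_I]
  have h1 := h.shift (continuous_realExp l) (fun x => (norm_realExp l x).le) τ
  simp only [realExp_add_right, he, mul_comm _ (-1 : ℂ)] at h1
  have h2 := h.const_smul (-1)
  have h3 := h1.unique h2
  rw [smul_eq_mul] at h3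
  have h4 : bohrMean (realExp l) = 0 := by linear_combination h3 / 2
  rwa [h4] at h

lemma hasMean_realExp (l : Fin n → ℝ) [Decidable (l = 0)] :
    HasMean (realExp l) (if l = 0 then 1 else 0) := by
  split_ifs with h
  · subst h
    have := hasMean_const (n := n) (1 : ℂ)
    refine Eq.mp ?_ this
    congr 1
    funext x
    rw [realExp_zero_left]
  · exact hasMean_realExp_of_ne_zero h

/-- A sufficient condition for the value of the Bohr transform. -/
lemma bohrTransform_eq {f : (Fin n → ℂ) → ℂ} {l : Fin n → ℝ} {m : ℂ}
    (h : HasMean (fun x => f (toComplex x) * realExp (-l) x) m) : bohrTransform f l = m := by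
  have e : (fun x : Fin n → ℝ => f (toComplex x) * realExp (-l) x) =
      fun x => Complex.exp (-Complex.I * pairing (fun k => (x k : ℂ)) l) *
        f (fun k => (x k : ℂ)) := by
    funext x
    rw [mul_comm, ← cplxExp_toComplex, cplxExp, pairing_neg_right, mul_neg, neg_mul]
    rfl
  rw [e] at h
  exact h.limUnder_eq

end Exponentials

/-! ### The identity theorem for entire functions -/

section Identity

lemma entire_eq_zero_of_real {h : ℂ → ℂ} (hh : Differentiable ℂ h) (h0 : ∀ x : ℝ, h x = 0) :
    h = 0 := by
  refine AnalyticOnNhd.eq_of_frequently_eq (z₀ := 0) (fun z _ => hh.analyticAt z)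
    (fun z _ => analyticAt_const) ?_
  have ht : Tendsto (fun k : ℕ => ((1 / ((k : ℝ) + 1) : ℝ) : ℂ)) atTop (𝓝[≠] 0) := by
    rw [tendsto_nhdsWithin_iff]
    refine ⟨?_, Eventually.of_forall fun k => ?_⟩
    · have := (Complex.continuous_ofReal.tendsto 0).comp tendsto_one_div_add_atTop_nhds_zero_nat
      rw [Complex.ofReal_zero] at this
      exact this
    · rw [Set.mem_compl_iff, Set.mem_singleton_iff, Complex.ofReal_eq_zero]
      positivity
  exact ht.frequently (Frequently.of_forall fun k => h0 _)

/-- Entire functions on `ℂⁿ` that agree on `ℝⁿ` are equal. -/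
lemma entire_eq_of_eq_on_real {n : ℕ} {f g : (Fin n → ℂ) → ℂ} (hf : Differentiable ℂ f)
    (hg : Differentiable ℂ g) (h : ∀ x, f (toComplex x) = g (toComplex x)) : f = g := by
  funext z
  -- Restrict to the complex line Re z + w Im z: real w stay in ℝⁿ, and w = i gives z.
  have hd : Differentiable ℂ fun w : ℂ =>
      f (fun k => ((z k).re : ℂ) + w * ((z k).im : ℂ)) -
        g (fun k => ((z k).re : ℂ) + w * ((z k).im : ℂ)) := by
    have h1 : Differentiable ℂ fun w : ℂ =>
        (fun k => ((z k).re : ℂ) + w * ((z k).im : ℂ) : Fin n → ℂ) := by fun_prop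
    exact (hf.comp h1).sub (hg.comp h1)
  have h0 := congrFun (entire_eq_zero_of_real hd fun x => by
    have e : (fun k => ((z k).re : ℂ) + (x : ℂ) * ((z k).im : ℂ)) =
        toComplex (fun k => (z k).re + x * (z k).im) := by
      funext k; simp [toComplex]
    simp only [e, h, sub_self]) Complex.I
  have e : (fun k => ((z k).re : ℂ) + Complex.I * ((z k).im : ℂ)) = z := by
    funext k
    rw [mul_comm]
    exact Complex.re_add_im _
  simp only [e, Pi.zero_apply] at h0
  exact sub_eq_zero.1 h0

end Identity

/-! ### Bounds, uniform continuity and periods of holomorphic almost periodic mappings -/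

section HAP

variable {n m : ℕ} {F : (Fin n → ℂ) → (Fin m → ℂ)}

lemma IsHAP.exists_almostPeriods (hF : IsHAP F) {ε : ℝ} (hε : 0 < ε) {Ω : Set (Fin n → ℝ)}
    (hΩ : Bornology.IsBounded Ω) : ∃ R : ℝ, ∀ ξ : Fin n → ℝ, ∃ τ : Fin n → ℝ,
      ‖τ - ξ‖ ≤ R ∧ ∀ z ∈ tube Ω, ‖F (realShift z τ) - F z‖ ≤ ε := by
  obtain ⟨t, ht, h⟩ := hF.almostPeriodic ε hε Ω hΩ
  refine ⟨∑ k, t k, fun ξ => ?_⟩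
  obtain ⟨τ, hτ, δ, hδ, hz⟩ := h ξ
  refine ⟨τ, ?_, fun z hzΩ => ?_⟩
  · refine (pi_norm_le_iff_of_nonneg (Finset.sum_nonneg fun k _ => (ht k).le)).2 fun k => ?_
    exact (hτ k).le.trans (Finset.single_le_sum (fun k _ => (ht k).le) (Finset.mem_univ k))
  · exact (pi_norm_le_iff_of_nonneg hε.le).2 fun l => (hz z hzΩ l).trans hδ.le

/-- An almost period close to -Re z carries z into a fixed ball, so uniform statements on tubes
reduce to compactness. -/
lemma exists_realShift_norm_le {Ω : Set (Fin n → ℝ)} (hΩ : Bornology.IsBounded Ω) :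
    ∃ C : ℝ, ∀ z ∈ tube Ω, ∀ τ : Fin n → ℝ, ∀ R, ‖τ - -(fun k => (z k).re)‖ ≤ R →
      ‖realShift z τ‖ ≤ R + C := by
  obtain ⟨C, hC⟩ := hΩ.exists_norm_le
  refine ⟨C, fun z hz τ R hR => ?_⟩
  have e : realShift z τ = toComplex (τ - -(fun k => (z k).re)) + Complex.I • toComplex (imPart z) := by
    funext k
    simp only [realShift, toComplex, imPart, Pi.add_apply, Pi.smul_apply, smul_eq_mul, sub_neg_eq_add, Complex.ofReal_add]
    conv_lhs => rw [← Complex.re_add_im (z k)]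
    ring
  rw [e]
  refine (norm_add_le _ _).trans (add_le_add ?_ ?_)
  · rwa [norm_toComplex]
  · rw [norm_smul, Complex.norm_I, one_mul, norm_toComplex]
    exact hC _ hz

lemma IsHAP.exists_bound (hF : IsHAP F) {Ω : Set (Fin n → ℝ)} (hΩ : Bornology.IsBounded Ω) :
    ∃ B : ℝ, ∀ z ∈ tube Ω, ‖F z‖ ≤ B := by
  obtain ⟨R, hR⟩ := hF.exists_almostPeriods one_pos hΩ
  obtain ⟨C, hC⟩ := exists_realShift_norm_le hΩ
  obtain ⟨B, hB⟩ := (isCompact_closedBall (0 : Fin n → ℂ) (R + C)).exists_bound_of_continuousOn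
    hF.holomorphic.continuous.continuousOn
  refine ⟨B + 1, fun z hz => ?_⟩
  obtain ⟨τ, hτ, h⟩ := hR (-(fun k => (z k).re))
  have h1 := hB _ (mem_closedBall_zero_iff.2 (hC z hz τ R hτ))
  have h2 := h z hz
  have h3 := norm_sub_norm_le (F z) (F (realShift z τ))
  rw [norm_sub_rev] at h3
  linarith

lemma IsHAP.exists_modulus (hF : IsHAP F) {Ω : Set (Fin n → ℝ)} (hΩ : Bornology.IsBounded Ω)
    {ε : ℝ} (hε : 0 < ε) :
    ∃ ρ > 0, ∀ t : Fin n → ℝ, ‖t‖ < ρ → ∀ z ∈ tube Ω, ‖F (realShift z t) - F z‖ ≤ ε := by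
  obtain ⟨R, hR⟩ := hF.exists_almostPeriods (ε := ε / 3) (by positivity) hΩ
  obtain ⟨C, hC⟩ := exists_realShift_norm_le hΩ
  have huc := (isCompact_closedBall (0 : Fin n → ℂ) (R + C + 1)).uniformContinuousOn_of_continuous
    hF.holomorphic.continuous.continuousOn
  obtain ⟨ρ, hρ, h⟩ := Metric.uniformContinuousOn_iff.1 huc (ε / 3) (by positivity)
  refine ⟨min ρ 1, by positivity, fun t ht z hz => ?_⟩
  obtain ⟨τ, hτ, hper⟩ := hR (-(fun k => (z k).re))
  have h1 := hC z hz τ R hτ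
  have h2 : ‖realShift (realShift z τ) t‖ ≤ R + C + 1 := by
    rw [realShift_eq_add (realShift z τ)]
    refine (norm_add_le _ _).trans (add_le_add h1 ?_)
    rw [norm_toComplex]
    exact ht.le.trans (min_le_right _ _)
  have h3 := h (realShift (realShift z τ) t) (mem_closedBall_zero_iff.2 h2) (realShift z τ)
    (mem_closedBall_zero_iff.2 (by linarith)) (by
      rw [dist_eq_norm, realShift_eq_add (realShift z τ), add_sub_cancel_left, norm_toComplex]
      exact ht.trans_le (min_le_left _ _))
  rw [dist_eq_norm] at h3
  have h4 := hper z hz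
  have h5 := hper (realShift z t) (realShift_mem_tube hz t)
  rw [realShift_realShift, add_comm t τ, ← realShift_realShift] at h5
  rw [norm_sub_rev] at h5
  calc _ = ‖(F (realShift z t) - F (realShift (realShift z τ) t)) +
        (F (realShift (realShift z τ) t) - F (realShift z τ)) + (F (realShift z τ) - F z)‖ := by
        congr 1; abel
    _ ≤ _ := norm_add₃_le
    _ ≤ _ := by linarith

/-- The restriction of a holomorphic almost periodic mapping to `ℝⁿ` is controlled by a gauge. -/
lemma IsHAP.exists_gauge (hF : IsHAP F) :
    ∃ d : (Fin n → ℝ) → ℝ, IsGauge d ∧ UniformAP d (fun x => F (toComplex x)) := by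
  have hΩ : Bornology.IsBounded ({0} : Set (Fin n → ℝ)) := Bornology.isBounded_singleton
  have hmem : ∀ x : Fin n → ℝ, toComplex x ∈ tube ({0} : Set (Fin n → ℝ)) := fun x => by
    change imPart (toComplex x) = 0
    funext k; simp [imPart, toComplex]
  obtain ⟨B, hB⟩ := hF.exists_bound hΩ
  -- The gauge is the sup-norm displacement of F on ℝⁿ.
  set d : (Fin n → ℝ) → ℝ := fun τ => ⨆ x, ‖F (toComplex (x + τ)) - F (toComplex x)‖ with hd
  have hbdd : ∀ τ, BddAbove (Set.range fun x => ‖F (toComplex (x + τ)) - F (toComplex x)‖) := by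
    intro τ
    refine ⟨B + B, ?_⟩
    rintro _ ⟨x, rfl⟩
    exact (norm_sub_le _ _).trans (add_le_add (hB _ (hmem _)) (hB _ (hmem _)))
  refine ⟨d, ⟨fun δ hδ => ?_, fun δ hδ => ?_⟩, fun ε hε => ⟨ε, hε, fun τ hτ x => ?_⟩⟩
  -- Write x = τ + (x - τ) with τ an almost period near x. The remainder lies in a fixed ball, and
  -- the net T of that ball serves for all x.
  · obtain ⟨R, hR⟩ := hF.exists_almostPeriods (ε := δ / 3) (by positivity) hΩ
    obtain ⟨ρ, hρ, hmod⟩ := hF.exists_modulus hΩ (ε := δ / 3) (by positivity)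
    obtain ⟨T, -, hTfin, hcov⟩ := Metric.finite_approx_of_totallyBounded
      (isCompact_closedBall (0 : Fin n → ℝ) R).totallyBounded ρ hρ
    refine ⟨hTfin.toFinset, fun x => ?_⟩
    obtain ⟨τ, hτ, hper⟩ := hR x
    have hx : x - τ ∈ Metric.closedBall (0 : Fin n → ℝ) R := by
      rw [mem_closedBall_zero_iff, norm_sub_rev]; exact hτ
    obtain ⟨t, ht, hxt⟩ := Set.mem_iUnion₂.1 (hcov hx)
    refine ⟨t, hTfin.mem_toFinset.2 ht, ?_⟩
    rw [Metric.mem_ball, dist_eq_norm] at hxt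
    have : d (x - t) ≤ 2 * δ / 3 := by
      refine ciSup_le fun y => ?_
      have h1 := hmod _ hxt _ (hmem (y + τ))
      have h2 := hper _ (hmem y)
      rw [← toComplex_add] at h1 h2
      rw [show y + τ + (x - τ - t) = y + (x - t) by abel] at h1
      have h3 := norm_sub_le_norm_sub_add_norm_sub (F (toComplex (y + (x - t))))
        (F (toComplex (y + τ))) (F (toComplex y))
      linarith
    linarith
  · obtain ⟨ρ, hρ, hmod⟩ := hF.exists_modulus hΩ (ε := δ / 2) (by positivity)
    filter_upwards [Metric.ball_mem_nhds (0 : Fin n → ℝ) hρ] with τ hτ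
    have : d τ ≤ δ / 2 := ciSup_le fun x => by
      rw [toComplex_add]
      exact hmod τ (mem_ball_zero_iff.1 hτ) _ (hmem x)
    linarith
  · exact (le_ciSup (hbdd τ) x).trans hτ.le

lemma UniformAP.component {d : (Fin n → ℝ) → ℝ} {u : (Fin n → ℝ) → Fin m → ℂ}
    (hu : UniformAP d u) (l : Fin m) : UniformAP d (fun x => u x l) := by
  intro ε hε
  obtain ⟨δ, hδ, h⟩ := hu ε hε
  exact ⟨δ, hδ, fun τ hτ x => (norm_le_pi_norm (u (x + τ) - u x) l).trans (h τ hτ x)⟩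

/-- A vector on which all the frequencies of `f` are trivial is a period of `f`. -/
lemma periodic_of_bohrSpectrum {f : (Fin n → ℂ) → ℂ} (hf : Differentiable ℂ f)
    {d : (Fin n → ℝ) → ℝ} (hd : IsGauge d) (hfd : UniformAP d (fun x => f (toComplex x)))
    {τ : Fin n → ℝ} (hτ : ∀ l ∈ bohrSpectrum f, realExp l τ = 1) (z : Fin n → ℂ) :
    f (realShift z τ) = f z := by
  suffices h : (fun z => f (realShift z τ)) = f from congrFun h z
  have hshift : Differentiable ℂ fun z => f (realShift z τ) :=
    hf.comp (differentiable_id.add_const (toComplex τ))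
  refine entire_eq_of_eq_on_real hshift hf ?_
  by_contra hne
  set u : (Fin n → ℝ) → ℂ := fun x => f (toComplex x) with hu
  have hg : UniformAP d (fun x => u (x + τ) + (-1 : ℂ) • u x) := (hfd.shift τ).add (hfd.const_smul _)
  obtain ⟨l, hl, hmean⟩ := exists_bohrMean_ne_zero hd hg (fun h0 => hne fun x => by
    have := congrFun h0 x
    simp only [hu, toComplex_add, Pi.zero_apply, smul_eq_mul, neg_mul, one_mul] at this
    linear_combination this)
  have hm := (hfd.mul hd hl).hasMean hd
  set μ := bohrMean (fun x => u x * realExp l x) with hμ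
  obtain ⟨B, hB⟩ := (hfd.mul hd hl).bounded hd
  have h1 := hm.shift ((hfd.mul hd hl).continuous hd) hB τ
  -- The coefficient of f(· + τ) - f is μ (e^{-i⟨τ, l⟩} - 1), where μ is the coefficient of f at -l.
  have h2 := (h1.const_smul (realExp l (-τ))).add (hm.const_smul (-1))
    ((((hfd.mul hd hl).shift τ).const_smul _).integrableOn hd)
    (((hfd.mul hd hl).const_smul _).integrableOn hd)
  have e : (fun x => realExp l (-τ) • (u (x + τ) * realExp l (x + τ)) +
      (-1 : ℂ) • (u x * realExp l x)) =
      fun x => (u (x + τ) + (-1 : ℂ) • u x) * realExp l x := by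
    funext x
    rw [realExp_add_right, realExp_neg_right]
    have := realExp_ne_zero l τ
    simp only [smul_eq_mul]
    field_simp
  rw [e] at h2
  rw [h2.bohrMean_eq] at hmean
  have hμ0 : μ ≠ 0 := by
    intro h0
    rw [h0] at hmean
    simp at hmean
  have hspec : bohrTransform f (-l) = μ := bohrTransform_eq (by rw [neg_neg]; exact hm)
  have h3 := hτ (-l) (by change bohrTransform f (-l) ≠ 0; rwa [hspec])
  rw [realExp_neg_left] at h3
  rw [h3] at hmean
  simp at hmean

end HAP

/-! ### Bohr coefficients along complex translates -/

section TubeAP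

variable {n : ℕ}

lemma differentiable_setIntegral_param {G : ℂ → (Fin n → ℝ) → ℂ}
    (hG : Continuous (Function.uncurry G)) (hhol : ∀ t, Differentiable ℂ fun w => G w t)
    (hbd : ∀ R : ℝ, ∃ B : ℝ, ∀ w, ‖w‖ ≤ R → ∀ t, ‖G w t‖ ≤ B) {S : Set (Fin n → ℝ)}
    (hS : volume S ≠ ⊤) : Differentiable ℂ fun w => ∫ t in S, G w t := by
  intro w₀
  -- One unit for the ball around w₀, another for the unit circles in the Cauchy estimate of the
  -- derivative.
  obtain ⟨B, hB⟩ := hbd (‖w₀‖ + 2)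
  have hfin : IsFiniteMeasure (volume.restrict S) := ⟨by simpa using hS.lt_top⟩
  have hmeas : ∀ w, AEStronglyMeasurable (G w) (volume.restrict S) := fun w =>
    (hG.comp (Continuous.prodMk_right w)).aestronglyMeasurable
  have hGs : Continuous (Function.uncurry fun (t : Fin n → ℝ) (w : ℂ) => G w t) :=
    hG.comp continuous_swap
  refine (hasDerivAt_integral_of_dominated_loc_of_deriv_le (s := Metric.ball w₀ 1)
    (F' := fun w t => deriv (fun w => G w t) w) (bound := fun _ => B / 1)
    (Metric.ball_mem_nhds w₀ one_pos) (Eventually.of_forall hmeas) ?_ ?_ ?_ ?_ ?_).2.differentiableAt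
  · exact Integrable.of_bound (C := B) (hmeas w₀) (Eventually.of_forall fun t => hB w₀ (by linarith) t)
  · exact ((stronglyMeasurable_deriv_with_param hGs).comp_measurable
      (measurable_prodMk_right (y := w₀))).aestronglyMeasurable
  · refine Eventually.of_forall fun t w hw => ?_
    refine Complex.norm_deriv_le_of_forall_mem_sphere_norm_le one_pos (hhol t).diffContOnCl
      fun z hz => hB z ?_ t
    rw [mem_ball_iff_norm] at hw
    rw [mem_sphere_iff_norm] at hz
    have h1 := norm_add₃_le (a := z - w) (b := w - w₀) (c := w₀)
    rw [show z - w + (w - w₀) + w₀ = z by ring] at h1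
    linarith
  · exact integrable_const _
  · exact Eventually.of_forall fun t w _ => (hhol t w).hasDerivAt

/-- An entire function that is bounded on tubes with bounded base and almost periodic there,
with almost periods controlled by the frequencies `b`. -/
structure TubeAP {ι : Type*} (b : ι → Fin n → ℝ) (f : (Fin n → ℂ) → ℂ) : Prop where
  differentiable : Differentiable ℂ f
  bounded : ∀ Ω : Set (Fin n → ℝ), Bornology.IsBounded Ω → ∃ B : ℝ, ∀ z ∈ tube Ω, ‖f z‖ ≤ B
  modulus : ∀ Ω : Set (Fin n → ℝ), Bornology.IsBounded Ω → ∀ ε > 0, ∃ δ > 0, ∀ t : Fin n → ℝ,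
    (∀ i, ‖realExp (b i) t - 1‖ < δ) → ∀ z ∈ tube Ω, ‖f (realShift z t) - f z‖ ≤ ε

variable {ι : Type*} [Fintype ι] {b : ι → Fin n → ℝ} {f : (Fin n → ℂ) → ℂ}

/-- The gauge of the frequencies `b` and `l`. -/
def optionGauge (b : ι → Fin n → ℝ) (l t : Fin n → ℝ) : ℝ :=
  ∑ i : Option ι, ‖realExp (i.elim (-l) b) t - 1‖

lemma isGauge_optionGauge (b : ι → Fin n → ℝ) (l : Fin n → ℝ) : IsGauge (optionGauge b l) :=
  isGauge_sum_realExp _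

lemma TubeAP.modulus_mul_realExp (hf : TubeAP b f) (l : Fin n → ℝ) {Ω : Set (Fin n → ℝ)}
    (hΩ : Bornology.IsBounded Ω) {ε : ℝ} (hε : 0 < ε) :
    ∃ δ > 0, ∀ z ∈ tube Ω, ∀ τ, optionGauge b l τ < δ → ∀ x,
      ‖f (realShift z (x + τ)) * realExp (-l) (x + τ) - f (realShift z x) * realExp (-l) x‖ ≤ ε := by
  obtain ⟨B, hB⟩ := hf.bounded Ω hΩ
  obtain ⟨δ, hδ, h⟩ := hf.modulus Ω hΩ (ε / 2) (by positivity)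
  have hB1 : 0 < |B| + 1 := by positivity
  refine ⟨min δ (ε / (2 * (|B| + 1))), by positivity, fun z hz τ hτ x => ?_⟩
  have hle : ∀ i : Option ι, ‖realExp (i.elim (-l) b) τ - 1‖ ≤ optionGauge b l τ := fun i =>
    Finset.single_le_sum (f := fun i : Option ι => ‖realExp (i.elim (-l) b) τ - 1‖)
      (fun _ _ => norm_nonneg _) (Finset.mem_univ i)
  have h1 := h τ (fun i => ((hle (some i)).trans_lt hτ).trans_le (min_le_left _ _))
    (realShift z x) (realShift_mem_tube hz x)
  rw [realShift_realShift] at h1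
  have h2 : ‖realExp (-l) τ - 1‖ ≤ ε / (2 * (|B| + 1)) :=
    (hle none).trans (hτ.le.trans (min_le_right _ _))
  have h3 : ‖f (realShift z x)‖ ≤ |B| + 1 := by
    have := hB _ (realShift_mem_tube hz x)
    linarith [le_abs_self B]
  have e : f (realShift z (x + τ)) * realExp (-l) (x + τ) - f (realShift z x) * realExp (-l) x =
      (f (realShift z (x + τ)) - f (realShift z x)) * realExp (-l) (x + τ) +
        f (realShift z x) * realExp (-l) x * (realExp (-l) τ - 1) := by
    rw [realExp_add_right]; ring
  rw [e]
  calc _ ≤ ‖f (realShift z (x + τ)) - f (realShift z x)‖ * ‖realExp (-l) (x + τ)‖ +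
        ‖f (realShift z x)‖ * ‖realExp (-l) x‖ * ‖realExp (-l) τ - 1‖ := by
        rw [← norm_mul, ← norm_mul, ← norm_mul]; exact norm_add_le _ _
    _ ≤ ε / 2 + (|B| + 1) * (ε / (2 * (|B| + 1))) := by
        rw [norm_realExp, norm_realExp, mul_one, mul_one]
        gcongr
    _ = ε := by field_simp; ring

/-- The function `t ↦ f(z + t) e^{-i⟨t, l⟩}`. -/
def twist (f : (Fin n → ℂ) → ℂ) (l : Fin n → ℝ) (z : Fin n → ℂ) (t : Fin n → ℝ) : ℂ :=
  f (realShift z t) * realExp (-l) t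

lemma isBounded_imPart_singleton (z : Fin n → ℂ) : Bornology.IsBounded ({imPart z} : Set (Fin n → ℝ)) :=
  Bornology.isBounded_singleton

lemma TubeAP.uniformAP_twist (hf : TubeAP b f) (l : Fin n → ℝ) (z : Fin n → ℂ) :
    UniformAP (optionGauge b l) (twist f l z) := by
  intro ε hε
  obtain ⟨δ, hδ, h⟩ := hf.modulus_mul_realExp l (isBounded_imPart_singleton z) hε
  exact ⟨δ, hδ, h z rfl⟩

lemma TubeAP.hasMean_twist_bohrMean (hf : TubeAP b f) (l : Fin n → ℝ) (z : Fin n → ℂ) :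
    HasMean (twist f l z) (bohrMean (twist f l z)) :=
  (hf.uniformAP_twist l z).hasMean (isGauge_optionGauge b l)

lemma TubeAP.continuous_twist (hf : TubeAP b f) (l : Fin n → ℝ) (z : Fin n → ℂ) :
    Continuous (twist f l z) := (hf.uniformAP_twist l z).continuous (isGauge_optionGauge b l)

lemma TubeAP.integrableOn_twist (hf : TubeAP b f) (l : Fin n → ℝ) (z : Fin n → ℂ) (s : ℝ) :
    IntegrableOn (twist f l z) (cube n s) :=
  (hf.uniformAP_twist l z).integrableOn (isGauge_optionGauge b l) s

lemma norm_twist_le {Ω : Set (Fin n → ℝ)} {B : ℝ} (hB : ∀ z ∈ tube Ω, ‖f z‖ ≤ B) (l : Fin n → ℝ)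
    {z : Fin n → ℂ} (hz : z ∈ tube Ω) (t : Fin n → ℝ) : ‖twist f l z t‖ ≤ B := by
  rw [twist, norm_mul, norm_realExp, mul_one]
  exact hB _ (realShift_mem_tube hz t)

/-- All the functions `twist f l z` with z in the tube share a bound and a modulus, hence a rate of
convergence. Uniformity in z makes the limiting mean holomorphic. -/
lemma TubeAP.uniform_cubeAvg (hf : TubeAP b f) (l : Fin n → ℝ) {Ω : Set (Fin n → ℝ)}
    (hΩ : Bornology.IsBounded Ω) {ε : ℝ} (hε : 0 < ε) :
    ∃ s₀ > 0, ∀ s ≥ s₀, ∀ z ∈ tube Ω,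
      ‖cubeAvg s (twist f l z) - bohrMean (twist f l z)‖ ≤ ε := by
  obtain ⟨B, hB⟩ := hf.bounded Ω hΩ
  obtain ⟨δ, hδ, h⟩ := hf.modulus_mul_realExp l hΩ (ε := ε / 4) (by positivity)
  obtain ⟨s₀, hs₀, h'⟩ := exists_forall_cubeAvg_close (X := ℂ) (isGauge_optionGauge b l) B
    (ε := ε / 4) (by positivity) hδ
  refine ⟨s₀, hs₀, fun s hs z hz => ?_⟩
  have hlim := ((tendsto_const_nhds (x := cubeAvg s (twist f l z))).sub
    (hf.hasMean_twist_bohrMean l z)).norm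
  refine le_of_tendsto hlim ?_
  filter_upwards [eventually_ge_atTop s₀] with s' hs'
  have := h' (twist f l z) (hf.continuous_twist l z) (norm_twist_le hB l hz) (h z hz) s hs s' hs'
  linarith

lemma TubeAP.bohrMean_twist_realShift (hf : TubeAP b f) (l : Fin n → ℝ) (z : Fin n → ℂ)
    (t : Fin n → ℝ) :
    bohrMean (twist f l (realShift z t)) = realExp l t * bohrMean (twist f l z) := by
  obtain ⟨B, hB⟩ := (hf.uniformAP_twist l z).bounded (isGauge_optionGauge b l)
  have h := ((hf.hasMean_twist_bohrMean l z).shift (hf.continuous_twist l z) hB t).const_smul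
    (realExp l t)
  refine HasMean.bohrMean_eq (Eq.mp ?_ h)
  congr 1
  funext x
  have := realExp_ne_zero l t
  rw [twist, twist, realShift_realShift, realExp_add_right, realExp_neg_left l t,
    realExp_neg_right, smul_eq_mul, add_comm t x]
  field_simp

/-- Real translations of z multiply both sides by e^{i⟨t, l⟩}. Along the line Re z + w Im z both
sides are entire in w and agree for real w, so they agree at w = i. -/
lemma TubeAP.bohrMean_twist (hf : TubeAP b f) (l : Fin n → ℝ) (z : Fin n → ℂ) :
    bohrMean (twist f l z) = bohrTransform f l * cplxExp l z := by
  have h0 : bohrTransform f l = bohrMean (twist f l 0) := by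
    refine bohrTransform_eq ?_
    have := hf.hasMean_twist_bohrMean l 0
    refine Eq.mp ?_ this
    congr 1
    funext x
    rw [twist]
    congr 2
    funext k
    simp [realShift, toComplex]
  set p : Fin n → ℝ := fun k => (z k).re with hp
  set q : Fin n → ℝ := imPart z with hq
  set γ : ℂ → Fin n → ℂ := fun w k => (p k : ℂ) + w * (q k : ℂ) with hγ
  have hγd : Differentiable ℂ γ := by rw [hγ]; fun_prop
  have hγI : γ Complex.I = z := by
    funext k
    rw [hγ]
    simp only [hp, hq, imPart]
    rw [mul_comm]
    exact Complex.re_add_im _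
  have hγr : ∀ x : ℝ, γ x = realShift 0 (p + x • q) := by
    intro x
    funext k
    simp [hγ, realShift]
  have htube : ∀ R : ℝ, ∃ Ω : Set (Fin n → ℝ), Bornology.IsBounded Ω ∧
      ∀ w, ‖w‖ ≤ R → γ w ∈ tube Ω := by
    intro R
    refine ⟨Metric.closedBall 0 (R * ‖q‖), Metric.isBounded_closedBall, fun w hw => ?_⟩
    change imPart (γ w) ∈ Metric.closedBall 0 (R * ‖q‖)
    have e : imPart (γ w) = w.im • q := by
      funext k
      simp [imPart, hγ]
    rw [e, mem_closedBall_zero_iff, norm_smul]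
    gcongr
    exact (Complex.abs_im_le_norm w).trans hw
  have hcd : Differentiable ℂ fun w => bohrMean (twist f l (γ w)) := by
    rw [← differentiableOn_univ]
    have hlim : TendstoLocallyUniformlyOn (fun (s : ℝ) w => cubeAvg s (twist f l (γ w)))
        (fun w => bohrMean (twist f l (γ w))) atTop Set.univ := by
      rw [Metric.tendstoLocallyUniformlyOn_iff]
      intro ε hε w _
      obtain ⟨Ω, hΩ, hmem⟩ := htube (‖w‖ + 1)
      obtain ⟨s₀, -, hs₀⟩ := hf.uniform_cubeAvg l hΩ (ε := ε / 2) (by positivity)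
      refine ⟨Metric.ball w 1, mem_nhdsWithin_of_mem_nhds (Metric.ball_mem_nhds w one_pos), ?_⟩
      filter_upwards [eventually_ge_atTop s₀] with s hs y hy
      rw [dist_comm, dist_eq_norm]
      have hyn : ‖y‖ ≤ ‖w‖ + 1 := by
        rw [mem_ball_iff_norm] at hy
        have := norm_sub_norm_le y w
        linarith
      have := hs₀ s hs (γ y) (hmem y hyn)
      linarith
    refine hlim.differentiableOn ?_ isOpen_univ
    · refine Eventually.of_forall fun s => ?_
      rw [differentiableOn_univ]
      simp only [cubeAvg, smul_eq_mul]
      refine Differentiable.const_mul ?_ _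
      refine differentiable_setIntegral_param (G := fun w t => twist f l (γ w) t) ?_ ?_ ?_
        (volume_cube_lt_top s).ne
      · have h1 : Continuous fun x : ℂ × (Fin n → ℝ) => realShift (γ x.1) x.2 := by
          have := hγd.continuous
          unfold realShift
          fun_prop
        exact (hf.differentiable.continuous.comp h1).mul
          ((continuous_realExp (-l)).comp continuous_snd)
      · intro t
        have h1 : Differentiable ℂ fun w => realShift (γ w) t := hγd.add_const (toComplex t)
        exact (hf.differentiable.comp h1).mul_const _
      · intro R
        obtain ⟨Ω, hΩ, hmem⟩ := htube R
        obtain ⟨B, hB⟩ := hf.bounded Ω hΩ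
        exact ⟨B, fun w hw t => norm_twist_le hB l (hmem w hw) t⟩
  have hd : Differentiable ℂ fun w =>
      bohrMean (twist f l (γ w)) - bohrTransform f l * cplxExp l (γ w) :=
    hcd.sub (((differentiable_cplxExp l).comp hγd).const_mul _)
  have h1 := congrFun (entire_eq_zero_of_real hd fun x => by
    have e0 : cplxExp l (0 : Fin n → ℂ) = 1 := by simp [cplxExp, pairing]
    rw [hγr, hf.bohrMean_twist_realShift, cplxExp_realShift, h0, e0]
    ring) Complex.I
  rw [hγI, Pi.zero_apply] at h1
  exact sub_eq_zero.1 h1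

/-- The Bohr coefficients along `ℝⁿ + z`. -/
lemma TubeAP.hasMean_twist (hf : TubeAP b f) (l : Fin n → ℝ) (z : Fin n → ℂ) :
    HasMean (fun t => f (realShift z t) * realExp (-l) t) (bohrTransform f l * cplxExp l z) := by
  rw [← hf.bohrMean_twist]
  exact hf.hasMean_twist_bohrMean l z

end TubeAP

/-! ### The one-dimensional Fejér kernel -/

section Fejer

lemma sum_Icc_neg_eq {M : Type*} [AddCommMonoid M] (g : ℤ → M) (N : ℕ) :
    ∑ ν ∈ Finset.Icc (-(N : ℤ)) N, g ν =
      g 0 + ∑ a ∈ Finset.range N, (g ((a : ℤ) + 1) + g (-((a : ℤ) + 1))) := by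
  induction N with
  | zero => simp
  | succ N ih =>
    have e : Finset.Icc (-((N + 1 : ℕ) : ℤ)) ((N + 1 : ℕ) : ℤ) =
        insert ((N : ℤ) + 1) (insert (-((N : ℤ) + 1)) (Finset.Icc (-(N : ℤ)) N)) := by
      ext x
      simp only [Finset.mem_Icc, Finset.mem_insert]
      push_cast
      omega
    rw [e, Finset.sum_insert, Finset.sum_insert, ih, Finset.sum_range_succ]
    · abel
    · simp
    · simp only [Finset.mem_insert, Finset.mem_Icc]; omega

/-- There are N - |ν| pairs of exponents below N with difference ν. The induction uses that passing
from N to N + 1 raises every weight by one. -/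
lemma fejer_identity {q : ℂ} (hq : q ≠ 0) (N : ℕ) :
    ∑ ν ∈ Finset.Icc (-(N : ℤ)) N, ((N : ℂ) - |(ν : ℝ)|) * q ^ ν =
      (∑ a ∈ Finset.range N, q ^ a) * ∑ a ∈ Finset.range N, (q⁻¹) ^ a := by
  have hrefl : ∀ (r : ℂ) (N : ℕ), ∑ a ∈ Finset.range N, r ^ (N - a) =
      ∑ a ∈ Finset.range N, r ^ (a + 1) := by
    intro r N
    rw [← Finset.sum_range_reflect]
    refine Finset.sum_congr rfl fun a ha => ?_
    have := Finset.mem_range.1 ha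
    congr 1
    omega
  induction N with
  | zero => simp
  | succ N ih =>
    have h1 : ∑ ν ∈ Finset.Icc (-((N + 1 : ℕ) : ℤ)) ((N + 1 : ℕ) : ℤ),
        (((N + 1 : ℕ) : ℂ) - |(ν : ℝ)|) * q ^ ν =
        (∑ ν ∈ Finset.Icc (-(N : ℤ)) N, ((N : ℂ) - |(ν : ℝ)|) * q ^ ν) +
          (1 + ∑ a ∈ Finset.range N, (q ^ (a + 1) + (q⁻¹) ^ (a + 1))) := by
      rw [sum_Icc_neg_eq, sum_Icc_neg_eq, Finset.sum_range_succ]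
      have hc : ∀ a : ℕ, |((((a : ℤ) + 1 : ℤ)) : ℝ)| = (a : ℝ) + 1 := by
        intro a
        push_cast
        rw [abs_of_nonneg (by positivity)]
      have hc' : ∀ a : ℕ, |(((-((a : ℤ) + 1) : ℤ)) : ℝ)| = (a : ℝ) + 1 := by
        intro a
        rw [Int.cast_neg, abs_neg, hc]
      have hz : ∀ a : ℕ, q ^ ((a : ℤ) + 1) = q ^ (a + 1) := by
        intro a
        exact_mod_cast zpow_natCast q (a + 1)
      have hz' : ∀ a : ℕ, q ^ (-((a : ℤ) + 1)) = (q⁻¹) ^ (a + 1) := by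
        intro a
        rw [zpow_neg, hz, inv_pow]
      simp only [hc, hc', hz, hz']
      push_cast
      rw [show ∑ x ∈ Finset.range N, (((N : ℂ) + 1 - (x + 1)) * q ^ (x + 1) +
          ((N : ℂ) + 1 - (x + 1)) * q⁻¹ ^ (x + 1)) =
          (∑ x ∈ Finset.range N, (((N : ℂ) - (x + 1)) * q ^ (x + 1) +
          ((N : ℂ) - (x + 1)) * q⁻¹ ^ (x + 1))) +
          ∑ x ∈ Finset.range N, (q ^ (x + 1) + q⁻¹ ^ (x + 1)) by
        rw [← Finset.sum_add_distrib]
        exact Finset.sum_congr rfl fun x _ => by ring]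
      simp
      ring
    rw [h1, ih, Finset.sum_range_succ, Finset.sum_range_succ]
    have h2 : (∑ a ∈ Finset.range N, q ^ a) * q⁻¹ ^ N = ∑ a ∈ Finset.range N, q⁻¹ ^ (a + 1) := by
      rw [← hrefl, Finset.sum_mul]
      refine Finset.sum_congr rfl fun a ha => ?_
      have := (Finset.mem_range.1 ha).le
      rw [inv_pow, inv_pow, ← pow_sub_mul_pow q this]
      have h3 := pow_ne_zero a hq
      have h4 := pow_ne_zero (N - a) hq
      field_simp
    have h3 : q ^ N * (∑ a ∈ Finset.range N, q⁻¹ ^ a) = ∑ a ∈ Finset.range N, q ^ (a + 1) := by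
      rw [← hrefl, Finset.mul_sum]
      refine Finset.sum_congr rfl fun a ha => ?_
      have := (Finset.mem_range.1 ha).le
      rw [inv_pow, ← pow_sub_mul_pow q this]
      have h3 := pow_ne_zero a hq
      field_simp
    have h4 : q ^ N * q⁻¹ ^ N = 1 := by
      rw [← mul_pow, mul_inv_cancel₀ hq, one_pow]
    rw [Finset.sum_add_distrib, ← h2, ← h3]
    linear_combination -h4

/-- The Fejér kernel is nonnegative. -/
lemma exists_fejer_eq_ofReal {q : ℂ} (hq : ‖q‖ = 1) {N : ℕ} (hN : 0 < N) :
    ∃ r : ℝ, 0 ≤ r ∧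
      ∑ ν ∈ Finset.Icc (-(N : ℤ)) N, ((1 - |(ν : ℝ)| / N : ℝ) : ℂ) * q ^ ν = r := by
  have hq0 : q ≠ 0 := by rintro rfl; simp at hq
  refine ⟨Complex.normSq (∑ a ∈ Finset.range N, q ^ a) / N, by
    have := Complex.normSq_nonneg (∑ a ∈ Finset.range N, q ^ a); positivity, ?_⟩
  have hN0 : (N : ℂ) ≠ 0 := by exact_mod_cast hN.ne'
  have h := fejer_identity hq0 N
  -- On the unit circle q⁻¹ is the conjugate of q, so the product of the two geometric sums is a
  -- squared modulus.
  have h1 : starRingEnd ℂ (∑ a ∈ Finset.range N, q ^ a) = ∑ a ∈ Finset.range N, (q⁻¹) ^ a := by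
    rw [map_sum]
    refine Finset.sum_congr rfl fun a _ => ?_
    rw [map_pow, Complex.inv_eq_conj hq]
  rw [← h1, Complex.mul_conj] at h
  rw [Complex.ofReal_div, ← h, Complex.ofReal_natCast, Finset.sum_div]
  refine Finset.sum_congr rfl fun ν _ => ?_
  push_cast
  field_simp

lemma one_sub_sum_le_prod_one_sub {ι : Type*} (S : Finset ι) (a : ι → ℝ) (h0 : ∀ i ∈ S, 0 ≤ a i)
    (h1 : ∀ i ∈ S, a i ≤ 1) : 1 - ∑ i ∈ S, a i ≤ ∏ i ∈ S, (1 - a i) := by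
  classical
  -- The induction also needs the product to stay in [0, 1].
  suffices h : 1 - ∑ i ∈ S, a i ≤ ∏ i ∈ S, (1 - a i) ∧ 0 ≤ ∏ i ∈ S, (1 - a i) ∧
      ∏ i ∈ S, (1 - a i) ≤ 1 from h.1
  induction S using Finset.induction_on with
  | empty => simp
  | insert i S hi ih =>
    obtain ⟨ih1, ih2, ih3⟩ := ih (fun j hj => h0 j (Finset.mem_insert_of_mem hj))
      (fun j hj => h1 j (Finset.mem_insert_of_mem hj))
    have hi0 := h0 i (Finset.mem_insert_self _ _)
    have hi1 := h1 i (Finset.mem_insert_self _ _)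
    rw [Finset.sum_insert hi, Finset.prod_insert hi]
    refine ⟨by nlinarith, mul_nonneg (by linarith) ih2, by nlinarith⟩

end Fejer

/-! ### Convolution with the multidimensional Fejér kernel -/

section FejerSums

variable {n : ℕ}

lemma HasMean.norm_le_re {u v : (Fin n → ℝ) → ℂ} {m m' : ℂ} (h : HasMean u m) (h' : HasMean v m')
    (hv : ∀ s, IntegrableOn v (cube n s)) (huv : ∀ x, ‖u x‖ ≤ (v x).re) : ‖m‖ ≤ m'.re := by
  refine le_of_tendsto_of_tendsto (Tendsto.norm h)
    ((Complex.continuous_re.tendsto m').comp h') ?_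
  filter_upwards [eventually_gt_atTop 0] with s hs
  have e : ((1 : ℂ) / (2 * (s : ℂ)) ^ n) = ((1 / (2 * s) ^ n : ℝ) : ℂ) := by push_cast; rfl
  simp only [cubeAvg, smul_eq_mul, Function.comp_apply]
  rw [e, Complex.re_ofReal_mul, norm_mul, Complex.norm_real, Real.norm_of_nonneg (by positivity)]
  refine mul_le_mul_of_nonneg_left ?_ (by positivity)
  have hv' := integral_re (hv s)
  simp only [RCLike.re_to_complex] at hv'
  rw [← hv']
  exact norm_integral_le_of_norm_le (hv s).re (Eventually.of_forall huv)

lemma integrableOn_const_smul {u : (Fin n → ℝ) → ℂ} {S : Set (Fin n → ℝ)} (c : ℂ)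
    (h : IntegrableOn u S) : IntegrableOn (fun x => c • u x) S := Integrable.smul c h

variable {κ : Type*} [Fintype κ] [DecidableEq κ]

/-- The frequency `∑ νᵣ vᵣ`. -/
def freqSum (v : κ → Fin n → ℝ) (ν : κ → ℤ) : Fin n → ℝ := ∑ r, (ν r : ℝ) • v r

/-- The weights of the Bochner-Fejér sums. -/
def fejerWeight (N : ℕ) (ν : κ → ℤ) : ℝ := ∏ r, (1 - |(ν r : ℝ)| / N)

variable (κ) in
/-- The index set of the Bochner-Fejér sums. -/
def fejerBox (N : ℕ) : Finset (κ → ℤ) := Fintype.piFinset fun _ => Finset.Icc (-(N : ℤ)) N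

/-- The Bochner-Fejér kernel. -/
def fejerKernel (v : κ → Fin n → ℝ) (N : ℕ) (t : Fin n → ℝ) : ℂ :=
  ∑ ν ∈ fejerBox κ N, (fejerWeight N ν : ℂ) * realExp (-freqSum v ν) t

lemma realExp_sum {ι : Type*} (S : Finset ι) (l : ι → Fin n → ℝ) (t : Fin n → ℝ) :
    realExp (∑ i ∈ S, l i) t = ∏ i ∈ S, realExp (l i) t := by
  classical
  induction S using Finset.induction_on with
  | empty => simp
  | insert i S hi ih => rw [Finset.sum_insert hi, Finset.prod_insert hi, realExp_add_left, ih]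

lemma realExp_intCast_smul (c : ℤ) (l t : Fin n → ℝ) :
    realExp ((c : ℝ) • l) t = realExp l t ^ c := by
  rw [realExp_eq, realExp_eq, ← Complex.exp_int_mul, dotProduct_smul, smul_eq_mul]
  push_cast
  rw [mul_assoc]

lemma realExp_neg_freqSum (v : κ → Fin n → ℝ) (ν : κ → ℤ) (t : Fin n → ℝ) :
    realExp (-freqSum v ν) t = ∏ r, realExp (-v r) t ^ ν r := by
  rw [freqSum, ← Finset.sum_neg_distrib, realExp_sum]
  refine Finset.prod_congr rfl fun r _ => ?_
  rw [← smul_neg, realExp_intCast_smul]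

lemma exists_fejerKernel_eq_ofReal (v : κ → Fin n → ℝ) {N : ℕ} (hN : 0 < N) (t : Fin n → ℝ) :
    ∃ r : ℝ, 0 ≤ r ∧ fejerKernel v N t = r := by
  choose ρ hρ0 hρ using fun r : κ => exists_fejer_eq_ofReal (norm_realExp (-v r) t) hN
  refine ⟨∏ r, ρ r, Finset.prod_nonneg fun r _ => hρ0 r, ?_⟩
  rw [Complex.ofReal_prod]
  simp_rw [← hρ]
  rw [Finset.prod_univ_sum, fejerKernel, fejerBox]
  refine Finset.sum_congr rfl fun ν _ => ?_
  rw [realExp_neg_freqSum, Finset.prod_mul_distrib, fejerWeight, Complex.ofReal_prod]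

lemma continuous_fejerKernel (v : κ → Fin n → ℝ) (N : ℕ) : Continuous (fejerKernel v N) :=
  continuous_finsetSum _ fun _ _ => continuous_const.mul (continuous_realExp _)

lemma exists_norm_fejerKernel_le (v : κ → Fin n → ℝ) (N : ℕ) :
    ∃ B, ∀ t, ‖fejerKernel v N t‖ ≤ B := by
  refine ⟨∑ ν ∈ fejerBox κ N, ‖(fejerWeight N ν : ℂ)‖, fun t => ?_⟩
  refine (norm_sum_le _ _).trans (Finset.sum_le_sum fun ν _ => ?_)
  rw [norm_mul, norm_realExp, mul_one]

/-- Orthogonality of exponentials: injectivity of `freqSum v` leaves only the term ν = μ. -/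
lemma hasMean_realExp_mul_fejerKernel {v : κ → Fin n → ℝ} (hv : Function.Injective (freqSum v))
    {N : ℕ} {μ : κ → ℤ} (hμ : μ ∈ fejerBox κ N) :
    HasMean (fun t => realExp (freqSum v μ) t * fejerKernel v N t) (fejerWeight N μ : ℂ) := by
  classical
  have h : ∀ ν ∈ fejerBox κ N, HasMean
      (fun t => (fejerWeight N ν : ℂ) • realExp (freqSum v μ - freqSum v ν) t)
      ((fejerWeight N ν : ℂ) • (if freqSum v μ - freqSum v ν = 0 then 1 else 0)) := fun ν _ =>
    (hasMean_realExp _).const_smul _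
  have h1 := HasMean.sum (fejerBox κ N) h fun ν _ s => integrableOn_const_smul _ (integrableOn_realExp _ s)
  rw [Finset.sum_eq_single μ] at h1
  · rw [sub_self, if_pos rfl, smul_eq_mul, mul_one] at h1
    refine Eq.mp ?_ h1
    congr 1
    funext t
    rw [fejerKernel, Finset.mul_sum]
    refine Finset.sum_congr rfl fun ν _ => ?_
    rw [sub_eq_add_neg, realExp_add_left, smul_eq_mul]
    ring
  · intro ν _ hne
    rw [if_neg, smul_zero]
    exact fun h0 => hne (hv (sub_eq_zero.1 h0)).symm
  · exact fun h0 => absurd hμ h0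

lemma hasMean_fejerKernel {v : κ → Fin n → ℝ} (hv : Function.Injective (freqSum v)) (N : ℕ) :
    HasMean (fejerKernel v N) 1 := by
  have h := hasMean_realExp_mul_fejerKernel hv (N := N) (μ := 0)
    (by simp [fejerBox])
  have e0 : freqSum v (0 : κ → ℤ) = 0 := by simp [freqSum]
  have e1 : fejerWeight N (0 : κ → ℤ) = 1 := by simp [fejerWeight]
  simpa [e0, e1] using h

variable {ι : Type*} [Fintype ι] {b : ι → Fin n → ℝ} {f : (Fin n → ℂ) → ℂ}

lemma TubeAP.hasMean_mul_fejerKernel (hf : TubeAP b f) (v : κ → Fin n → ℝ) (N : ℕ)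
    (z : Fin n → ℂ) :
    HasMean (fun t => f (realShift z t) * fejerKernel v N t)
      (∑ ν ∈ fejerBox κ N, (fejerWeight N ν : ℂ) * bohrTransform f (freqSum v ν) *
        cplxExp (freqSum v ν) z) := by
  have h1 := HasMean.sum (fejerBox κ N)
    (fun ν _ => (hf.hasMean_twist (freqSum v ν) z).const_smul (fejerWeight N ν : ℂ))
    (fun ν _ s => integrableOn_const_smul _ (hf.integrableOn_twist (freqSum v ν) z s))
  simp only [smul_eq_mul, ← mul_assoc] at h1
  refine Eq.mp ?_ h1
  congr 1
  funext t
  rw [fejerKernel, Finset.mul_sum]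
  exact Finset.sum_congr rfl fun ν _ => by ring

lemma norm_realExp_sub_one_sq (l t : Fin n → ℝ) :
    ‖realExp l t - 1‖ ^ 2 = 2 * (1 - (realExp l t).re) := by
  have h := norm_realExp l t
  have h1 : Complex.normSq (realExp l t) = 1 := by rw [Complex.normSq_eq_norm_sq, h, one_pow]
  rw [← Complex.normSq_eq_norm_sq, Complex.normSq_sub, h1]
  simp
  ring

/-- The error of the approximation by a Bochner-Fejér sum. -/
lemma TubeAP.norm_fejerSum_sub_le (hf : TubeAP b f) {v : κ → Fin n → ℝ}
    (hv : Function.Injective (freqSum v)) {N : ℕ} (hN : 0 < N) {μ : ι → κ → ℤ}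
    (hμ : ∀ i, freqSum v (μ i) = b i) (hbox : ∀ i, μ i ∈ fejerBox κ N) {z : Fin n → ℂ} {ε C : ℝ}
    (hmod : ∀ t, ‖f (realShift z t) - f z‖ ≤ ε + C * ∑ i, ‖realExp (b i) t - 1‖ ^ 2) :
    ‖(∑ ν ∈ fejerBox κ N, (fejerWeight N ν : ℂ) * bohrTransform f (freqSum v ν) *
        cplxExp (freqSum v ν) z) - f z‖ ≤ ε + 2 * C * ∑ i, (1 - fejerWeight N (μ i)) := by
  obtain ⟨B, hB⟩ := exists_norm_fejerKernel_le v N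
  obtain ⟨Bf, hBf⟩ := hf.bounded {imPart z} (isBounded_imPart_singleton z)
  have hKint : ∀ s, IntegrableOn (fejerKernel v N) (cube n s) :=
    integrableOn_cube (continuous_fejerKernel v N) hB
  have hKeint : ∀ i s, IntegrableOn (fun t => realExp (b i) t * fejerKernel v N t) (cube n s) :=
    fun i => integrableOn_cube ((continuous_realExp _).mul (continuous_fejerKernel v N))
      (fun t => by rw [norm_mul, norm_realExp, one_mul]; exact hB t)
  have hcont : Continuous fun t => f (realShift z t) := by
    refine hf.differentiable.continuous.comp ?_
    unfold realShift
    fun_prop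
  have hfint : ∀ s, IntegrableOn (fun t => f (realShift z t) * fejerKernel v N t) (cube n s) :=
    integrableOn_cube (hcont.mul (continuous_fejerKernel v N)) (B := Bf * B) (fun t => by
      have h0 := hBf (realShift z t) (realShift_mem_tube (Set.mem_singleton (imPart z)) t)
      rw [norm_mul]
      exact mul_le_mul h0 (hB t) (norm_nonneg _) ((norm_nonneg _).trans h0))
  have hK := hasMean_fejerKernel hv N
  have hleft := (hf.hasMean_mul_fejerKernel v N z).sub (hK.const_smul (f z)) hfint
    (fun s => integrableOn_const_smul _ (hKint s))
  -- The majorant is rewritten with |e - 1|² = 2(1 - Re e), so its mean against the kernel is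
  -- computed from the weights at the μ i.
  have hsum := HasMean.sum Finset.univ (fun i _ =>
    (hasMean_realExp_mul_fejerKernel hv (hbox i)).const_smul (-(2 * C : ℝ) : ℂ))
    (fun i _ s => by rw [hμ i]; exact integrableOn_const_smul _ (hKeint i s))
  simp only [hμ] at hsum
  have hright := (hK.const_smul ((ε + 2 * C * Fintype.card ι : ℝ) : ℂ)).add hsum
    (fun s => integrableOn_const_smul _ (hKint s))
    (fun s => integrable_finsetSum _ fun i _ => integrableOn_const_smul _ (hKeint i s))
  have hbound := hleft.norm_le_re hright (fun s => (integrableOn_const_smul _ (hKint s)).add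
    (integrable_finsetSum _ fun i _ => integrableOn_const_smul _ (hKeint i s))) (fun t => by
      obtain ⟨r, hr0, hr⟩ := exists_fejerKernel_eq_ofReal v hN t
      rw [hr]
      have e1 : f (realShift z t) * (r : ℂ) - f z • (r : ℂ) = (f (realShift z t) - f z) * r := by
        rw [smul_eq_mul]; ring
      have e2 : (((ε + 2 * C * Fintype.card ι : ℝ) : ℂ) • (r : ℂ) +
          ∑ i, (-(2 * C : ℝ) : ℂ) • (realExp (b i) t * (r : ℂ))).re =
          (ε + C * ∑ i, ‖realExp (b i) t - 1‖ ^ 2) * r := by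
        simp_rw [norm_realExp_sub_one_sq]
        rw [Complex.add_re, Complex.re_sum]
        have e3 : ∀ i, ((-(2 * C : ℝ) : ℂ) • (realExp (b i) t * (r : ℂ))).re =
            -(2 * C) * ((realExp (b i) t).re * r) := by
          intro i
          rw [smul_eq_mul, ← Complex.ofReal_neg, Complex.re_ofReal_mul, Complex.re_mul_ofReal]
        simp_rw [e3]
        rw [smul_eq_mul, Complex.re_ofReal_mul, Complex.ofReal_re, ← Finset.mul_sum,
          ← Finset.sum_mul, ← Finset.mul_sum, Finset.sum_sub_distrib, Finset.sum_const,
          Finset.card_univ, nsmul_eq_mul]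
        ring
      rw [e1, e2, norm_mul, Complex.norm_real, Real.norm_of_nonneg hr0]
      exact mul_le_mul_of_nonneg_right (hmod t) hr0)
  rw [smul_eq_mul, mul_one] at hbound
  refine hbound.trans (le_of_eq ?_)
  rw [Complex.add_re, Complex.re_sum, smul_eq_mul, mul_one, Complex.ofReal_re]
  have e3 : ∀ i, ((-(2 * C : ℝ) : ℂ) • (fejerWeight N (μ i) : ℂ)).re =
      -(2 * C) * fejerWeight N (μ i) := by
    intro i
    rw [smul_eq_mul, ← Complex.ofReal_neg, Complex.re_ofReal_mul, Complex.ofReal_re]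
  simp_rw [e3]
  rw [← Finset.mul_sum, Finset.sum_sub_distrib, Finset.sum_const, Finset.card_univ, nsmul_eq_mul]
  ring

/-- If some |e^{i⟨t, b_i⟩} - 1| ≥ δ, the trivial bound 2|B| is absorbed by the sum, which is then at
least δ². Squares are used because they are trigonometric polynomials, with explicit kernel means.
-/
lemma TubeAP.exists_quadratic_modulus (hf : TubeAP b f) {Ω : Set (Fin n → ℝ)}
    (hΩ : Bornology.IsBounded Ω) {ε : ℝ} (hε : 0 < ε) :
    ∃ C, 0 ≤ C ∧ ∀ z ∈ tube Ω, ∀ t,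
      ‖f (realShift z t) - f z‖ ≤ ε + C * ∑ i, ‖realExp (b i) t - 1‖ ^ 2 := by
  obtain ⟨B, hB⟩ := hf.bounded Ω hΩ
  obtain ⟨δ, hδ, h⟩ := hf.modulus Ω hΩ ε hε
  refine ⟨2 * |B| / δ ^ 2, by positivity, fun z hz t => ?_⟩
  have hsum : 0 ≤ ∑ i, ‖realExp (b i) t - 1‖ ^ 2 := Finset.sum_nonneg fun _ _ => by positivity
  by_cases hall : ∀ i, ‖realExp (b i) t - 1‖ < δ
  · have := h t hall z hz
    have h2 : 0 ≤ 2 * |B| / δ ^ 2 * ∑ i, ‖realExp (b i) t - 1‖ ^ 2 := by positivity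
    linarith
  · push Not at hall
    obtain ⟨i, hi⟩ := hall
    have h1 : δ ^ 2 ≤ ∑ i, ‖realExp (b i) t - 1‖ ^ 2 :=
      (pow_le_pow_left₀ hδ.le hi 2).trans (Finset.single_le_sum
        (f := fun i => ‖realExp (b i) t - 1‖ ^ 2) (fun _ _ => by positivity) (Finset.mem_univ i))
    have h2 : ‖f (realShift z t) - f z‖ ≤ 2 * |B| := by
      have h3 := hB _ (realShift_mem_tube hz t)
      have h4 := hB z hz
      have h5 := norm_sub_le (f (realShift z t)) (f z)
      linarith [le_abs_self B]
    have h3 : 2 * |B| ≤ 2 * |B| / δ ^ 2 * ∑ i, ‖realExp (b i) t - 1‖ ^ 2 := by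
      rw [div_mul_eq_mul_div, le_div_iff₀ (by positivity)]
      gcongr
    linarith

end FejerSums

/-! ### Bochner–Fejér approximation -/

section BochnerFejer

variable {n : ℕ}

lemma lt_toNat_min_iff {r j : ℕ} {d : ℕ∞} :
    r < (min (j : ℕ∞) d).toNat ↔ r < j ∧ (r : ℕ∞) < d := by
  induction d using ENat.recTopCoe with
  | top => simp
  | coe d' =>
    rcases le_total j d' with h | h
    · rw [min_eq_left (by exact_mod_cast h), ENat.toNat_natCast, Nat.cast_lt]
      omega
    · rw [min_eq_right (by exact_mod_cast h), ENat.toNat_natCast, Nat.cast_lt]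
      omega

/-- The frequencies `ωᵣ / j!` of the `j`-th Bochner-Fejér sum. -/
def scaledFreq (d : ℕ∞) (ω : ℕ → Fin n → ℝ) (j : ℕ) (r : Fin (min (j : ℕ∞) d).toNat) : Fin n → ℝ :=
  (1 / (j ! : ℝ)) • ω r

lemma freqSum_scaledFreq (d : ℕ∞) (ω : ℕ → Fin n → ℝ) (j : ℕ)
    (ν : Fin (min (j : ℕ∞) d).toNat → ℤ) :
    freqSum (scaledFreq d ω j) ν = ∑ r, ((ν r : ℝ) / (j ! : ℝ)) • ω r := by
  refine Finset.sum_congr rfl fun r _ => ?_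
  rw [scaledFreq, smul_smul, mul_one_div]

lemma bochnerFejer_eq (d : ℕ∞) (ω : ℕ → Fin n → ℝ) (j : ℕ) (f : (Fin n → ℂ) → ℂ)
    (z : Fin n → ℂ) :
    bochnerFejer d ω j f z = ∑ ν ∈ fejerBox (Fin (min (j : ℕ∞) d).toNat) (j ! ^ 2),
      (fejerWeight (j ! ^ 2) ν : ℂ) * bohrTransform f (freqSum (scaledFreq d ω j) ν) *
        cplxExp (freqSum (scaledFreq d ω j) ν) z := by
  simp only [freqSum_scaledFreq, bochnerFejer, fejerBox, fejerWeight, cplxExp, Nat.cast_pow]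

lemma injective_freqSum_scaledFreq {d : ℕ∞} {ω : ℕ → Fin n → ℝ}
    (hω : LinearIndependent ℚ (fun r : {r : ℕ // (r : ℕ∞) < d} => ω r)) (j : ℕ) :
    Function.Injective (freqSum (scaledFreq d ω j)) := by
  intro ν ν' h
  rw [freqSum_scaledFreq, freqSum_scaledFreq, ← sub_eq_zero, ← Finset.sum_sub_distrib] at h
  have hinj : Function.Injective (fun r : Fin (min (j : ℕ∞) d).toNat =>
      (⟨r, (lt_toNat_min_iff.1 r.2).2⟩ : {r : ℕ // (r : ℕ∞) < d})) := by
    intro r r' hr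
    exact Fin.ext (congrArg (fun x : {r : ℕ // (r : ℕ∞) < d} => x.1) hr)
  have hli := hω.comp _ hinj
  rw [Fintype.linearIndependent_iff] at hli
  have h1 := hli (fun r => ((ν r - ν' r : ℤ) : ℚ)) (by
    have hj : (j ! : ℝ) ≠ 0 := by positivity
    have h2 : (j ! : ℝ) • ∑ r : Fin (min (j : ℕ∞) d).toNat,
        (((ν r : ℝ) / (j ! : ℝ)) • ω r - ((ν' r : ℝ) / (j ! : ℝ)) • ω r) = 0 := by
      rw [h, smul_zero]
    rw [Finset.smul_sum] at h2
    refine Eq.trans (Finset.sum_congr rfl fun r _ => ?_) h2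
    rw [← sub_smul, smul_smul, ← sub_div, mul_div_cancel₀ _ hj]
    funext k
    simp [Rat.smul_def])
  funext r
  have := h1 r
  rw [Int.cast_eq_zero, sub_eq_zero] at this
  exact this

/-- Vectors in the rational span of `ω` are integral combinations of the frequencies of the
Bochner-Fejér sums of large order, with moderately growing coefficients. -/
lemma exists_freqSum_eq {d : ℕ∞} {ω : ℕ → Fin n → ℝ} {x : Fin n → ℝ}
    (hx : x ∈ Submodule.span ℚ (ω '' {r : ℕ | (r : ℕ∞) < d})) :
    ∃ C : ℝ, ∀ᶠ j : ℕ in atTop, ∃ ν : Fin (min (j : ℕ∞) d).toNat → ℤ,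
      freqSum (scaledFreq d ω j) ν = x ∧ ∑ r, |(ν r : ℝ)| ≤ C * j ! := by
  obtain ⟨c, hc, rfl⟩ := (Finsupp.mem_span_image_iff_linearCombination ℚ).1 hx
  have hcz : ∀ r : ℕ, ¬ ((r : ℕ∞) < d) → c r = 0 := fun r hr => by
    by_contra h0
    exact hr ((Finsupp.mem_supported ℚ c).1 hc (Finsupp.mem_support_iff.2 h0))
  refine ⟨∑ r ∈ c.support, |(c r : ℝ)|, ?_⟩
  -- Once j exceeds every index used and is at least every denominator, each c r * j! is an integer
  -- and every needed ω r is available.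
  have hev : ∀ᶠ j : ℕ in atTop, ∀ r ∈ c.support, r < j ∧ (c r).den ≤ j := by
    refine (Filter.eventually_all_finset c.support).2 fun r _ => ?_
    exact (eventually_gt_atTop r).and (eventually_ge_atTop _)
  filter_upwards [hev] with j hj
  have hj0 : (j ! : ℝ) ≠ 0 := by positivity
  have hint : ∀ r, ∃ k : ℤ, (k : ℝ) = (c r : ℝ) * j ! := by
    intro r
    by_cases hr : r ∈ c.support
    · obtain ⟨e, he⟩ := Nat.dvd_factorial (c r).den_pos (hj r hr).2
      refine ⟨(c r).num * e, ?_⟩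
      have h1 : (c r : ℝ) * ((c r).den : ℝ) = (c r).num := by exact_mod_cast Rat.mul_den_eq_num (c r)
      rw [he]
      push_cast
      rw [← mul_assoc, h1]
    · exact ⟨0, by rw [Finsupp.notMem_support_iff.1 hr]; simp⟩
  choose k hk using hint
  set M := (min (j : ℕ∞) d).toNat with hM
  have hsub : c.support ⊆ Finset.range M := by
    intro r hr
    rw [Finset.mem_range, hM, lt_toNat_min_iff]
    refine ⟨(hj r hr).1, ?_⟩
    by_contra h0
    exact Finsupp.mem_support_iff.1 hr (hcz r h0)
  refine ⟨fun r => k r, ?_, ?_⟩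
  · rw [freqSum_scaledFreq, Finsupp.linearCombination_apply, Finsupp.sum]
    have h1 : ∀ r : Fin M, (((k r : ℤ) : ℝ) / (j ! : ℝ)) • ω r = (c r : ℚ) • ω r := by
      intro r
      rw [hk, mul_div_cancel_right₀ _ hj0]
      funext i
      simp [Rat.smul_def]
    rw [Finset.sum_congr rfl fun r _ => h1 r, Fin.sum_univ_eq_sum_range (fun r => c r • ω r) M]
    refine (Finset.sum_subset hsub fun r _ hr => ?_).symm
    rw [Finsupp.notMem_support_iff.1 hr, zero_smul]
  · have h1 : ∀ r : Fin M, |((k r : ℤ) : ℝ)| = |(c r : ℝ)| * j ! := by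
      intro r
      rw [hk, abs_mul, abs_of_nonneg (by positivity : (0 : ℝ) ≤ j !)]
    rw [Finset.sum_congr rfl fun r _ => h1 r, Fin.sum_univ_eq_sum_range
      (fun r => |(c r : ℝ)| * (j ! : ℝ)) M, ← Finset.sum_mul]
    refine mul_le_mul_of_nonneg_right (le_of_eq ?_) (by positivity)
    refine (Finset.sum_subset hsub fun r _ hr => ?_).symm
    rw [Finsupp.notMem_support_iff.1 hr]; simp

/-- **Bochner-Fejér approximation**. -/
theorem TubeAP.tendstoUniformlyOn_bochnerFejer {ι : Type*} [Fintype ι] {b : ι → Fin n → ℝ}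
    {f : (Fin n → ℂ) → ℂ} (hf : TubeAP b f) {d : ℕ∞} {ω : ℕ → Fin n → ℝ}
    (hω : LinearIndependent ℚ (fun r : {r : ℕ // (r : ℕ∞) < d} => ω r))
    (hb : ∀ i, b i ∈ Submodule.span ℚ (ω '' {r : ℕ | (r : ℕ∞) < d})) {Ω : Set (Fin n → ℝ)}
    (hΩ : Bornology.IsBounded Ω) :
    TendstoUniformlyOn (fun j z => bochnerFejer d ω j f z) f atTop (tube Ω) := by
  rw [Metric.tendstoUniformlyOn_iff]
  intro ε hε
  obtain ⟨C, hC0, hC⟩ := hf.exists_quadratic_modulus hΩ (ε := ε / 2) (by positivity)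
  choose c hc using fun i => exists_freqSum_eq (hb i)
  have hfac : Tendsto (fun j : ℕ => (j ! : ℝ)) atTop atTop :=
    tendsto_natCast_atTop_atTop.comp (tendsto_atTop_mono Nat.self_le_factorial tendsto_id)
  have hlim : Tendsto (fun j : ℕ => 2 * C * ∑ i, c i / (j ! : ℝ)) atTop (𝓝 0) := by
    have := (tendsto_finsetSum Finset.univ fun i _ =>
      (tendsto_const_nhds (x := c i)).div_atTop hfac).const_mul (2 * C)
    simpa using this
  have hev : ∀ᶠ j : ℕ in atTop, ∀ i ∈ (Finset.univ : Finset ι), c i ≤ (j ! : ℝ) :=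
    (Filter.eventually_all_finset _).2 fun i _ => hfac.eventually_ge_atTop _
  have hc' : ∀ᶠ j : ℕ in atTop, ∀ i ∈ (Finset.univ : Finset ι),
      ∃ ν : Fin (min (j : ℕ∞) d).toNat → ℤ,
      freqSum (scaledFreq d ω j) ν = b i ∧ ∑ r, |(ν r : ℝ)| ≤ c i * j ! :=
    (Filter.eventually_all_finset _).2 fun i _ => hc i
  filter_upwards [hev, hc', hlim.eventually (gt_mem_nhds (half_pos hε))] with j hj hcj hlimj z hz
  choose μ hμ hμC using fun i => hcj i (Finset.mem_univ i)
  have hjpos : (0 : ℝ) < j ! := by positivity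
  -- The coefficients grow like c i * j!, which is at most (j!)² as soon as c i ≤ j!.
  have hle : ∀ i r, |(μ i r : ℝ)| ≤ (j ! : ℝ) ^ 2 := by
    intro i r
    have h1 : |(μ i r : ℝ)| ≤ ∑ r, |(μ i r : ℝ)| :=
      Finset.single_le_sum (f := fun r => |(μ i r : ℝ)|) (fun _ _ => abs_nonneg _)
        (Finset.mem_univ r)
    have h2 := hj i (Finset.mem_univ i)
    nlinarith [hμC i]
  have hbox : ∀ i, μ i ∈ fejerBox (Fin (min (j : ℕ∞) d).toNat) (j ! ^ 2) := by
    intro i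
    rw [fejerBox, Fintype.mem_piFinset]
    intro r
    rw [Finset.mem_Icc, ← abs_le]
    have := hle i r
    exact_mod_cast this
  have hest := hf.norm_fejerSum_sub_le (injective_freqSum_scaledFreq hω j)
    (by positivity : 0 < j ! ^ 2) hμ hbox (hC z hz)
  rw [← bochnerFejer_eq] at hest
  -- The box size (j!)² beats the coefficient size c i * j! by a factor of order j!, so the weights
  -- tend to 1.
  have hw : ∀ i, 1 - fejerWeight (j ! ^ 2) (μ i) ≤ c i / (j ! : ℝ) := by
    intro i
    have h1 := one_sub_sum_le_prod_one_sub Finset.univ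
      (fun r => |(μ i r : ℝ)| / ((j ! ^ 2 : ℕ) : ℝ)) (fun r _ => by positivity) (fun r _ => by
        rw [div_le_one (by positivity)]
        push_cast
        exact hle i r)
    rw [← Finset.sum_div] at h1
    have h2 : (∑ r, |(μ i r : ℝ)|) / ((j ! ^ 2 : ℕ) : ℝ) ≤ c i / (j ! : ℝ) := by
      rw [div_le_div_iff₀ (by positivity) hjpos]
      push_cast
      nlinarith [hμC i]
    rw [fejerWeight]
    linarith
  have hsum : 2 * C * ∑ i, (1 - fejerWeight (j ! ^ 2) (μ i)) ≤ 2 * C * ∑ i, c i / (j ! : ℝ) :=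
    mul_le_mul_of_nonneg_left (Finset.sum_le_sum fun i _ => hw i) (by positivity)
  rw [dist_comm, dist_eq_norm]
  linarith

end BochnerFejer

/-! ### The frequency lattice: periods and closedness -/

section Lattice

variable {n m r : ℕ}

lemma exists_dual_vectors {b : Fin r → Fin n → ℝ} (hb : LinearIndependent ℝ b) :
    ∃ β : Fin r → Fin n → ℝ, ∀ θ : Fin r → ℝ, ∀ i, dotProduct (∑ j, θ j • β j) (b i) = θ i := by
  classical
  -- The coordinates on the span extend linearly to ℝⁿ; the dual vectors represent the extended
  -- coordinates under the dot product.
  obtain ⟨g, hg⟩ := LinearMap.exists_extend hb.repr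
  have hgb : ∀ i, g (b i) = Finsupp.single i 1 := by
    intro i
    have h1 := LinearMap.congr_fun hg ⟨b i, Submodule.subset_span ⟨i, rfl⟩⟩
    have h2 := hb.repr_eq_single i ⟨b i, Submodule.subset_span ⟨i, rfl⟩⟩ rfl
    exact h1.trans h2
  refine ⟨fun j k => g (Pi.single k 1) j, fun θ i => ?_⟩
  have h3 : ∀ j, dotProduct (fun k => g (Pi.single k 1) j) (b i) = if i = j then 1 else 0 := by
    intro j
    have h4 : g (b i) j = ∑ k, b i k * g (Pi.single k 1) j := by
      conv_lhs => rw [pi_eq_sum_univ' (b i)]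
      rw [map_sum, Finsupp.finsetSum_apply]
      refine Finset.sum_congr rfl fun k _ => ?_
      rw [map_smul, Finsupp.smul_apply, smul_eq_mul]
    rw [hgb, Finsupp.single_apply] at h4
    rw [h4, dotProduct]
    exact Finset.sum_congr rfl fun k _ => mul_comm _ _
  rw [sum_dotProduct]
  simp [smul_dotProduct, h3]

/-- The arguments of the exponentials with frequencies `b` at `x`. -/
def argVec (b : Fin r → Fin n → ℝ) (x : Fin n → ℝ) (i : Fin r) : ℝ := (realExp (b i) x).arg

lemma exp_arg_mul_I {w : ℂ} (hw : ‖w‖ = 1) : Complex.exp (w.arg * Complex.I) = w := by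
  have := Complex.norm_mul_exp_arg_mul_I w
  rwa [hw, Complex.ofReal_one, one_mul] at this

/-- Subtracting the combination of dual vectors with the phases of x leaves an element of the dual
lattice. -/
lemma realExp_sub_argVec {b β : Fin r → Fin n → ℝ}
    (hβ : ∀ θ : Fin r → ℝ, ∀ i, dotProduct (∑ j, θ j • β j) (b i) = θ i) (x : Fin n → ℝ)
    (i : Fin r) : realExp (b i) (x - ∑ j, argVec b x j • β j) = 1 := by
  rw [sub_eq_add_neg, realExp_add_right, realExp_neg_right, realExp_eq (b i) (∑ j, _), hβ, argVec,
    exp_arg_mul_I (norm_realExp _ _), mul_inv_cancel₀ (realExp_ne_zero _ _)]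

lemma realExp_eq_one_of_span {b : Fin r → Fin n → ℝ} {τ : Fin n → ℝ}
    (hτ : ∀ i, realExp (b i) τ = 1) (c : Fin r → ℤ) : realExp (∑ i, c i • b i) τ = 1 := by
  rw [realExp_sum]
  refine Finset.prod_eq_one fun i _ => ?_
  rw [← Int.cast_smul_eq_zsmul ℝ, realExp_intCast_smul, hτ, one_zpow]

/-- If the spectra lie in the lattice generated by `b`, then the vectors of the dual lattice are
periods. -/
lemma IsHAP.periodic {F : (Fin n → ℂ) → (Fin m → ℂ)} (hF : IsHAP F) {b : Fin r → Fin n → ℝ}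
    (hspan : ∀ l ∈ allSpectra F, ∃ c : Fin r → ℤ, l = ∑ i, c i • b i) {τ : Fin n → ℝ}
    (hτ : ∀ i, realExp (b i) τ = 1) (z : Fin n → ℂ) : F (realShift z τ) = F z := by
  obtain ⟨d, hd, hFd⟩ := hF.exists_gauge
  funext l
  refine periodic_of_bohrSpectrum (f := fun z => F z l)
    (differentiable_pi.1 hF.holomorphic l) hd (hFd.component l) (fun μ hμ => ?_) z
  obtain ⟨c, rfl⟩ := hspan μ (Set.mem_iUnion.2 ⟨l, hμ⟩)
  exact realExp_eq_one_of_span hτ c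

/-- If all phases of t are small, t differs by a period from a small vector s = Σ arg · β, and
uniform continuity applies to s. -/
lemma IsHAP.tubeAP {F : (Fin n → ℂ) → (Fin m → ℂ)} (hF : IsHAP F) {b : Fin r → Fin n → ℝ}
    (hb : LinearIndependent ℝ b)
    (hspan : ∀ l ∈ allSpectra F, ∃ c : Fin r → ℤ, l = ∑ i, c i • b i) (l : Fin m) :
    TubeAP b (fun z => F z l) := by
  obtain ⟨β, hβ⟩ := exists_dual_vectors hb
  refine ⟨differentiable_pi.1 hF.holomorphic l, fun Ω hΩ => ?_, fun Ω hΩ ε hε => ?_⟩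
  · obtain ⟨B, hB⟩ := hF.exists_bound hΩ
    exact ⟨B, fun z hz => (norm_le_pi_norm (F z) l).trans (hB z hz)⟩
  · obtain ⟨ρ, hρ, hmod⟩ := hF.exists_modulus hΩ hε
    have hβ0 : 0 ≤ ∑ j, ‖β j‖ := Finset.sum_nonneg fun _ _ => norm_nonneg _
    -- Chosen so that phases of size at most η give ‖s‖ < ρ; the 1 keeps the denominator positive.
    set η : ℝ := ρ / (1 + ∑ j, ‖β j‖) with hη
    have hηpos : 0 < η := by positivity
    have hcont : ContinuousAt Complex.arg 1 := Complex.continuousAt_arg (by simp)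
    obtain ⟨δ, hδ, harg⟩ := Metric.continuousAt_iff.1 hcont η hηpos
    refine ⟨δ, hδ, fun t ht z hz => ?_⟩
    set s : Fin n → ℝ := ∑ j, argVec b t j • β j with hs
    have hθ : ∀ j, |argVec b t j| ≤ η := by
      intro j
      have := harg (x := realExp (b j) t) (by rw [dist_eq_norm]; exact ht j)
      rw [Complex.arg_one, dist_zero_right, Real.norm_eq_abs] at this
      exact this.le
    have hsn : ‖s‖ < ρ := by
      calc ‖s‖ ≤ ∑ j, ‖argVec b t j • β j‖ := norm_sum_le _ _
        _ ≤ ∑ j, η * ‖β j‖ := by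
            refine Finset.sum_le_sum fun j _ => ?_
            rw [norm_smul, Real.norm_eq_abs]
            exact mul_le_mul_of_nonneg_right (hθ j) (norm_nonneg _)
        _ = ρ * (∑ j, ‖β j‖) / (1 + ∑ j, ‖β j‖) := by
            rw [← Finset.mul_sum, hη, div_mul_eq_mul_div]
        _ < ρ := by rw [div_lt_iff₀ (by positivity)]; nlinarith
    have e : F (realShift z t) = F (realShift z s) := by
      have := hF.periodic hspan (τ := t - s) (realExp_sub_argVec hβ t) (realShift z s)
      rwa [realShift_realShift, add_sub_cancel] at this
    have h1 := hmod s hsn z hz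
    rw [← e] at h1
    exact (norm_le_pi_norm (F (realShift z t) - F z) l).trans h1

/-- The imaginary parts of the zeros form a closed set. -/
lemma IsHAP.isClosed_imPart_zeroLocus {F : (Fin n → ℂ) → (Fin m → ℂ)} (hF : IsHAP F)
    {b : Fin r → Fin n → ℝ} (hb : LinearIndependent ℝ b)
    (hspan : ∀ l ∈ allSpectra F, ∃ c : Fin r → ℤ, l = ∑ i, c i • b i) :
    IsClosed (imPart '' zeroLocus F) := by
  obtain ⟨β, hβ⟩ := exists_dual_vectors hb
  set K : Set (Fin r → ℝ) := Set.univ.pi fun _ => Set.Icc (-Real.pi) Real.pi with hK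
  have hKc : IsCompact K := isCompact_univ_pi fun _ => isCompact_Icc
  have hKs : CompactSpace K := isCompact_iff_compactSpace.1 hKc
  set P : K × (Fin n → ℝ) → Fin n → ℂ := fun p =>
    toComplex (∑ j, p.1.1 j • β j) + Complex.I • toComplex p.2 with hP
  have hPc : Continuous P := by
    have h1 : Continuous fun p : K × (Fin n → ℝ) => ∑ j, p.1.1 j • β j :=
      continuous_finsetSum _ fun j _ =>
        ((continuous_apply j).comp (continuous_subtype_val.comp continuous_fst)).smul
          continuous_const
    have h2 : Continuous fun p : K × (Fin n → ℝ) => Complex.I • toComplex p.2 :=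
      (continuous_toComplex.comp continuous_snd).const_smul Complex.I
    exact (continuous_toComplex.comp h1).add h2
  have hPim : ∀ p, imPart (P p) = p.2 := by
    intro p
    funext k
    simp [hP, imPart, toComplex]
  have hclosed : IsClosed {p : K × (Fin n → ℝ) | F (P p) = 0} :=
    isClosed_eq (hF.holomorphic.continuous.comp hPc) continuous_const
  -- Projection along the compact box of phases is a closed map.
  have himg := isClosedMap_snd_of_compactSpace _ hclosed
  convert himg using 1
  ext y
  constructor
  · rintro ⟨z, hz, rfl⟩
    set x : Fin n → ℝ := fun k => (z k).re with hx
    refine ⟨(⟨argVec b x, fun i _ => ⟨(Complex.neg_pi_lt_arg _).le, Complex.arg_le_pi _⟩⟩,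
      imPart z), ?_, rfl⟩
    set p : K × (Fin n → ℝ) := (⟨argVec b x, fun i _ => ⟨(Complex.neg_pi_lt_arg _).le,
      Complex.arg_le_pi _⟩⟩, imPart z) with hp
    -- A zero z is moved by a period to the point of the compact family with the same phases and
    -- imaginary part.
    have h1 := hF.periodic hspan (realExp_sub_argVec hβ x) (P p)
    have h2 : realShift (P p) (x - ∑ j, argVec b x j • β j) = z := by
      funext k
      simp only [realShift, hP, hp, hx, toComplex, imPart, Pi.add_apply, Pi.smul_apply,
        Pi.sub_apply, smul_eq_mul, Complex.ofReal_sub]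
      conv_rhs => rw [← Complex.re_add_im (z k)]
      ring
    rw [h2] at h1
    exact h1.symm.trans hz
  · rintro ⟨p, hp, rfl⟩
    exact ⟨P p, hp, hPim p⟩

/-- A basis with as many elements as the real dimension of its span is independent over ℝ. A
finitely generated subgroup of ℚⁿ is free, being torsion-free, and for rational vectors independence
over ℤ, ℚ and ℝ is the same. -/
lemma exists_lattice_basis {F : (Fin n → ℂ) → (Fin m → ℂ)}
    (hΞ : (Module.Free ℤ (freqModule F) ∧ Module.Finite ℤ (freqModule F) ∧
            Module.finrank ℤ (freqModule F) =
              Module.finrank ℝ (Submodule.span ℝ (freqModule F : Set (Fin n → ℝ)))) ∨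
          ((freqModule F).FG ∧ ∀ l ∈ freqModule F, ∀ k, ∃ q : ℚ, l k = (q : ℝ))) :
    ∃ (r : ℕ) (b : Fin r → Fin n → ℝ), LinearIndependent ℝ b ∧ (∀ i, b i ∈ freqModule F) ∧
      ∀ l ∈ freqModule F, ∃ c : Fin r → ℤ, l = ∑ i, c i • b i := by
  have hfree : Module.Free ℤ (freqModule F) ∧ Module.Finite ℤ (freqModule F) := by
    rcases hΞ with h | h
    · exact ⟨h.1, h.2.1⟩
    · have hfin : Module.Finite ℤ (freqModule F) :=
        Module.Finite.iff_addGroup_fg.2 ((AddGroup.fg_iff_addSubgroup_fg _).2 h.1)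
      exact ⟨inferInstance, hfin⟩
  obtain ⟨hfr, hfin⟩ := hfree
  set B := Module.finBasis ℤ (freqModule F) with hB
  set b : Fin (Module.finrank ℤ (freqModule F)) → Fin n → ℝ := fun i => (B i : Fin n → ℝ) with hb
  have hrepr : ∀ l ∈ freqModule F, ∃ c : Fin (Module.finrank ℤ (freqModule F)) → ℤ,
      l = ∑ i, c i • b i := by
    intro l hl
    refine ⟨fun i => B.repr ⟨l, hl⟩ i, ?_⟩
    have h1 := congrArg (freqModule F).subtype (B.sum_repr ⟨l, hl⟩)
    rw [map_sum] at h1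
    exact h1.symm
  refine ⟨_, b, ?_, fun i => (B i).2, hrepr⟩
  rcases hΞ with h | h
  · rw [linearIndependent_iff_card_eq_finrank_span, Fintype.card_fin, Set.finrank]
    have e : Submodule.span ℝ (Set.range b) =
        Submodule.span ℝ (freqModule F : Set (Fin n → ℝ)) := by
      refine le_antisymm (Submodule.span_mono ?_) (Submodule.span_le.2 fun l hl => ?_)
      · rintro _ ⟨i, rfl⟩
        exact (B i).2
      · obtain ⟨c, rfl⟩ := hrepr l hl
        exact Submodule.sum_mem _ fun i _ =>
          zsmul_mem (Submodule.subset_span (Set.mem_range_self i)) _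
    rw [e]
    exact h.2.2
  · choose q hq using fun i => h.2 (b i) (B i).2
    have hqb : (fun i => algebraMap ℚ ℝ ∘ q i) = b := by
      funext i k
      exact (hq i k).symm
    rw [← hqb, linearIndependent_algebraMap_comp_iff, ← LinearIndependent.iff_fractionRing ℤ ℚ,
      Fintype.linearIndependent_iff]
    intro c hc
    have hBli := Fintype.linearIndependent_iff.1 B.linearIndependent c
    refine hBli (Subtype.ext ?_)
    have h1 : ((∑ i, c i • B i : freqModule F) : Fin n → ℝ) = ∑ i, c i • b i := by
      change (freqModule F).subtype (∑ i, c i • B i) = _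
      rw [map_sum]
      rfl
    rw [h1, ← hqb]
    funext k
    have h2 := congrArg (fun x : ℚ => (x : ℝ)) (congrFun hc k)
    simpa using h2

end Lattice

/-! ### Perturbation by characters as translation -/

section Perturbation

variable {n m r : ℕ}

/-- The dual vectors prescribe the phases ⟨τ, b_i⟩ = arg χ(b_i); both sides are multiplicative, so
they agree on the whole lattice. No continuity of χ is needed. -/
lemma exists_realExp_eq_char {G : AddSubgroup (Fin n → ℝ)} (χ : AddChar G Circle)
    {b : Fin r → Fin n → ℝ} (hb : LinearIndependent ℝ b) (hbG : ∀ i, b i ∈ G) :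
    ∃ τ : Fin n → ℝ, ∀ (c : Fin r → ℤ) (l : G), (l : Fin n → ℝ) = ∑ i, c i • b i →
      (χ l : ℂ) = realExp l τ := by
  obtain ⟨β, hβ⟩ := exists_dual_vectors hb
  refine ⟨∑ j, ((χ ⟨b j, hbG j⟩ : ℂ).arg) • β j, fun c l hl => ?_⟩
  have h1 : l = ∑ i, c i • (⟨b i, hbG i⟩ : G) := by
    refine Subtype.ext ?_
    change _ = G.subtype _
    rw [map_sum, hl]
    rfl
  have h2 : χ l = ∏ i, χ ⟨b i, hbG i⟩ ^ c i := by
    have h0 : ∀ S : Finset (Fin r), χ (∑ i ∈ S, c i • (⟨b i, hbG i⟩ : G)) =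
        ∏ i ∈ S, χ ⟨b i, hbG i⟩ ^ c i := by
      intro S
      induction S using Finset.induction_on with
      | empty => simp
      | insert i S hi ih =>
        rw [Finset.sum_insert hi, Finset.prod_insert hi, AddChar.map_add_eq_mul, ih,
          AddChar.map_zsmul_eq_zpow]
    rw [h1, h0]
  have h3 : (χ l : ℂ) = ∏ i, ((χ ⟨b i, hbG i⟩ : ℂ)) ^ c i := by
    have := congrArg Circle.coeHom h2
    rw [map_prod] at this
    simp only [map_zpow] at this
    exact this
  rw [h3, hl, realExp_sum]
  refine Finset.prod_congr rfl fun i _ => ?_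
  rw [← Int.cast_smul_eq_zsmul ℝ, realExp_intCast_smul, realExp_eq, hβ, exp_arg_mul_I]
  exact Circle.norm_coe _

lemma bohrTransform_expSum {α : Type*} (S : Finset α) (a : α → ℂ) (p : α → Fin n → ℝ)
    (l : Fin n → ℝ) [∀ ν, Decidable (p ν = l)] :
    bohrTransform (fun z => ∑ ν ∈ S, a ν * cplxExp (p ν) z) l =
      ∑ ν ∈ S, if p ν = l then a ν else 0 := by
  classical
  refine bohrTransform_eq ?_
  have h1 := HasMean.sum S (fun ν _ => (hasMean_realExp (p ν + -l)).const_smul (a ν))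
    (fun ν _ s => integrableOn_const_smul _ (integrableOn_realExp _ s))
  have e : ∀ ν, (a ν • if p ν + -l = 0 then (1 : ℂ) else 0) = if p ν = l then a ν else 0 := by
    intro ν
    by_cases h : p ν = l
    · rw [if_pos h, if_pos (by rw [h, add_neg_cancel]), smul_eq_mul, mul_one]
    · rw [if_neg h, if_neg (by rwa [← sub_eq_add_neg, sub_eq_zero]), smul_zero]
  simp only [e] at h1
  refine Eq.mp ?_ h1
  congr 1
  funext x
  rw [Finset.sum_mul]
  refine Finset.sum_congr rfl fun ν _ => ?_
  rw [realExp_add_left, cplxExp_toComplex, smul_eq_mul, mul_assoc]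

/-- Perturbing an exponential sum by the restriction of an exponential is a translation. -/
lemma perturbExpSum_eq {G : AddSubgroup (Fin n → ℝ)} (χ : AddChar G Circle) {α : Type*}
    (S : Finset α) (a : α → ℂ) (p : α → Fin n → ℝ) {τ : Fin n → ℝ}
    (h : ∀ ν ∈ S, a ν ≠ 0 → ∃ hG : p ν ∈ G, (χ ⟨p ν, hG⟩ : ℂ) = realExp (p ν) τ)
    (z : Fin n → ℂ) :
    perturbExpSum χ (fun z => ∑ ν ∈ S, a ν * cplxExp (p ν) z) z =
      ∑ ν ∈ S, a ν * cplxExp (p ν) (realShift z τ) := by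
  classical
  have e : ∀ l : G, bohrTransform (fun z => ∑ ν ∈ S, a ν * cplxExp (p ν) z) l * (χ l : ℂ) *
      Complex.exp (Complex.I * pairing z l) =
      ∑ ν ∈ S, if p ν = l then a ν * (χ l : ℂ) * cplxExp l z else 0 := by
    intro l
    rw [bohrTransform_expSum, Finset.sum_mul, Finset.sum_mul]
    refine Finset.sum_congr rfl fun ν _ => ?_
    rw [ite_mul, ite_mul, zero_mul, zero_mul]
    rfl
  rw [perturbExpSum]
  simp only [e]
  have hsupp : ∀ ν (l : G), (if p ν = l then a ν * (χ l : ℂ) * cplxExp l z else 0) ≠ 0 →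
      p ν = l := by
    intro ν l hne
    by_contra h0
    exact hne (if_neg h0)
  -- The interchange is legitimate because each ν contributes to at most one l.
  rw [finsum_sum_comm]
  · refine Finset.sum_congr rfl fun ν hν => ?_
    by_cases ha : a ν = 0
    · simp [ha]
    · obtain ⟨hG, hχ⟩ := h ν hν ha
      rw [finsum_eq_single _ (⟨p ν, hG⟩ : G)]
      · rw [if_pos rfl, hχ, cplxExp_realShift]
        ring
      · intro l hl
        exact if_neg fun h0 => hl (Subtype.ext h0.symm)
  · intro ν _
    refine Set.Subsingleton.finite fun l hl l' hl' => Subtype.ext ?_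
    exact (hsupp ν l hl).symm.trans (hsupp ν l' hl')

lemma IsHAP.realShift {F : (Fin n → ℂ) → (Fin m → ℂ)} (hF : IsHAP F) (τ : Fin n → ℝ) :
    IsHAP (fun z => F (realShift z τ)) := by
  refine ⟨hF.holomorphic.comp (differentiable_id.add_const (toComplex τ)), fun ε hε Ω hΩ => ?_⟩
  obtain ⟨t, ht, h⟩ := hF.almostPeriodic ε hε Ω hΩ
  refine ⟨t, ht, fun ξ => ?_⟩
  obtain ⟨σ, hσ, δ, hδ, hz⟩ := h ξ
  refine ⟨σ, hσ, δ, hδ, fun z hzΩ l => ?_⟩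
  have := hz (_root_.realShift z τ) (realShift_mem_tube hzΩ τ) l
  rwa [realShift_realShift, add_comm τ σ, ← realShift_realShift] at this

lemma tendstoUniformlyOn_pi {α : Type*} {S : Set α} {G : ℕ → α → Fin m → ℂ} {H : α → Fin m → ℂ}
    (h : ∀ l, TendstoUniformlyOn (fun j z => G j z l) (fun z => H z l) atTop S) :
    TendstoUniformlyOn G H atTop S := by
  rw [Metric.tendstoUniformlyOn_iff]
  intro ε hε
  have h1 := eventually_all.2 fun l => Metric.tendstoUniformlyOn_iff.1 (h l) ε hε
  filter_upwards [h1] with j hj z hz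
  rw [dist_pi_lt_iff hε]
  exact fun l => hj l z hz

lemma TendstoHAP.unique {G : ℕ → (Fin n → ℂ) → (Fin m → ℂ)} {H H' : (Fin n → ℂ) → (Fin m → ℂ)}
    (h : TendstoHAP G H) (h' : TendstoHAP G H') : H = H' := by
  funext z
  exact tendsto_nhds_unique
    ((h {imPart z} (isBounded_imPart_singleton z)).tendsto_at (Set.mem_singleton (imPart z)))
    ((h' {imPart z} (isBounded_imPart_singleton z)).tendsto_at (Set.mem_singleton (imPart z)))

end Perturbation

/-! ### Identification of the perturbed mappings -/

section Main

variable {n m : ℕ}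

/-- The perturbations of `F` are its translates by real vectors. -/
lemma exists_isPerturbed_iff {F : (Fin n → ℂ) → (Fin m → ℂ)} (hF : IsHAP F)
    {d : ℕ∞} {ω : ℕ → Fin n → ℝ} (hω : IsFreqBasis F d ω)
    {G : AddSubgroup (Fin n → ℝ)} (hG : allSpectra F ⊆ (G : Set (Fin n → ℝ))) {r : ℕ}
    {b : Fin r → Fin n → ℝ} (hb : LinearIndependent ℝ b) (hbF : ∀ i, b i ∈ freqModule F)
    (hspan : ∀ l ∈ freqModule F, ∃ c : Fin r → ℤ, l = ∑ i, c i • b i) (χ : AddChar G Circle) :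
    ∃ τ : Fin n → ℝ, ∀ H, IsPerturbed d ω F χ H ↔ H = fun z => F (realShift z τ) := by
  have hle : freqModule F ≤ G := (AddSubgroup.closure_le G).2 hG
  have hsub : ∀ l ∈ allSpectra F, l ∈ freqModule F := fun l hl => AddSubgroup.subset_closure hl
  have hspan' : ∀ l ∈ allSpectra F, ∃ c : Fin r → ℤ, l = ∑ i, c i • b i := fun l hl =>
    hspan l (hsub l hl)
  obtain ⟨τ, hτ⟩ := exists_realExp_eq_char χ hb fun i => hle (hbF i)
  have hpert : ∀ j z l, perturbExpSum χ (bochnerFejer d ω j fun w => F w l) z =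
      bochnerFejer d ω j (fun w => F w l) (realShift z τ) := by
    intro j z l
    have e : bochnerFejer d ω j (fun w => F w l) = fun z =>
        ∑ ν ∈ fejerBox (Fin (min (j : ℕ∞) d).toNat) (j ! ^ 2),
          ((fejerWeight (j ! ^ 2) ν : ℂ) *
            bohrTransform (fun w => F w l) (freqSum (scaledFreq d ω j) ν)) *
            cplxExp (freqSum (scaledFreq d ω j) ν) z :=
      funext fun z => bochnerFejer_eq d ω j _ z
    rw [e]
    refine perturbExpSum_eq χ _ _ _ (fun ν _ hne => ?_) z
    -- Many indices of the Bochner–Fejér sum give frequencies outside `G`; those with a nonzero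
    -- coefficient lie in the spectrum.
    have hmem : freqSum (scaledFreq d ω j) ν ∈ allSpectra F :=
      Set.mem_iUnion.2 ⟨l, right_ne_zero_of_mul hne⟩
    obtain ⟨c, hc⟩ := hspan' _ hmem
    exact ⟨hG hmem, hτ c ⟨_, hG hmem⟩ hc⟩
  have hbω : ∀ i, b i ∈ Submodule.span ℚ (ω '' {r : ℕ | (r : ℕ∞) < d}) := fun i => by
    rw [hω.span_eq]
    exact Submodule.subset_span (hbF i)
  have hconv : TendstoHAP
      (fun j z l => perturbExpSum χ (bochnerFejer d ω j (fun w => F w l)) z)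
      (fun z => F (realShift z τ)) := by
    intro Ω hΩ
    refine tendstoUniformlyOn_pi fun l => ?_
    simp only [hpert]
    have h1 := (hF.tubeAP hb hspan' l).tendstoUniformlyOn_bochnerFejer hω.linearIndependent hbω hΩ
    rw [Metric.tendstoUniformlyOn_iff] at h1 ⊢
    intro ε hε
    filter_upwards [h1 ε hε] with j hj z hz
    -- Tubes are invariant under real translations, so the convergence is transported unchanged.
    exact hj _ (realShift_mem_tube hz τ)
  refine ⟨τ, fun H => ⟨fun h => h.tendsto.unique hconv, ?_⟩⟩
  rintro rfl
  exact ⟨hF.realShift τ, hconv⟩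

lemma imPart_image_zeroLocus_realShift (F : (Fin n → ℂ) → (Fin m → ℂ)) (τ : Fin n → ℝ) :
    imPart '' zeroLocus (fun z => F (realShift z τ)) = imPart '' zeroLocus F := by
  ext y
  constructor
  · rintro ⟨z, hz, rfl⟩
    exact ⟨realShift z τ, hz, imPart_realShift z τ⟩
  · rintro ⟨z, hz, rfl⟩
    refine ⟨realShift z (-τ), ?_, imPart_realShift z (-τ)⟩
    change F (realShift (realShift z (-τ)) τ) = 0
    rw [realShift_realShift, neg_add_cancel]
    have : realShift z 0 = z := by funext k; simp [realShift]
    rw [this]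
    exact hz

end Main
end

/-- The `𝒴`-amoeba is formed with an arbitrary `ℚ`-basis of `lin_ℚ Ξ_F` and an arbitrary subgroup
`G` of `ℝⁿ` containing the spectra of the components of `F`. -/
theorem lemma4p3 {n m : ℕ} (F : (Fin n → ℂ) → (Fin m → ℂ)) (hF : IsHAP F)
    (d : ℕ∞) (ω : ℕ → Fin n → ℝ) (hω : IsFreqBasis F d ω)
    (G : AddSubgroup (Fin n → ℝ)) (hG : allSpectra F ⊆ (G : Set (Fin n → ℝ)))
    (hΞ : (Module.Free ℤ (freqModule F) ∧ Module.Finite ℤ (freqModule F) ∧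
            Module.finrank ℤ (freqModule F) =
              Module.finrank ℝ (Submodule.span ℝ (freqModule F : Set (Fin n → ℝ)))) ∨
          ((freqModule F).FG ∧ ∀ l ∈ freqModule F, ∀ k, ∃ q : ℚ, l k = (q : ℝ))) :
    yAmoeba d ω G F = imPart '' zeroLocus F ∧
      imPart '' zeroLocus F = amoeba F ∧
      IsClosed (imPart '' zeroLocus F) := by
  obtain ⟨r, b, hb, hbF, hspan⟩ := exists_lattice_basis hΞ
  have hclosed : IsClosed (imPart '' zeroLocus F) :=
    hF.isClosed_imPart_zeroLocus hb fun l hl => hspan l (AddSubgroup.subset_closure hl)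
  refine ⟨?_, hclosed.closure_eq.symm, hclosed⟩
  ext y
  simp only [yAmoeba, Set.mem_iUnion]
  constructor
  · rintro ⟨χ, H, hH, hy⟩
    obtain ⟨τ, hτ⟩ := exists_isPerturbed_iff hF hω hG hb hbF hspan χ
    rw [(hτ H).1 hH, imPart_image_zeroLocus_realShift] at hy
    exact hy
  · intro hy
    -- Any character would do, since each perturbation is a real translate of F with the same Im V.
    obtain ⟨τ, hτ⟩ := exists_isPerturbed_iff hF hω hG hb hbF hspan (1 : AddChar G Circle)
    refine ⟨1, _, (hτ _).2 rfl, ?_⟩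
    rw [imPart_image_zeroLocus_realShift]
    exact hy
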